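/- Let $\Omega\subset\mathbb R^2$ be a bounded, simply connected, Lipschitz polygonal domain (equivalently, the interior of a simple closed polygon). Let $\Gamma_D,\Gamma_N\subseteq\partial\Omega$ be disjoint and relatively open with $\overline\Gamma_D\cup\overline\Gamma_N=\partial\Omega$ (either may be empty), and let $\Gamma_1,\dots,\Gamma_J$ be the connected components of $\Gamma_N$. Let $\mathcal T_h$ be a conforming triangulation of $\overline\Omega$ aligned with $\Gamma_D,\Gamma_N$ (the relative interior of each boundary edge lies in $\Gamma_D$ or in $\Gamma_N$). Let $r\ge 0$ be an integer, $\lambda,\mu>0$, $\mathbb S$ the symmetric $2\times 2$ matrices, $\delta$ the identity matrix, and $$\mathbb A\tau=\frac1{2\mu}\Big(\tau-\frac{\lambda}{2\mu+2\lambda}(\operatorname{tr}\tau)\,\delta\Big).$$ Let $(\cdot,\cdot)$ be the $L^2(\Omega)$ inner product and let $\operatorname{div}$ act on matrix fields row by row (weakly). Put $$\Sigma_h=\{\tau\in L^2(\Omega,\mathbb S):\operatorname{div}\tau\in L^2(\Omega,\mathbb R^2),\ \tau n=0\text{ on }\Gamma_N,\ \tau|_T\in\mathcal P_{r+3}(T,\mathbb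 S)\ \forall T\in\mathcal T_h\},$$ where $n$ is the outward unit normal and the boundary condition is understood in the weak sense; $$U_h=\{v\in L^2(\Omega,\mathbb R^2): v|_T\in\mathcal P_{r+2}(T,\mathbb R^2)\ \forall T\in\mathcal T_h\}\quad\text{if }\Gamma_D\ne\emptyset,$$ while if $\Gamma_D=\emptyset$, $U_h$ is the subspace of those $v$ that in addition are $L^2$-orthogonal to the rigid body motions $(c_1,c_2)^\top+c_3(-x_2,x_1)^\top$; and $$W_h=\{w\in C^1(\overline\Omega): w|_T\in\mathcal P_{r+5}(T)\ \forall T\in\mathcal T_h,\ (\operatorname{curl}w)|_{\Gamma_j}\text{ is constant for }1\le j\le J\},$$ where $\operatorname{curl}w=(-\partial_{x_2}w,\partial_{x_1}w)^\top$. Let $J=\operatorname{curl}\operatorname{curl}=\begin{pmatrix}\partial_{x_2}^2&-\partial_{x_1}\partial_{x_2}\\-\partial_{x_1}\partial_{x_2}&\partial_{x_1}^2\end{pmatrix}$, applied triangle by triangle. Then $J(W_h)\subseteq\Sigma_h$, $\operatorname{div}(\Sigma_h)\subseteq U_h$, and the sequence $$W_h\xrightarrow{\ J\ }\Sigma_h\xrightarrow{\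 \operatorname{div}\ }U_h\to0$$ is exact: $\ker(\operatorname{div}|_{\Sigma_h})=J(W_h)$ and $\operatorname{div}(\Sigma_h)=U_h$. Moreover there is exactly one linear map $\varepsilon^h_{\mathbb C}:U_h\to\Sigma_h$ with $$(\mathbb A\,\varepsilon^h_{\mathbb C}(v),\tau)=-(v,\operatorname{div}\tau)\qquad\text{for all }v\in U_h,\ \tau\in\Sigma_h,$$ and $$\Sigma_h=J(W_h)\oplus\varepsilon^h_{\mathbb C}(U_h),$$ the sum being orthogonal with respect to $(\mathbb A\,\cdot,\cdot)$. -/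

import Mathlib

open MeasureTheory Set
open scoped ContDiff

noncomputable section

namespace ElasticFEM

/-! ### The plane, `L²` functions, classical differential operators -/

/-- The plane `ℝ²`, with coordinates `x 0`, `x 1`. -/
abbrev Plane : Type := EuclideanSpace ℝ (Fin 2)

/-- `L²(Ω)`, real valued. -/
abbrev L2 (Ω : Set Plane) : Type := Lp ℝ 2 (volume.restrict Ω)

/-- `L²(Ω, ℝ²)`. -/
abbrev L2Vec (Ω : Set Plane) : Type := Fin 2 → L2 Ω

/-- `L²(Ω, ℝ^{2×2})`, as the space of `2 × 2` matrices with entries in `L²(Ω)`. -/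
abbrev L2Mat (Ω : Set Plane) : Type := Matrix (Fin 2) (Fin 2) (L2 Ω)

/-- The coordinate vectors. -/
def basisVec (j : Fin 2) : Plane := EuclideanSpace.single j 1

/-- The partial derivative `∂f/∂x_j`. -/
def pd (j : Fin 2) (f : Plane → ℝ) (x : Plane) : ℝ := fderiv ℝ f x (basisVec j)

/-- `curl f = (-∂f/∂x₂, ∂f/∂x₁)`. -/
def curl (f : Plane → ℝ) (x : Plane) : Fin 2 → ℝ := ![-pd 1 f x, pd 0 f x]

/-- The curl of a function on a set `S`, with derivatives taken within `S`. For a `C¹` function on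
the closure of a domain this is the continuous extension of the curl to the closed domain. -/
def curlWithin (S : Set Plane) (f : Plane → ℝ) (x : Plane) : Fin 2 → ℝ :=
  ![-fderivWithin ℝ f S x (basisVec 1), fderivWithin ℝ f S x (basisVec 0)]

/-- The Airy stress operator `J = curl curl`; the curl of a vector field is taken row by row. -/
def airyFun (f : Plane → ℝ) (x : Plane) : Matrix (Fin 2) (Fin 2) ℝ :=
  fun i j => curl (fun y => curl f y i) x j

/-- The `L²(Ω, ℝ²)` inner product. -/
def innerVec {Ω : Set Plane} (v w : L2Vec Ω) : ℝ := ∑ i, inner ℝ (v i) (w i)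

/-- The `L²(Ω, ℝ^{2×2})` inner product (with the Frobenius product of matrices). -/
def innerMat {Ω : Set Plane} (σ τ : L2Mat Ω) : ℝ := ∑ i, ∑ j, inner ℝ (σ i j) (τ i j)

/-- The compliance tensor `𝔸 τ = (1/2μ) (τ - λ/(2μ+2λ) tr(τ) δ)`. -/
def compliance {Ω : Set Plane} (lam mu : ℝ) (τ : L2Mat Ω) : L2Mat Ω :=
  (1 / (2 * mu)) • (τ - (lam / (2 * mu + 2 * lam)) • Matrix.diagonal (fun _ => τ.trace))

/-! ### Domain, boundary parts, triangulation -/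

/-- `Ω` is a Lipschitz domain: near each boundary point it is, in suitable orthonormal coordinates,
the region above the graph of a Lipschitz function. -/
def HasLipschitzBoundary (Ω : Set Plane) : Prop :=
  ∀ x ∈ frontier Ω, ∃ (e : Plane ≃ᵢ Plane) (φ : ℝ → ℝ) (K : NNReal) (V : Set Plane),
    LipschitzWith K φ ∧ IsOpen V ∧ x ∈ V ∧ ∀ y ∈ V, (y ∈ Ω ↔ φ (e y 0) < e y 1)

/-- A simply connected (bounded, Lipschitz) polygonal domain in the plane. -/
structure PolygonalDomain where
  carrier : Set Plane
  isOpen : IsOpen carrier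
  isBounded : Bornology.IsBounded carrier
  simplyConnected : SimplyConnectedSpace carrier
  polygonal : ∃ S : Finset (Plane × Plane), frontier carrier = ⋃ s ∈ S, segment ℝ s.1 s.2
  lipschitz : HasLipschitzBoundary carrier

/-- The partition of the boundary into the Dirichlet part `Γ_D` and the Neumann part `Γ_N`; either
of them may be empty. -/
structure BoundaryParts (Ω : PolygonalDomain) where
  ΓD : Set Plane
  ΓN : Set Plane
  openD : ∃ O : Set Plane, IsOpen O ∧ ΓD = O ∩ frontier Ω.carrier
  openN : ∃ O : Set Plane, IsOpen O ∧ ΓN = O ∩ frontier Ω.carrier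
  disjoint : Disjoint ΓD ΓN
  cover : closure ΓD ∪ closure ΓN = frontier Ω.carrier

/-- A conforming triangulation of the closed domain, aligned with `Γ_D` and `Γ_N`. -/
structure Triangulation (Ω : PolygonalDomain) (Γ : BoundaryParts Ω) where
  complex : Geometry.SimplicialComplex ℝ Plane
  finite : complex.faces.Finite
  pure : ∀ s ∈ complex.faces, ∃ t ∈ complex.faces, s ⊆ t ∧ t.card = 3
  covers : complex.space = closure Ω.carrier
  aligned : ∀ a b : Plane, a ≠ b → {a, b} ∈ complex.faces → segment ℝ a b ⊆ frontier Ω.carrier →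
    openSegment ℝ a b ⊆ Γ.ΓD ∨ openSegment ℝ a b ⊆ Γ.ΓN

/-- The (closed) triangles of a triangulation. -/
def Triangulation.triangles {Ω : PolygonalDomain} {Γ : BoundaryParts Ω}
    (𝒯 : Triangulation Ω Γ) : Set (Set Plane) :=
  {T | ∃ t ∈ 𝒯.complex.faces, t.card = 3 ∧ T = convexHull ℝ (t : Set Plane)}

/-! ### Piecewise polynomials -/

/-- The value at `x` of a polynomial in two variables. -/
def polyEval (p : MvPolynomial (Fin 2) ℝ) (x : Plane) : ℝ := MvPolynomial.eval (fun i => x i) p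

/-- `f ∈ L²(Ω)` agrees on each triangle with a polynomial of degree at most `k`. -/
def IsPiecewisePoly {Ω : PolygonalDomain} {Γ : BoundaryParts Ω} (𝒯 : Triangulation Ω Γ) (k : ℕ)
    (f : L2 Ω.carrier) : Prop :=
  ∀ T ∈ 𝒯.triangles, ∃ p : MvPolynomial (Fin 2) ℝ, p.totalDegree ≤ k ∧
    ∀ᵐ x ∂(volume.restrict Ω.carrier), x ∈ T → f x = polyEval p x

lemma isPiecewisePoly_zero {Ω : PolygonalDomain} {Γ : BoundaryParts Ω} (𝒯 : Triangulation Ω Γ)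
    (k : ℕ) : IsPiecewisePoly 𝒯 k 0 := by
  intro T _
  refine ⟨0, by simp, ?_⟩
  filter_upwards [Lp.coeFn_zero ℝ 2 (volume.restrict Ω.carrier)] with x hx _
  rw [hx]; simp [polyEval]

lemma IsPiecewisePoly.add {Ω : PolygonalDomain} {Γ : BoundaryParts Ω} {𝒯 : Triangulation Ω Γ}
    {k : ℕ} {f g : L2 Ω.carrier} (hf : IsPiecewisePoly 𝒯 k f) (hg : IsPiecewisePoly 𝒯 k g) :
    IsPiecewisePoly 𝒯 k (f + g) := by
  intro T hT
  obtain ⟨p, hp, h1⟩ := hf T hT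
  obtain ⟨q, hq, h2⟩ := hg T hT
  refine ⟨p + q, (MvPolynomial.totalDegree_add p q).trans (max_le hp hq), ?_⟩
  filter_upwards [h1, h2, Lp.coeFn_add f g] with x h1 h2 h3 hx
  rw [h3]; simp [polyEval] at *; rw [h1 hx, h2 hx]

lemma IsPiecewisePoly.smul {Ω : PolygonalDomain} {Γ : BoundaryParts Ω} {𝒯 : Triangulation Ω Γ}
    {k : ℕ} {f : L2 Ω.carrier} (c : ℝ) (hf : IsPiecewisePoly 𝒯 k f) :
    IsPiecewisePoly 𝒯 k (c • f) := by
  intro T hT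
  obtain ⟨p, hp, h1⟩ := hf T hT
  refine ⟨c • p, (MvPolynomial.totalDegree_smul_le c p).trans hp, ?_⟩
  filter_upwards [h1, Lp.coeFn_smul c f] with x h1 h3 hx
  rw [h3, Pi.smul_apply, h1 hx]; simp [polyEval, MvPolynomial.smul_eval]

/-! ### Weak divergence and normal trace -/

/-- Smooth compactly supported test functions on the plane. -/
def IsTest (φ : Plane → ℝ) : Prop := ContDiff ℝ ∞ φ ∧ HasCompactSupport φ

/-- `∫_Ω f φ`. -/
def pairing {Ω : Set Plane} (f : L2 Ω) (φ : Plane → ℝ) : ℝ := ∫ x in Ω, f x * φ x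

/-- The left side of Green's formula `∫_Ω τ_i · ∇φ + ∫_Ω g_i φ = ∫_{∂Ω} (τ n)_i φ`, for the `i`-th
row of a matrix field `τ` whose row-wise divergence is `g`. -/
def green {Ω : Set Plane} (τ : L2Mat Ω) (g : L2Vec Ω) (i : Fin 2) (φ : Plane → ℝ) : ℝ :=
  (∑ j, pairing (τ i j) (pd j φ)) + pairing (g i) φ

/-- `g` is the weak (distributional) row-wise divergence of `τ` in `Ω`. -/
def IsWeakDiv {Ω : Set Plane} (τ : L2Mat Ω) (g : L2Vec Ω) : Prop :=
  ∀ (i : Fin 2) (φ : Plane → ℝ), IsTest φ → tsupport φ ⊆ Ω → green τ g i φ = 0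

/-- `τ n = 0` on `∂Ω` away from `Γ_D`, in the usual weak sense, for `τ` with weak divergence `g`:
the boundary term of Green's formula vanishes for all test functions that vanish near the closure
of `Γ_D`. -/
def HasZeroNormalTrace {Ω : Set Plane} (ΓD : Set Plane) (τ : L2Mat Ω) (g : L2Vec Ω) : Prop :=
  ∀ (i : Fin 2) (φ : Plane → ℝ), IsTest φ → Disjoint (tsupport φ) (closure ΓD) → green τ g i φ = 0

lemma IsTest.pd {φ : Plane → ℝ} (h : IsTest φ) (j : Fin 2) :
    Continuous (pd j φ) ∧ HasCompactSupport (pd j φ) := by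
  refine ⟨?_, ?_⟩
  · have := h.1.continuous_fderiv (by simp)
    exact this.clm_apply continuous_const
  · have := h.2.fderiv (𝕜 := ℝ)
    exact this.comp_left (g := fun L : Plane →L[ℝ] ℝ => L (basisVec j)) (by simp)

lemma integrable_pairing {Ω : Set Plane} (f : L2 Ω) {φ : Plane → ℝ} (h1 : Continuous φ)
    (h2 : HasCompactSupport φ) : Integrable (fun x => f x * φ x) (volume.restrict Ω) :=
  MemLp.integrable_mul (p := 2) (q := 2) (Lp.memLp f) (h1.memLp_of_hasCompactSupport h2)

lemma pairing_add {Ω : Set Plane} (f g : L2 Ω) {φ : Plane → ℝ} (h1 : Continuous φ)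
    (h2 : HasCompactSupport φ) : pairing (f + g) φ = pairing f φ + pairing g φ := by
  unfold pairing
  rw [← integral_add (integrable_pairing f h1 h2) (integrable_pairing g h1 h2)]
  refine integral_congr_ae ?_
  filter_upwards [Lp.coeFn_add f g] with x hx
  rw [hx]; simp [add_mul]

lemma pairing_smul {Ω : Set Plane} (c : ℝ) (f : L2 Ω) (φ : Plane → ℝ) :
    pairing (c • f) φ = c * pairing f φ := by
  unfold pairing
  rw [← integral_const_mul]
  refine integral_congr_ae ?_
  filter_upwards [Lp.coeFn_smul c f] with x hx
  rw [hx]; simp [mul_assoc]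

lemma green_add {Ω : Set Plane} (τ τ' : L2Mat Ω) (g g' : L2Vec Ω) (i : Fin 2) {φ : Plane → ℝ}
    (h : IsTest φ) : green (τ + τ') (g + g') i φ = green τ g i φ + green τ' g' i φ := by
  have h0 := pairing_add (g i) (g' i) h.1.continuous h.2
  have h1 : ∀ j, pairing ((τ + τ') i j) (ElasticFEM.pd j φ) = _ :=
    fun j => pairing_add (τ i j) (τ' i j) (h.pd j).1 (h.pd j).2
  simp only [green, Pi.add_apply, h0, h1, Finset.sum_add_distrib]
  ring

lemma green_smul {Ω : Set Plane} (c : ℝ) (τ : L2Mat Ω) (g : L2Vec Ω) (i : Fin 2)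
    (φ : Plane → ℝ) : green (c • τ) (c • g) i φ = c * green τ g i φ := by
  simp only [green, Pi.smul_apply, Matrix.smul_apply, pairing_smul, mul_add, Finset.mul_sum]

lemma IsWeakDiv.add {Ω : Set Plane} {τ τ' : L2Mat Ω} {g g' : L2Vec Ω} (h : IsWeakDiv τ g)
    (h' : IsWeakDiv τ' g') : IsWeakDiv (τ + τ') (g + g') := by
  intro i φ hφ hs
  rw [green_add _ _ _ _ _ hφ, h i φ hφ hs, h' i φ hφ hs, add_zero]

lemma IsWeakDiv.smul {Ω : Set Plane} {τ : L2Mat Ω} {g : L2Vec Ω} (c : ℝ) (h : IsWeakDiv τ g) :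
    IsWeakDiv (c • τ) (c • g) := by
  intro i φ hφ hs
  rw [green_smul, h i φ hφ hs, mul_zero]

lemma IsWeakDiv.unique {Ω : Set Plane} (hΩ : IsOpen Ω) {τ : L2Mat Ω} {g g' : L2Vec Ω}
    (h : IsWeakDiv τ g) (h' : IsWeakDiv τ g') : g = g' := by
  have h0 : IsWeakDiv (τ + (-1 : ℝ) • τ) (g + (-1 : ℝ) • g') := h.add (h'.smul (-1))
  have hz : τ + (-1 : ℝ) • τ = 0 := by simp
  rw [hz] at h0
  ext1 i
  have key : ((g i + (-1 : ℝ) • g' i : L2 Ω) : Plane → ℝ) =ᵐ[volume.restrict Ω] 0 := by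
    rw [Filter.EventuallyEq, ae_restrict_iff' hΩ.measurableSet]
    refine hΩ.ae_eq_zero_of_integral_contDiff_smul_eq_zero ?_ ?_
    · have hm : MemLp ((g i + (-1 : ℝ) • g' i : L2 Ω) : Plane → ℝ) 2 (volume.restrict Ω) :=
        Lp.memLp _
      exact locallyIntegrableOn_of_locallyIntegrable_restrict
        (hm.locallyIntegrable (by norm_num))
    · intro φ h1 h2 h3
      have := h0 i φ ⟨h1, h2⟩ h3
      have hp : ∀ j, pairing ((0 : L2Mat Ω) i j) (pd j φ) = 0 := by
        intro j
        have := pairing_smul (Ω := Ω) 0 0 (pd j φ)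
        simpa using this
      have h4 : pairing (g i + (-1 : ℝ) • g' i) φ = 0 := by
        have h5 : (∑ j, pairing ((0 : L2Mat Ω) i j) (pd j φ)) +
          pairing (g i + (-1 : ℝ) • g' i) φ = 0 := this
        rwa [Finset.sum_eq_zero fun j _ => hp j, zero_add] at h5
      have h6 : ∫ x in Ω, φ x • (g i + (-1 : ℝ) • g' i : L2 Ω) x = 0 := by
        rw [← h4]
        refine integral_congr_ae (Filter.Eventually.of_forall fun x => ?_)
        simp [mul_comm]
      rw [← h6]
      refine (setIntegral_eq_integral_of_forall_compl_eq_zero fun x hx => ?_).symm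
      have : φ x = 0 := by
        by_contra hne
        exact hx (h3 (subset_tsupport φ hne))
      simp [this]
  have : g i + (-1 : ℝ) • g' i = 0 := Lp.ext (key.trans (Lp.coeFn_zero ℝ 2 _).symm)
  simpa [add_neg_eq_zero] using this

/-- The matrix fields in `L²(Ω, ℝ^{2×2})` whose weak divergence is in `L²(Ω, ℝ²)`. -/
def Hdiv (Ω : Set Plane) : Submodule ℝ (L2Mat Ω) where
  carrier := {τ | ∃ g, IsWeakDiv τ g}
  add_mem' := by
    rintro τ τ' ⟨g, hg⟩ ⟨g', hg'⟩
    exact ⟨g + g', hg.add hg'⟩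
  zero_mem' := ⟨0, fun i φ _ _ => by simpa using green_smul (Ω := Ω) 0 0 0 i φ⟩
  smul_mem' := by
    rintro c τ ⟨g, hg⟩
    exact ⟨c • g, hg.smul c⟩

/-- The weak divergence, as a linear operator. -/
def weakDiv (Ω : PolygonalDomain) : Hdiv Ω.carrier →ₗ[ℝ] L2Vec Ω.carrier where
  toFun τ := τ.2.choose
  map_add' τ τ' := IsWeakDiv.unique Ω.isOpen (τ + τ').2.choose_spec
    (τ.2.choose_spec.add τ'.2.choose_spec)
  map_smul' c τ := IsWeakDiv.unique Ω.isOpen (c • τ).2.choose_spec (τ.2.choose_spec.smul c)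

lemma weakDiv_spec (Ω : PolygonalDomain) (τ : Hdiv Ω.carrier) :
    IsWeakDiv (τ : L2Mat Ω.carrier) (weakDiv Ω τ) := τ.2.choose_spec

/-! ### The stress and displacement spaces -/

/-- `Σ = {τ ∈ L²(Ω, 𝕊) : div τ ∈ L²(Ω, ℝ²), τ n = 0 on Γ_N}`, with `𝕊` the symmetric matrices. -/
def stressSpace (Ω : PolygonalDomain) (Γ : BoundaryParts Ω) : Submodule ℝ (L2Mat Ω.carrier) where
  carrier := {τ | τ.IsSymm ∧ ∃ g, IsWeakDiv τ g ∧ HasZeroNormalTrace Γ.ΓD τ g}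
  add_mem' := by
    rintro τ τ' ⟨hs, g, hg, ht⟩ ⟨hs', g', hg', ht'⟩
    refine ⟨hs.add hs', g + g', hg.add hg', fun i φ hφ hd => ?_⟩
    rw [green_add _ _ _ _ _ hφ, ht i φ hφ hd, ht' i φ hφ hd, add_zero]
  zero_mem' := ⟨Matrix.isSymm_zero, 0,
    fun i φ _ _ => by simpa using green_smul (Ω := Ω.carrier) 0 0 0 i φ,
    fun i φ _ _ => by simpa using green_smul (Ω := Ω.carrier) 0 0 0 i φ⟩
  smul_mem' := by
    rintro c τ ⟨hs, g, hg, ht⟩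
    refine ⟨hs.smul c, c • g, hg.smul c, fun i φ hφ hd => ?_⟩
    rw [green_smul, ht i φ hφ hd, mul_zero]

/-- `Σ_h`: the stresses in `Σ` that are polynomials of degree at most `r + 3` on each triangle. -/
def discreteStress {Ω : PolygonalDomain} {Γ : BoundaryParts Ω} (𝒯 : Triangulation Ω Γ) (r : ℕ) :
    Submodule ℝ (L2Mat Ω.carrier) where
  carrier := {τ | τ ∈ stressSpace Ω Γ ∧ ∀ i j, IsPiecewisePoly 𝒯 (r + 3) (τ i j)}
  add_mem' h h' := ⟨add_mem h.1 h'.1, fun i j => (h.2 i j).add (h'.2 i j)⟩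
  zero_mem' := ⟨zero_mem _, fun _ _ => isPiecewisePoly_zero _ _⟩
  smul_mem' c _ h := ⟨Submodule.smul_mem _ c h.1, fun i j => (h.2 i j).smul c⟩

lemma discreteStress_le_Hdiv {Ω : PolygonalDomain} {Γ : BoundaryParts Ω}
    (𝒯 : Triangulation Ω Γ) (r : ℕ) : discreteStress 𝒯 r ≤ Hdiv Ω.carrier := by
  rintro τ ⟨⟨_, g, hg, _⟩, _⟩
  exact ⟨g, hg⟩

/-- The divergence on `Σ_h`. -/
def discreteDiv {Ω : PolygonalDomain} {Γ : BoundaryParts Ω} (𝒯 : Triangulation Ω Γ) (r : ℕ) :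
    discreteStress 𝒯 r →ₗ[ℝ] L2Vec Ω.carrier :=
  (weakDiv Ω).comp (Submodule.inclusion (discreteStress_le_Hdiv 𝒯 r))

/-- Rigid body motions `(c₁, c₂) + c₃ (-x₂, x₁)`. -/
def rigidMotion (c₁ c₂ c₃ : ℝ) (x : Plane) : Fin 2 → ℝ := ![c₁ - c₃ * x 1, c₂ + c₃ * x 0]

/-- `v ∈ L²(Ω, ℝ²)` is `L²`-orthogonal to the rigid body motions. -/
def OrthogonalToRigid {Ω : Set Plane} (v : L2Vec Ω) : Prop :=
  ∀ c₁ c₂ c₃ : ℝ, ∑ i, pairing (v i) (fun x => rigidMotion c₁ c₂ c₃ x i) = 0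

lemma integrable_pairing_rigid (Ω : PolygonalDomain) (f : L2 Ω.carrier) (c₁ c₂ c₃ : ℝ)
    (i : Fin 2) :
    Integrable (fun x => f x * rigidMotion c₁ c₂ c₃ x i) (volume.restrict Ω.carrier) := by
  refine MemLp.integrable_mul (p := 2) (q := 2) (Lp.memLp f) ?_
  have hc : Continuous (fun x : Plane => rigidMotion c₁ c₂ c₃ x i) := by
    fin_cases i <;> simp [rigidMotion] <;> fun_prop
  have : IsFiniteMeasure (volume.restrict Ω.carrier) :=
    ⟨by simpa using Ω.isBounded.measure_lt_top⟩
  obtain ⟨C, hC⟩ := (Ω.isBounded.isCompact_closure).exists_bound_of_continuousOn hc.continuousOn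
  refine MemLp.of_bound hc.aestronglyMeasurable C ?_
  filter_upwards [ae_restrict_mem Ω.isOpen.measurableSet] with x hx
  exact hC x (subset_closure hx)

lemma OrthogonalToRigid.add {Ω : PolygonalDomain} {v w : L2Vec Ω.carrier}
    (hv : OrthogonalToRigid v) (hw : OrthogonalToRigid w) : OrthogonalToRigid (v + w) := by
  intro c₁ c₂ c₃
  rw [← add_zero (0 : ℝ), ← congrArg₂ (· + ·) (hv c₁ c₂ c₃) (hw c₁ c₂ c₃),
    ← Finset.sum_add_distrib]
  refine Finset.sum_congr rfl fun i _ => ?_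
  unfold pairing
  rw [← integral_add (integrable_pairing_rigid Ω _ c₁ c₂ c₃ i)
    (integrable_pairing_rigid Ω _ c₁ c₂ c₃ i)]
  refine integral_congr_ae ?_
  filter_upwards [Lp.coeFn_add (v i) (w i)] with x hx
  rw [Pi.add_apply, hx]; simp [add_mul]

lemma OrthogonalToRigid.smul {Ω : Set Plane} {v : L2Vec Ω} (c : ℝ)
    (hv : OrthogonalToRigid v) : OrthogonalToRigid (c • v) := by
  intro c₁ c₂ c₃
  simp only [Pi.smul_apply, pairing_smul, ← Finset.mul_sum, hv c₁ c₂ c₃, mul_zero]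

/-- `U_h`: the displacements in `L²(Ω, ℝ²)` that are polynomials of degree at most `r + 2` on each
triangle. In the pure traction case `Γ_D = ∅` rigid body motions are factored out: the quotient
by them is represented by their orthogonal complement. -/
def discreteDisplacement {Ω : PolygonalDomain} {Γ : BoundaryParts Ω} (𝒯 : Triangulation Ω Γ)
    (r : ℕ) : Submodule ℝ (L2Vec Ω.carrier) where
  carrier := {v | (∀ i, IsPiecewisePoly 𝒯 (r + 2) (v i)) ∧ (Γ.ΓD = ∅ → OrthogonalToRigid v)}
  add_mem' h h' := ⟨fun i => (h.1 i).add (h'.1 i), fun he => (h.2 he).add (h'.2 he)⟩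
  zero_mem' := ⟨fun _ => isPiecewisePoly_zero _ _, fun _ => by
    intro c₁ c₂ c₃
    refine Finset.sum_eq_zero fun i _ => ?_
    simpa using pairing_smul (Ω := Ω.carrier) 0 0 (fun x => rigidMotion c₁ c₂ c₃ x i)⟩
  smul_mem' c _ h := ⟨fun i => (h.1 i).smul c, fun he => (h.2 he).smul c⟩

/-! ### The `C¹` space `W_h` and the Airy operator on it -/

/-- Membership in `W_h`: `w` is `C¹` on the closed domain, a polynomial of degree at most `r + 5`
on each triangle, and `curl w` is constant on each connected component of `Γ_N`. Functions on the
closed domain are represented by their extension by zero to the plane. -/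
structure MemW {Ω : PolygonalDomain} {Γ : BoundaryParts Ω} (𝒯 : Triangulation Ω Γ) (r : ℕ)
    (w : Plane → ℝ) : Prop where
  zero_off : ∀ x ∉ closure Ω.carrier, w x = 0
  contDiffOn : ContDiffOn ℝ 1 w (closure Ω.carrier)
  poly : ∀ T ∈ 𝒯.triangles, ∃ p : MvPolynomial (Fin 2) ℝ, p.totalDegree ≤ r + 5 ∧
    ∀ x ∈ T, w x = polyEval p x
  curl_const : ∀ x ∈ Γ.ΓN, ∃ c : Fin 2 → ℝ, ∀ y ∈ connectedComponentIn Γ.ΓN x,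
    curlWithin (closure Ω.carrier) w y = c

lemma Triangulation.exists_triangle {Ω : PolygonalDomain} {Γ : BoundaryParts Ω}
    (𝒯 : Triangulation Ω Γ) {x : Plane} (hx : x ∈ closure Ω.carrier) :
    ∃ T ∈ 𝒯.triangles, x ∈ T := by
  rw [← 𝒯.covers, Geometry.SimplicialComplex.mem_space_iff] at hx
  obtain ⟨s, hs, hxs⟩ := hx
  obtain ⟨t, ht, hst, hc⟩ := 𝒯.pure s hs
  exact ⟨_, ⟨t, ht, hc, rfl⟩, convexHull_mono (by exact_mod_cast hst) hxs⟩

lemma Triangulation.triangle_subset {Ω : PolygonalDomain} {Γ : BoundaryParts Ω}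
    (𝒯 : Triangulation Ω Γ) {T : Set Plane} (hT : T ∈ 𝒯.triangles) : T ⊆ closure Ω.carrier := by
  obtain ⟨t, ht, -, rfl⟩ := hT
  rw [← 𝒯.covers]
  exact 𝒯.complex.convexHull_subset_space ht

lemma Triangulation.triangles_finite {Ω : PolygonalDomain} {Γ : BoundaryParts Ω}
    (𝒯 : Triangulation Ω Γ) : 𝒯.triangles.Finite := by
  refine (𝒯.finite.image fun t : Finset Plane => convexHull ℝ (t : Set Plane)).subset ?_
  rintro T ⟨t, ht, -, rfl⟩
  exact ⟨t, ht, rfl⟩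

lemma Triangulation.triangle_convex {Ω : PolygonalDomain} {Γ : BoundaryParts Ω}
    (𝒯 : Triangulation Ω Γ) {T : Set Plane} (hT : T ∈ 𝒯.triangles) : Convex ℝ T := by
  obtain ⟨t, ht, -, rfl⟩ := hT
  exact convex_convexHull ℝ _

lemma Triangulation.triangle_compact {Ω : PolygonalDomain} {Γ : BoundaryParts Ω}
    (𝒯 : Triangulation Ω Γ) {T : Set Plane} (hT : T ∈ 𝒯.triangles) : IsCompact T := by
  obtain ⟨t, ht, -, rfl⟩ := hT
  exact t.finite_toSet.isCompact_convexHull ℝ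

lemma Triangulation.triangle_interior {Ω : PolygonalDomain} {Γ : BoundaryParts Ω}
    (𝒯 : Triangulation Ω Γ) {T : Set Plane} (hT : T ∈ 𝒯.triangles) : (interior T).Nonempty := by
  obtain ⟨t, ht, hc, rfl⟩ := hT
  rw [interior_convexHull_nonempty_iff_affineSpan_eq_top]
  have h := (𝒯.complex.indep ht).affineSpan_eq_top_iff_card_eq_finrank_add_one
  rw [Subtype.range_coe] at h
  exact h.2 (by simp [hc])

lemma Triangulation.uniqueDiffOn {Ω : PolygonalDomain} {Γ : BoundaryParts Ω}
    (𝒯 : Triangulation Ω Γ) : UniqueDiffOn ℝ (closure Ω.carrier) := by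
  intro x hx
  obtain ⟨T, hT, hxT⟩ := 𝒯.exists_triangle hx
  exact (uniqueDiffOn_convex (𝒯.triangle_convex hT) (𝒯.triangle_interior hT) x hxT).mono
    (𝒯.triangle_subset hT)

lemma Triangulation.ae_interior {Ω : PolygonalDomain} {Γ : BoundaryParts Ω}
    (𝒯 : Triangulation Ω Γ) :
    ∀ᵐ x ∂(volume.restrict Ω.carrier), ∃ T ∈ 𝒯.triangles, x ∈ interior T := by
  have h0 : ∀ᵐ x ∂(volume : Measure Plane), ∀ T ∈ 𝒯.triangles, x ∉ frontier T := by
    rw [ae_ball_iff 𝒯.triangles_finite.countable]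
    intro T hT
    exact measure_eq_zero_iff_ae_notMem.1 ((𝒯.triangle_convex hT).addHaar_frontier volume)
  filter_upwards [ae_restrict_of_ae h0, ae_restrict_mem Ω.isOpen.measurableSet] with x hx hxΩ
  obtain ⟨T, hT, hxT⟩ := 𝒯.exists_triangle (subset_closure hxΩ)
  refine ⟨T, hT, ?_⟩
  by_contra hne
  exact hx T hT ⟨subset_closure hxT, hne⟩

lemma contDiff_polyEval (p : MvPolynomial (Fin 2) ℝ) : ContDiff ℝ ∞ (polyEval p) := by
  induction p using MvPolynomial.induction_on with
  | C a =>
    have : polyEval (MvPolynomial.C a) = fun _ => a := by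
      ext x; simp [polyEval]
    rw [this]; exact contDiff_const
  | add p q hp hq =>
    have : polyEval (p + q) = fun x => polyEval p x + polyEval q x := by
      ext x; simp [polyEval]
    rw [this]; exact hp.add hq
  | mul_X p i hp =>
    have : polyEval (p * MvPolynomial.X i) = fun x => polyEval p x * x i := by
      ext x; simp [polyEval]
    rw [this]; exact hp.mul (by fun_prop)

lemma contDiff_pd {f : Plane → ℝ} (h : ContDiff ℝ ∞ f) (j : Fin 2) : ContDiff ℝ ∞ (pd j f) :=
  (h.fderiv_right (m := ∞) (by simp)).clm_apply contDiff_const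

lemma pd_eqOn {f g : Plane → ℝ} {V : Set Plane} (hV : IsOpen V) (h : EqOn f g V) (j : Fin 2) :
    EqOn (pd j f) (pd j g) V := by
  intro x hx
  simp only [pd, (h.eventuallyEq_of_mem (hV.mem_nhds hx)).fderiv_eq]

lemma curl_apply (f : Plane → ℝ) (i : Fin 2) :
    (fun x => curl f x i) = if i = 0 then -pd 1 f else pd 0 f := by
  ext x; fin_cases i <;> simp [curl]

lemma curl_eqOn {f g : Plane → ℝ} {V : Set Plane} (hV : IsOpen V) (h : EqOn f g V) (i : Fin 2) :
    EqOn (fun x => curl f x i) (fun x => curl g x i) V := by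
  intro x hx
  simp only [curl, pd_eqOn hV h 0 hx, pd_eqOn hV h 1 hx]

lemma airyFun_eqOn {f g : Plane → ℝ} {V : Set Plane} (hV : IsOpen V) (h : EqOn f g V)
    (i j : Fin 2) : EqOn (fun x => airyFun f x i j) (fun x => airyFun g x i j) V :=
  curl_eqOn hV (curl_eqOn hV h i) j

lemma contDiff_curl {f : Plane → ℝ} (h : ContDiff ℝ ∞ f) (i : Fin 2) :
    ContDiff ℝ ∞ (fun x => curl f x i) := by
  rw [curl_apply]
  split_ifs
  · exact (contDiff_pd h 1).neg
  · exact contDiff_pd h 0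

lemma curl_lin {f g : Plane → ℝ} (hf : ContDiff ℝ ∞ f) (hg : ContDiff ℝ ∞ g) (c : ℝ) (i : Fin 2) :
    (fun x => curl (fun y => f y + c * g y) x i) = fun x => curl f x i + c * curl g x i := by
  have key : ∀ j x, pd j (fun y => f y + c * g y) x = pd j f x + c * pd j g x := by
    intro j x
    have h1 := (hf.differentiable (by simp) x).hasFDerivAt
    have h2 := (hg.differentiable (by simp) x).hasFDerivAt
    have h3 := (h1.add (h2.const_mul c)).fderiv
    simp only [pd]
    erw [h3]
    simp
  ext x
  fin_cases i <;> simp [curl, key]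
  ring

lemma airyFun_lin {f g : Plane → ℝ} (hf : ContDiff ℝ ∞ f) (hg : ContDiff ℝ ∞ g) (c : ℝ)
    (x : Plane) (i j : Fin 2) :
    airyFun (fun y => f y + c * g y) x i j = airyFun f x i j + c * airyFun g x i j := by
  simp only [airyFun, curl_lin hf hg]
  exact congrFun (curl_lin (contDiff_curl hf i) (contDiff_curl hg i) c j) x

lemma MemW.lin {Ω : PolygonalDomain} {Γ : BoundaryParts Ω} {𝒯 : Triangulation Ω Γ} {r : ℕ}
    {w w' : Plane → ℝ} (h : MemW 𝒯 r w) (h' : MemW 𝒯 r w') (c : ℝ) :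
    MemW 𝒯 r (fun x => w x + c * w' x) where
  zero_off x hx := by simp [h.zero_off x hx, h'.zero_off x hx]
  contDiffOn := h.contDiffOn.add (contDiffOn_const.mul h'.contDiffOn)
  poly T hT := by
    obtain ⟨p, hp, h1⟩ := h.poly T hT
    obtain ⟨q, hq, h2⟩ := h'.poly T hT
    refine ⟨p + c • q, (MvPolynomial.totalDegree_add _ _).trans
      (max_le hp ((MvPolynomial.totalDegree_smul_le c q).trans hq)), fun x hx => ?_⟩
    rw [h1 x hx, h2 x hx]; simp [polyEval, MvPolynomial.smul_eval]
  curl_const x hx := by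
    obtain ⟨a, ha⟩ := h.curl_const x hx
    obtain ⟨b, hb⟩ := h'.curl_const x hx
    refine ⟨a + c • b, fun y hy => ?_⟩
    have hyN : y ∈ closure Ω.carrier := by
      have h1 : y ∈ Γ.ΓN := connectedComponentIn_subset _ _ hy
      obtain ⟨O, -, hO⟩ := Γ.openN
      rw [hO] at h1
      exact frontier_subset_closure h1.2
    have hd := (h.contDiffOn.differentiableOn (by simp) y hyN).hasFDerivWithinAt
    have hd' := (h'.contDiffOn.differentiableOn (by simp) y hyN).hasFDerivWithinAt
    have h3 := (hd.add (hd'.const_mul c)).fderivWithin (𝒯.uniqueDiffOn y hyN)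
    rw [← ha y hy, ← hb y hy]
    unfold curlWithin
    erw [h3]
    ext i
    fin_cases i <;> simp
    ring

lemma memW_zero {Ω : PolygonalDomain} {Γ : BoundaryParts Ω} (𝒯 : Triangulation Ω Γ) (r : ℕ) :
    MemW 𝒯 r 0 where
  zero_off _ _ := rfl
  contDiffOn := contDiffOn_const
  poly _ _ := ⟨0, by simp, fun x _ => by simp [polyEval]⟩
  curl_const _ _ := ⟨0, fun y _ => by
    ext i
    fin_cases i <;> simp [curlWithin]⟩

/-- The space `W_h`. -/
def discreteAiry {Ω : PolygonalDomain} {Γ : BoundaryParts Ω} (𝒯 : Triangulation Ω Γ) (r : ℕ) :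
    Submodule ℝ (Plane → ℝ) where
  carrier := {w | MemW 𝒯 r w}
  add_mem' {w w'} h h' := by
    have e : w + w' = fun x => w x + 1 * w' x := by ext x; simp
    rw [e]; exact MemW.lin h h' 1
  zero_mem' := memW_zero 𝒯 r
  smul_mem' c w h := by
    have e : c • w = fun x => (0 : Plane → ℝ) x + c * w x := by ext x; simp
    rw [e]; exact (memW_zero 𝒯 r).lin h c

lemma memLp_of_triangles {Ω : PolygonalDomain} {Γ : BoundaryParts Ω} (𝒯 : Triangulation Ω Γ)
    (f : Plane → ℝ)
    (h : ∀ T ∈ 𝒯.triangles, ∃ q : Plane → ℝ, Continuous q ∧ EqOn f q (interior T)) :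
    MemLp f 2 (volume.restrict Ω.carrier) := by
  have hle : volume.restrict Ω.carrier ≤
      volume.restrict (⋃ T ∈ 𝒯.triangles, interior T) := by
    refine Measure.restrict_mono_ae ?_
    have := (ae_restrict_iff' Ω.isOpen.measurableSet).1 𝒯.ae_interior
    filter_upwards [this] with x hx hxΩ
    exact mem_iUnion₂.2 (by simpa using hx hxΩ)
  refine MemLp.mono_measure hle ?_
  have hloc : ∀ T ∈ 𝒯.triangles, MemLp f 2 (volume.restrict (interior T)) := by
    intro T hT
    obtain ⟨q, hq, he⟩ := h T hT
    have : IsFiniteMeasure (volume.restrict (interior T)) :=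
      ⟨by simpa using
        (measure_mono interior_subset).trans_lt (𝒯.triangle_compact hT).measure_lt_top⟩
    obtain ⟨C, hC⟩ := (𝒯.triangle_compact hT).exists_bound_of_continuousOn hq.continuousOn
    have hm : MemLp q 2 (volume.restrict (interior T)) := by
      refine MemLp.of_bound hq.aestronglyMeasurable C ?_
      filter_upwards [ae_restrict_mem isOpen_interior.measurableSet] with x hx
      exact hC x (interior_subset hx)
    refine hm.ae_eq ?_
    filter_upwards [ae_restrict_mem isOpen_interior.measurableSet] with x hx
    exact (he hx).symm
  have hms : AEStronglyMeasurable f (volume.restrict (⋃ T ∈ 𝒯.triangles, interior T)) := by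
    have : Countable 𝒯.triangles := 𝒯.triangles_finite.countable
    rw [biUnion_eq_iUnion, aestronglyMeasurable_iUnion_iff]
    exact fun T => (hloc T T.2).aestronglyMeasurable
  rw [memLp_two_iff_integrable_sq hms]
  refine (integrableOn_finite_biUnion 𝒯.triangles_finite).2 fun T hT => ?_
  exact (hloc T hT).integrable_sq

lemma MemW.memLp {Ω : PolygonalDomain} {Γ : BoundaryParts Ω} {𝒯 : Triangulation Ω Γ} {r : ℕ}
    {w : Plane → ℝ} (h : MemW 𝒯 r w) (i j : Fin 2) :
    MemLp (fun x => airyFun w x i j) 2 (volume.restrict Ω.carrier) := by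
  refine memLp_of_triangles 𝒯 _ fun T hT => ?_
  obtain ⟨p, -, hp⟩ := h.poly T hT
  exact ⟨fun x => airyFun (polyEval p) x i j,
    (contDiff_curl (contDiff_curl (contDiff_polyEval p) i) j).continuous,
    airyFun_eqOn isOpen_interior (fun x hx => hp x (interior_subset hx)) i j⟩

lemma MemW.airyFun_ae {Ω : PolygonalDomain} {Γ : BoundaryParts Ω} {𝒯 : Triangulation Ω Γ} {r : ℕ}
    {w w' : Plane → ℝ} (h : MemW 𝒯 r w) (h' : MemW 𝒯 r w') (c : ℝ) (i j : Fin 2) :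
    ∀ᵐ x ∂(volume.restrict Ω.carrier), airyFun (fun y => w y + c * w' y) x i j =
      airyFun w x i j + c * airyFun w' x i j := by
  filter_upwards [𝒯.ae_interior] with x ⟨T, hT, hx⟩
  obtain ⟨p, -, hp⟩ := h.poly T hT
  obtain ⟨q, -, hq⟩ := h'.poly T hT
  have e1 : EqOn w (polyEval p) (interior T) := fun x hx => hp x (interior_subset hx)
  have e2 : EqOn w' (polyEval q) (interior T) := fun x hx => hq x (interior_subset hx)
  have e3 : EqOn (fun y => w y + c * w' y) (fun y => polyEval p y + c * polyEval q y)
      (interior T) := fun x hx => by simp only [e1 hx, e2 hx]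
  have a1 := airyFun_eqOn isOpen_interior e1 i j hx
  have a2 := airyFun_eqOn isOpen_interior e2 i j hx
  have a3 := airyFun_eqOn isOpen_interior e3 i j hx
  simp only at a1 a2 a3
  rw [a1, a2, a3, airyFun_lin (contDiff_polyEval p) (contDiff_polyEval q)]

/-- The Airy operator `J = curl curl` on `W_h`, with values in `L²(Ω, ℝ^{2×2})`; the derivatives
are taken triangle by triangle (almost everywhere). -/
def airy {Ω : PolygonalDomain} {Γ : BoundaryParts Ω} (𝒯 : Triangulation Ω Γ) (r : ℕ) :
    discreteAiry 𝒯 r →ₗ[ℝ] L2Mat Ω.carrier where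
  toFun w := fun i j => (MemW.memLp w.2 i j).toLp
  map_add' w w' := by
    refine Matrix.ext fun i j => ?_
    refine Lp.ext ?_
    filter_upwards [(MemW.memLp (w + w').2 i j).coeFn_toLp, (MemW.memLp w.2 i j).coeFn_toLp,
      (MemW.memLp w'.2 i j).coeFn_toLp, MemW.airyFun_ae w.2 w'.2 1 i j,
      Lp.coeFn_add ((MemW.memLp w.2 i j).toLp) ((MemW.memLp w'.2 i j).toLp)] with x h1 h2 h3 h4 h5
    rw [h1]
    erw [h5]
    rw [Pi.add_apply, h2, h3]
    simp only [one_mul] at h4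
    exact h4
  map_smul' c w := by
    refine Matrix.ext fun i j => ?_
    refine Lp.ext ?_
    filter_upwards [(MemW.memLp (c • w).2 i j).coeFn_toLp, (MemW.memLp w.2 i j).coeFn_toLp,
      MemW.airyFun_ae (memW_zero 𝒯 r) w.2 c i j,
      MemW.airyFun_ae (memW_zero 𝒯 r) (memW_zero 𝒯 r) 1 i j,
      Lp.coeFn_smul c ((MemW.memLp w.2 i j).toLp)] with x h1 h2 h3 h4 h5
    rw [h1]
    erw [h5]
    rw [Pi.smul_apply, h2]
    have hz : airyFun (fun _ => (0 : ℝ)) x i j = 0 := by simpa [Pi.zero_def] using h4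
    simp only [Pi.zero_apply, Pi.zero_def, zero_add, hz] at h3
    exact h3

/-! ### The discrete adjoint of the divergence -/

/-- `ε : U_h → Σ_h` is the adjoint `ε_ℂ^h` of `-div : Σ_h → U_h`, where `Σ_h` carries the inner
product `(𝔸 ·, ·)`: it satisfies `(𝔸 ε(v), τ) = -(v, div τ)` for all `τ ∈ Σ_h`. -/
def IsDiscreteStrain {Ω : PolygonalDomain} {Γ : BoundaryParts Ω} (𝒯 : Triangulation Ω Γ) (r : ℕ)
    (lam mu : ℝ) (ε : discreteDisplacement 𝒯 r →ₗ[ℝ] discreteStress 𝒯 r) : Prop :=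
  ∀ (v : discreteDisplacement 𝒯 r) (τ : discreteStress 𝒯 r),
    innerMat (compliance lam mu (ε v : L2Mat Ω.carrier)) τ =
      -innerVec (v : L2Vec Ω.carrier) (discreteDiv 𝒯 r τ)

end ElasticFEM

end

/-!
# Exactness and Hodge decomposition for the discrete elasticity complex

The statement is proved for an arbitrary triangulation, without a dimension count.

*Piecewise polynomials and normal jumps.* A piecewise polynomial matrix field is tested against a
smooth function triangle by triangle (`Triangulation.two_mul_green`). This shows that it belongs to
the stress space precisely when the normal components of its rows do not jump across interior edges
and vanish on the Neumann edges (`Triangulation.JumpFree`, `Triangulation.JumpFree.green_eq_zero`,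
`Triangulation.jumpFree_of_green`), and then the weak divergence is the piecewise one
(`Triangulation.hasPieces_weakDiv`).

*Exactness at the stress space.* The curl of a piecewise polynomial is free of normal jumps if and
only if the polynomial is continuous across the edges up to constants and constant along each
Neumann edge (`Triangulation.jumpFree_curlPoly_iff`). For `w ∈ W_h` this applies to the components
of `curl w`. Conversely, the rows of a divergence-free stress are piecewise curls; since the domain
is simply connected, the constants can be chosen such that the potentials are continuous
(`exists_global_primitive`, `Triangulation.exists_constants`). The potentials of the two rows form a
vector field which is divergence-free because the stress is symmetric, so a potential `w` can be
taken once more, and `w` is `C¹` (`exists_airy_eq`). The Lipschitz condition enters in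
`Triangulation.exists_constants`: the potential is first glued in the open domain, and it extends
continuously to a boundary vertex because the domain is connected near each boundary point.

*Surjectivity of the divergence.* By duality, it is enough that a displacement `v ∈ U_h` orthogonal
to `div Σ_h` vanishes (`eq_zero_of_orthogonal_div`). The test stresses are products of an edge
bubble with a polynomial matrix. With values in the span of `t tᵀ`, where `t` is the edge vector,
they are supported in a single triangle and show that the strain of `v` vanishes there
(`Triangulation.tangential_strain_eq_zero`), so `v` is a rigid motion on each triangle. With values
`d νᵀ + ν dᵀ`, where `ν` is normal to the edge and `d` is the jump of `v` across it, they show that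
`d` vanishes (`Triangulation.jump_eq_zero`), on interior edges and on Dirichlet edges. Hence `v` is
a global rigid motion, and it vanishes on a Dirichlet edge or is orthogonal to itself.

The decomposition is then linear algebra in finite dimension (`exists_adjoint_decomposition`).
-/

namespace ElasticFEM

open Filter Topology

/-! ### Gluing local primitives on a simply connected space -/

/-- The fibre bundle with discrete fibre `G` whose sections over `U i` are the functions that
differ from `f i` by a locally constant function. -/
def primitiveBundle {ι X G : Type*} [TopologicalSpace X] [AddCommGroup G] [TopologicalSpace G]
    [DiscreteTopology G] (U : ι → Set X) (hU : ∀ i, IsOpen (U i)) (idx : X → ι)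
    (hidx : ∀ x, x ∈ U (idx x)) (f : ι → X → G)
    (hf : ∀ i j, ∀ x ∈ U i ∩ U j, ∀ᶠ y in 𝓝 x, f i y - f j y = f i x - f j x) :
    FiberBundleCore ι X G where
  baseSet := U
  isOpen_baseSet := hU
  indexAt := idx
  mem_baseSet_at := hidx
  coordChange i j x v := v + (f i x - f j x)
  coordChange_self i x _ v := by simp
  continuousOn_coordChange i j := by
    rintro ⟨x, v⟩ ⟨hx, -⟩
    refine ContinuousAt.continuousWithinAt ?_
    have h1 : ∀ᶠ p : X × G in 𝓝 (x, v), f i p.1 - f j p.1 = f i x - f j x :=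
      (continuous_fst.tendsto (x, v)).eventually (hf i j x hx)
    have h2 : ∀ᶠ p : X × G in 𝓝 (x, v), p.2 = v :=
      (continuous_snd.tendsto (x, v)).eventually (p := fun w => w = v)
        ((isOpen_discrete {v}).mem_nhds rfl)
    refine ContinuousAt.congr (f := fun _ => v + (f i x - f j x)) continuousAt_const ?_
    filter_upwards [h1, h2] with p hp1 hp2
    rw [hp1, hp2]
  coordChange_comp i j k x _ v := by abel

/-- On a simply connected space, local functions that differ by locally constant functions on the
overlaps come from one global function, up to locally constant functions. -/
theorem exists_global_primitive {ι X G : Type*} [TopologicalSpace X] [SimplyConnectedSpace X]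
    [LocallyPathConnectedSpace X] [AddCommGroup G]
    (U : ι → Set X) (hU : ∀ i, IsOpen (U i)) (idx : X → ι)
    (hidx : ∀ x, x ∈ U (idx x)) (f : ι → X → G)
    (hf : ∀ i j, ∀ x ∈ U i ∩ U j, ∀ᶠ y in 𝓝 x, f i y - f j y = f i x - f j x) :
    ∃ u : X → G, ∀ i, ∀ x ∈ U i, ∀ᶠ y in 𝓝 x, u y - f i y = u x - f i x := by
  let _ : TopologicalSpace G := ⊥
  have : DiscreteTopology G := ⟨rfl⟩
  let Z := primitiveBundle U hU idx hidx f hf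
  have hcov : IsCoveringMap Z.proj :=
    IsCoveringMap.mk (f := Z.proj) (fun _ => G) (fun x => Z.localTrivAt x)
      (fun x => Z.mem_baseSet_at x)
  obtain ⟨x₀⟩ : Nonempty X := inferInstance
  obtain ⟨s, ⟨-, hs⟩, -⟩ := hcov.existsUnique_continuousMap_lifts (ContinuousMap.id X) x₀
    (⟨x₀, (0 : G)⟩ : Z.TotalSpace) rfl
  have hproj : ∀ x, (s x).1 = x := fun x => congrFun hs x
  let val : Z.TotalSpace → G := fun p => p.2
  refine ⟨fun x => f (idx x) x + val (s x), fun i x hx => ?_⟩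
  have hc : ContinuousAt (fun y => (Z.localTriv i (s y)).2) x := by
    have h1 : ContinuousAt (Z.localTriv i) (s x) :=
      (Z.localTriv i).continuousAt (by
        rw [Bundle.Trivialization.mem_source]
        change (s x).1 ∈ U i
        rw [hproj]; exact hx)
    exact continuous_snd.continuousAt.comp (h1.comp s.continuous.continuousAt)
  have he : ∀ y, (Z.localTriv i (s y)).2 = val (s y) + (f (idx y) y - f i y) := by
    intro y
    change val (s y) + (f (idx (s y).1) (s y).1 - f i (s y).1) = _
    rw [hproj]
  have h2 := hc.tendsto.eventually (p := fun w => w = (Z.localTriv i (s x)).2)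
    ((isOpen_discrete _).mem_nhds rfl)
  filter_upwards [h2] with y hy
  rw [he, he] at hy
  rw [add_sub_right_comm, add_comm, hy]
  abel

/-! ### Polynomials in two variables -/

@[simp] lemma polyEval_zero (x : Plane) : polyEval 0 x = 0 := by simp [polyEval]

@[simp] lemma polyEval_C (c : ℝ) (x : Plane) : polyEval (MvPolynomial.C c) x = c := by
  simp [polyEval]

@[simp] lemma polyEval_X (i : Fin 2) (x : Plane) : polyEval (MvPolynomial.X i) x = x i := by
  simp [polyEval]

@[simp] lemma polyEval_add (p q : MvPolynomial (Fin 2) ℝ) (x : Plane) :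
    polyEval (p + q) x = polyEval p x + polyEval q x := by simp [polyEval]

@[simp] lemma polyEval_sub (p q : MvPolynomial (Fin 2) ℝ) (x : Plane) :
    polyEval (p - q) x = polyEval p x - polyEval q x := by simp [polyEval]

@[simp] lemma polyEval_neg (p : MvPolynomial (Fin 2) ℝ) (x : Plane) :
    polyEval (-p) x = -polyEval p x := by simp [polyEval]

@[simp] lemma polyEval_mul (p q : MvPolynomial (Fin 2) ℝ) (x : Plane) :
    polyEval (p * q) x = polyEval p x * polyEval q x := by simp [polyEval]

@[simp] lemma polyEval_smul (c : ℝ) (p : MvPolynomial (Fin 2) ℝ) (x : Plane) :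
    polyEval (c • p) x = c * polyEval p x := by simp [polyEval, MvPolynomial.smul_eval]

lemma continuous_polyEval (p : MvPolynomial (Fin 2) ℝ) : Continuous (polyEval p) :=
  (contDiff_polyEval p).continuous

lemma differentiable_polyEval (p : MvPolynomial (Fin 2) ℝ) : Differentiable ℝ (polyEval p) :=
  (contDiff_polyEval p).differentiable (by simp)

lemma fderiv_apply_eq_pd (f : Plane → ℝ) (x v : Plane) :
    fderiv ℝ f x v = v 0 * pd 0 f x + v 1 * pd 1 f x := by
  have h : v = v 0 • basisVec 0 + v 1 • basisVec 1 := by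
    ext i; fin_cases i <;> simp [basisVec]
  conv_lhs => rw [h]
  simp [pd]

lemma pd_add {f g : Plane → ℝ} (hf : Differentiable ℝ f) (hg : Differentiable ℝ g) (j : Fin 2)
    (x : Plane) : pd j (fun y => f y + g y) x = pd j f x + pd j g x := by
  simp only [pd]
  have h : HasFDerivAt (fun y => f y + g y) (fderiv ℝ f x + fderiv ℝ g x) x :=
    (hf x).hasFDerivAt.add (hg x).hasFDerivAt
  rw [h.fderiv]
  rfl

lemma pd_mul {f g : Plane → ℝ} (hf : Differentiable ℝ f) (hg : Differentiable ℝ g) (j : Fin 2)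
    (x : Plane) : pd j (fun y => f y * g y) x = pd j f x * g x + f x * pd j g x := by
  simp only [pd]
  have h : HasFDerivAt (fun y => f y * g y) (f x • fderiv ℝ g x + g x • fderiv ℝ f x) x :=
    (hf x).hasFDerivAt.mul (hg x).hasFDerivAt
  rw [h.fderiv]
  simp; ring

lemma pd_coord (i j : Fin 2) (x : Plane) :
    pd j (fun y : Plane => y i) x = if i = j then 1 else 0 := by
  have h : HasFDerivAt (fun y : Plane => y i) (EuclideanSpace.proj i : Plane →L[ℝ] ℝ) x :=
    (EuclideanSpace.proj i : Plane →L[ℝ] ℝ).hasFDerivAt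
  simp only [pd, h.fderiv]
  simp [basisVec]

lemma pd_polyEval (j : Fin 2) (p : MvPolynomial (Fin 2) ℝ) (x : Plane) :
    pd j (polyEval p) x = polyEval (MvPolynomial.pderiv j p) x := by
  induction p using MvPolynomial.induction_on generalizing x with
  | C a =>
    have : polyEval (MvPolynomial.C a) = fun _ => a := by ext x; simp
    simp [pd, this]
  | add p q hp hq =>
    have : polyEval (p + q) = fun x => polyEval p x + polyEval q x := by ext x; simp
    rw [this, pd_add (differentiable_polyEval p) (differentiable_polyEval q), hp, hq]; simp
  | mul_X p i hp =>
    have : polyEval (p * MvPolynomial.X i) = fun x => polyEval p x * x i := by ext x; simp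
    rw [this, pd_mul (differentiable_polyEval p) (by fun_prop), hp, pd_coord]
    simp only [Derivation.leibniz, MvPolynomial.pderiv_X, smul_eq_mul, polyEval_add, polyEval_mul,
      polyEval_X, Pi.single_apply]
    have h1 : polyEval 1 x = 1 := by simp [polyEval]
    by_cases h : i = j
    · subst h; simp [h1]; ring
    · simp [h]; ring

/-- A polynomial that vanishes on a nonempty open set is zero. -/
lemma eq_zero_of_polyEval_eq_zero {p : MvPolynomial (Fin 2) ℝ} {U : Set Plane} (hU : IsOpen U)
    (hne : U.Nonempty) (h : ∀ x ∈ U, polyEval p x = 0) : p = 0 := by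
  obtain ⟨z, hz⟩ := hne
  have hV : IsOpen ((WithLp.toLp 2 : (Fin 2 → ℝ) → Plane) ⁻¹' U) :=
    hU.preimage (PiLp.continuous_toLp 2 _)
  obtain ⟨ε, hε, hb⟩ := Metric.isOpen_iff.1 hV (fun i => z i) (by simpa using hz)
  refine MvPolynomial.funext_set (fun i => Metric.ball (z i) ε) (fun i => ?_) fun x hx => ?_
  · rw [Real.ball_eq_Ioo]; exact Set.Ioo_infinite (by linarith)
  · have hx' : x ∈ Metric.ball (fun i => z i) ε := by
      rw [ball_pi _ hε]; exact hx
    simpa [polyEval] using h _ (hb hx')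

lemma eq_of_polyEval_eq {p q : MvPolynomial (Fin 2) ℝ} {U : Set Plane} (hU : IsOpen U)
    (hne : U.Nonempty) (h : ∀ x ∈ U, polyEval p x = polyEval q x) : p = q := by
  rw [← sub_eq_zero]
  exact eq_zero_of_polyEval_eq_zero hU hne fun x hx => by simp [h x hx]

lemma totalDegree_pderiv_le {p : MvPolynomial (Fin 2) ℝ} {k : ℕ} (hp : p.totalDegree ≤ k + 1)
    (j : Fin 2) : (MvPolynomial.pderiv j p).totalDegree ≤ k := by
  rw [← MvPolynomial.sum_homogeneousComponent p, map_sum]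
  refine MvPolynomial.totalDegree_finsetSum_le fun i hi => ?_
  refine ((MvPolynomial.homogeneousComponent_isHomogeneous i p).pderiv).totalDegree_le.trans ?_
  have := Finset.mem_range.1 hi
  omega

/-- Homogeneous components commute with partial derivatives. -/
lemma pderiv_homogeneousComponent (p : MvPolynomial (Fin 2) ℝ) (j : Fin 2) (n : ℕ) :
    MvPolynomial.pderiv j (MvPolynomial.homogeneousComponent (n + 1) p) =
      MvPolynomial.homogeneousComponent n (MvPolynomial.pderiv j p) := by
  ext d
  rw [MvPolynomial.coeff_pderiv, MvPolynomial.coeff_homogeneousComponent,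
    MvPolynomial.coeff_homogeneousComponent, MvPolynomial.coeff_pderiv]
  have : (d + Finsupp.single j 1).degree = d.degree + 1 := by simp
  rw [this]
  by_cases h : d.degree = n <;> simp [h]

/-- The polynomial Poincaré lemma in the plane, by Euler's identity on each homogeneous
component. -/
lemma exists_polynomial_primitive {a b : MvPolynomial (Fin 2) ℝ}
    (hab : MvPolynomial.pderiv 1 a = MvPolynomial.pderiv 0 b) {k : ℕ} (ha : a.totalDegree ≤ k)
    (hb : b.totalDegree ≤ k) :
    ∃ p : MvPolynomial (Fin 2) ℝ, p.totalDegree ≤ k + 1 ∧ MvPolynomial.pderiv 0 p = a ∧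
      MvPolynomial.pderiv 1 p = b := by
  classical
  let H := fun (n : ℕ) (q : MvPolynomial (Fin 2) ℝ) => MvPolynomial.homogeneousComponent n q
  let P := fun n : ℕ => ((n : ℝ) + 1)⁻¹ • (MvPolynomial.X 0 * H n a + MvPolynomial.X 1 * H n b)
  have hclosed : ∀ n, MvPolynomial.pderiv 1 (H n a) = MvPolynomial.pderiv 0 (H n b) := by
    intro n
    rcases n with _ | n
    · simp [H, MvPolynomial.homogeneousComponent_zero]
    · simp only [H]; rw [pderiv_homogeneousComponent, pderiv_homogeneousComponent, hab]
  have heuler : ∀ n q, MvPolynomial.X 0 * MvPolynomial.pderiv 0 (H n q) +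
      MvPolynomial.X 1 * MvPolynomial.pderiv 1 (H n q) = (n : ℝ) • H n q := by
    intro n q
    have := (MvPolynomial.homogeneousComponent_isHomogeneous n q).sum_X_mul_pderiv
    rw [Fin.sum_univ_two] at this
    rw [this, ← Nat.cast_smul_eq_nsmul ℝ]
  have hP0 : ∀ n, MvPolynomial.pderiv 0 (P n) = H n a := by
    intro n
    have hn : ((n : ℝ) + 1) ≠ 0 := by positivity
    simp only [P, Derivation.map_smul, map_add, Derivation.leibniz, MvPolynomial.pderiv_X, smul_eq_mul]
    rw [← hclosed]
    rw [inv_smul_eq_iff₀ hn, add_smul, ← heuler n a]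
    simp
    ring
  have hP1 : ∀ n, MvPolynomial.pderiv 1 (P n) = H n b := by
    intro n
    have hn : ((n : ℝ) + 1) ≠ 0 := by positivity
    simp only [P, Derivation.map_smul, map_add, Derivation.leibniz, MvPolynomial.pderiv_X, smul_eq_mul]
    rw [hclosed]
    rw [inv_smul_eq_iff₀ hn, add_smul, ← heuler n b]
    simp
    ring
  have hsum : ∀ q : MvPolynomial (Fin 2) ℝ, q.totalDegree ≤ k →
      ∑ n ∈ Finset.range (k + 1), H n q = q := by
    intro q hq
    conv_rhs => rw [← MvPolynomial.sum_homogeneousComponent q]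
    refine (Finset.sum_subset (Finset.range_mono (by omega)) fun n _ hn => ?_).symm
    exact MvPolynomial.homogeneousComponent_eq_zero _ _ (by simpa using hn)
  refine ⟨∑ n ∈ Finset.range (k + 1), P n, ?_, ?_, ?_⟩
  · refine MvPolynomial.totalDegree_finsetSum_le fun n hn => ?_
    refine (MvPolynomial.totalDegree_smul_le _ _).trans ?_
    refine (MvPolynomial.totalDegree_add _ _).trans (max_le ?_ ?_) <;>
    · refine (MvPolynomial.totalDegree_mul _ _).trans ?_
      rw [MvPolynomial.totalDegree_X]
      have h1 := Finset.mem_range.1 hn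
      have h2 := fun q => (MvPolynomial.homogeneousComponent_isHomogeneous (R := ℝ) (σ := Fin 2)
        n q).totalDegree_le
      first | (have := h2 a; simp only [H]; omega) | (have := h2 b; simp only [H]; omega)
  · rw [map_sum, Finset.sum_congr rfl fun n _ => hP0 n, hsum a ha]
  · rw [map_sum, Finset.sum_congr rfl fun n _ => hP1 n, hsum b hb]

/-! ### Green's formula on a triangle -/

/-- The oriented (doubled) area `det (q - p, x - p)` of the triangle `p q x`. -/
def orient (p q x : Plane) : ℝ := (q 0 - p 0) * (x 1 - p 1) - (q 1 - p 1) * (x 0 - p 0)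

/-- The flux `∫ F · ν` of the field `F` through the segment from `p` to `q`, where `ν` is the unit
normal to the right of the direction of travel. -/
noncomputable def edgeFlux (p q : Plane) (F : Fin 2 → Plane → ℝ) : ℝ :=
  ∫ s in (0 : ℝ)..1, (F 0 (AffineMap.lineMap p q s) * (q 1 - p 1) -
    F 1 (AffineMap.lineMap p q s) * (q 0 - p 0))

lemma lineMap_coord (p q : Plane) (s : ℝ) (i : Fin 2) :
    (AffineMap.lineMap p q s : Plane) i = p i + s * (q i - p i) := by
  simp [AffineMap.lineMap_apply]; ring

lemma orient_swap (p q x : Plane) : orient q p x = -orient p q x := by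
  unfold orient; ring

lemma orient_rotate (p q x : Plane) : orient q x p = orient p q x := by
  unfold orient; ring

lemma orient_swap_right (p q x : Plane) : orient p x q = -orient p q x := by
  unfold orient; ring

@[simp] lemma orient_self_left (p q : Plane) : orient p q p = 0 := by unfold orient; ring

@[simp] lemma orient_self_right (p q : Plane) : orient p q q = 0 := by unfold orient; ring

lemma orient_lineMap (p q x y : Plane) (s : ℝ) :
    orient p q (AffineMap.lineMap x y s) = (1 - s) * orient p q x + s * orient p q y := by
  simp only [orient, lineMap_coord]; ring

lemma eq_barycentric {a b c : Plane} (hD : orient a b c ≠ 0) (x : Plane) :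
    x = a + (orient a x c / orient a b c) • (b - a) + (orient a b x / orient a b c) • (c - a) := by
  ext i
  have : ∀ u v w : ℝ, x i = a i + u / orient a b c * v + w / orient a b c * (c i - a i) ↔
      (x i - a i) * orient a b c = u * v + w * (c i - a i) := by
    intro u v w
    field_simp
    constructor <;> intro h <;> linarith
  simp only [PiLp.add_apply, PiLp.smul_apply, PiLp.sub_apply, smul_eq_mul]
  rw [this]
  fin_cases i <;> simp [orient] <;> ring

lemma orient_affine_right (a b c : Plane) (s t : ℝ) :
    orient a b (a + s • (b - a) + t • (c - a)) = t * orient a b c := by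
  simp [orient]; ring

lemma orient_affine_left (a b c : Plane) (s t : ℝ) :
    orient a (a + s • (b - a) + t • (c - a)) c = s * orient a b c := by
  simp [orient]; ring

lemma mem_convexHull_triple_iff (a b c x : Plane) :
    x ∈ convexHull ℝ ({a, b, c} : Set Plane) ↔
      ∃ s t : ℝ, 0 ≤ s ∧ 0 ≤ t ∧ s + t ≤ 1 ∧ x = a + s • (b - a) + t • (c - a) := by
  rw [convexHull_insert (by simp), convexHull_pair, mem_convexJoin]
  constructor
  · rintro ⟨_, rfl, y, ⟨u, v, hu, hv, huv, rfl⟩, ⟨w, z, hw, hz, hwz, rfl⟩⟩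
    refine ⟨z * u, z * v, by positivity, by positivity, by nlinarith, ?_⟩
    obtain rfl : w = 1 - z := by linarith
    obtain rfl : u = 1 - v := by linarith
    module
  · rintro ⟨s, t, hs, ht, hst, rfl⟩
    refine ⟨a, rfl, ?_⟩
    rcases (add_nonneg hs ht).eq_or_lt with h | h
    · obtain rfl : s = 0 := by linarith
      obtain rfl : t = 0 := by linarith
      exact ⟨b, left_mem_segment _ _ _, by simpa using left_mem_segment ℝ a b⟩
    · refine ⟨(s / (s + t)) • b + (t / (s + t)) • c,
        ⟨s / (s + t), t / (s + t), by positivity, by positivity, by field_simp, rfl⟩,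
        1 - (s + t), s + t, by linarith, h.le, by ring, ?_⟩
      rw [smul_add, smul_smul, smul_smul, mul_div_cancel₀ _ h.ne', mul_div_cancel₀ _ h.ne']
      module

lemma mem_convexHull_triple_iff_orient {a b c : Plane} (hD : orient a b c ≠ 0) (x : Plane) :
    x ∈ convexHull ℝ ({a, b, c} : Set Plane) ↔
      0 ≤ orient a x c / orient a b c ∧ 0 ≤ orient a b x / orient a b c ∧
        orient a x c / orient a b c + orient a b x / orient a b c ≤ 1 := by
  rw [mem_convexHull_triple_iff]
  constructor
  · rintro ⟨s, t, hs, ht, hst, rfl⟩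
    rw [orient_affine_left, orient_affine_right, mul_div_cancel_right₀ _ hD,
      mul_div_cancel_right₀ _ hD]
    exact ⟨hs, ht, hst⟩
  · rintro ⟨h1, h2, h3⟩
    exact ⟨_, _, h1, h2, h3, eq_barycentric hD x⟩

/-- The standard triangle in `ℝ × ℝ`. -/
def stdTriangle : Set (ℝ × ℝ) := {z | 0 ≤ z.1 ∧ 0 ≤ z.2 ∧ z.1 + z.2 ≤ 1}

lemma isClosed_stdTriangle : IsClosed stdTriangle :=
  (isClosed_le continuous_const continuous_fst).inter
    ((isClosed_le continuous_const continuous_snd).inter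
      (isClosed_le (continuous_fst.add continuous_snd) continuous_const))

lemma isCompact_stdTriangle : IsCompact stdTriangle := by
  refine (isCompact_Icc (a := ((0 : ℝ), (0 : ℝ))) (b := (1, 1))).of_isClosed_subset
    isClosed_stdTriangle ?_
  rintro ⟨s, t⟩ ⟨h1, h2, h3⟩
  simp only at h1 h2 h3
  exact ⟨⟨h1, h2⟩, ⟨by simp only; linarith, by simp only; linarith⟩⟩

lemma setIntegral_stdTriangle {f : ℝ × ℝ → ℝ} (hf : Continuous f) :
    ∫ z in stdTriangle, f z = ∫ x in (0 : ℝ)..1, ∫ y in (0 : ℝ)..(1 - x), f (x, y) := by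
  have hm := isClosed_stdTriangle.measurableSet
  have hint : Integrable (stdTriangle.indicator f) (volume.prod volume) := by
    rw [← Measure.volume_eq_prod, integrable_indicator_iff hm]
    exact hf.continuousOn.integrableOn_compact isCompact_stdTriangle
  rw [← integral_indicator hm, Measure.volume_eq_prod, integral_prod _ hint,
    intervalIntegral.integral_of_le zero_le_one, ← integral_Icc_eq_integral_Ioc,
    ← integral_indicator measurableSet_Icc]
  refine integral_congr_ae (Eventually.of_forall fun x => ?_)
  by_cases hx : x ∈ Icc (0 : ℝ) 1
  · simp only [indicator_of_mem hx]
    rw [intervalIntegral.integral_of_le (by linarith [hx.2]), ← integral_Icc_eq_integral_Ioc,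
      ← integral_indicator measurableSet_Icc]
    refine integral_congr_ae (Eventually.of_forall fun y => ?_)
    by_cases hy : y ∈ Icc (0 : ℝ) (1 - x)
    · have h : (x, y) ∈ stdTriangle := ⟨hx.1, hy.1, by simp only; linarith [hy.2]⟩
      rw [indicator_of_mem hy]
      exact indicator_of_mem h f
    · have h : (x, y) ∉ stdTriangle := fun h => hy ⟨h.2.1, by
        have := h.2.2
        simp only at this
        linarith⟩
      rw [indicator_of_notMem hy]
      exact indicator_of_notMem h f
  · simp only [indicator_of_notMem hx]
    refine integral_eq_zero_of_ae (Eventually.of_forall fun y => ?_)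
    refine indicator_of_notMem (fun h => hx ⟨h.1, ?_⟩) f
    have h2 := h.2.1
    have h3 := h.2.2
    simp only at h2 h3
    linarith

lemma setIntegral_stdTriangle_symm {f : ℝ × ℝ → ℝ} (hf : Continuous f) :
    ∫ z in stdTriangle, f z = ∫ y in (0 : ℝ)..1, ∫ x in (0 : ℝ)..(1 - y), f (x, y) := by
  have hsw : MeasurePreserving (Prod.swap : ℝ × ℝ → ℝ × ℝ) volume volume := by
    rw [Measure.volume_eq_prod]; exact Measure.measurePreserving_swap
  have h1 : Prod.swap ⁻¹' stdTriangle = stdTriangle := by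
    ext ⟨x, y⟩
    simp only [stdTriangle, mem_preimage, mem_ofPred_eq, Prod.fst_swap, Prod.snd_swap]
    constructor <;> rintro ⟨h1, h2, h3⟩ <;> exact ⟨h2, h1, by linarith⟩
  have h2 := hsw.setIntegral_preimage_emb MeasurableEquiv.prodComm.measurableEmbedding f stdTriangle
  rw [h1] at h2
  rw [← h2]
  exact setIntegral_stdTriangle (f := fun z => f z.swap) (hf.comp continuous_swap)

lemma integral_divergence_stdTriangle {G₁ G₂ g₁ g₂ : ℝ × ℝ → ℝ} (hg₁ : Continuous g₁)
    (hg₂ : Continuous g₂) (hG₁ : Continuous G₁) (hG₂ : Continuous G₂)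
    (h₁ : ∀ s t, HasDerivAt (fun s => G₁ (s, t)) (g₁ (s, t)) s)
    (h₂ : ∀ s t, HasDerivAt (fun t => G₂ (s, t)) (g₂ (s, t)) t) :
    ∫ z in stdTriangle, (g₁ z + g₂ z) =
      ∫ s in (0 : ℝ)..1, (G₁ (1 - s, s) - G₁ (0, s) + G₂ (s, 1 - s) - G₂ (s, 0)) := by
  have hi : ∀ {g : ℝ × ℝ → ℝ}, Continuous g → IntegrableOn g stdTriangle := fun hg =>
    hg.continuousOn.integrableOn_compact isCompact_stdTriangle
  rw [integral_add (hi hg₁) (hi hg₂), setIntegral_stdTriangle_symm hg₁,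
    setIntegral_stdTriangle hg₂, ← intervalIntegral.integral_add]
  · refine intervalIntegral.integral_congr fun s _ => ?_
    have e1 : ∫ x in (0 : ℝ)..(1 - s), g₁ (x, s) = G₁ (1 - s, s) - G₁ (0, s) :=
      intervalIntegral.integral_eq_sub_of_hasDerivAt (fun x _ => h₁ x s)
        ((by fun_prop : Continuous fun x => g₁ (x, s)).intervalIntegrable _ _)
    have e2 : ∫ y in (0 : ℝ)..(1 - s), g₂ (s, y) = G₂ (s, 1 - s) - G₂ (s, 0) :=
      intervalIntegral.integral_eq_sub_of_hasDerivAt (fun y _ => h₂ s y)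
        ((by fun_prop : Continuous fun y => g₂ (s, y)).intervalIntegrable _ _)
    simp only [e1, e2]; ring
  · have : (fun y => ∫ x in (0 : ℝ)..(1 - y), g₁ (x, y)) =
        fun y => G₁ (1 - y, y) - G₁ (0, y) := by
      ext y
      exact intervalIntegral.integral_eq_sub_of_hasDerivAt (fun x _ => h₁ x y)
        ((by fun_prop : Continuous fun x => g₁ (x, y)).intervalIntegrable _ _)
    rw [this]
    exact (by fun_prop : Continuous fun y => G₁ (1 - y, y) - G₁ (0, y)).intervalIntegrable _ _
  · have : (fun x => ∫ y in (0 : ℝ)..(1 - x), g₂ (x, y)) =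
        fun x => G₂ (x, 1 - x) - G₂ (x, 0) := by
      ext x
      exact intervalIntegral.integral_eq_sub_of_hasDerivAt (fun y _ => h₂ x y)
        ((by fun_prop : Continuous fun y => g₂ (x, y)).intervalIntegrable _ _)
    rw [this]
    exact (by fun_prop : Continuous fun x => G₂ (x, 1 - x) - G₂ (x, 0)).intervalIntegrable _ _

/-- The linear map with columns `u`, `v`. -/
noncomputable def columnMap (u v : Plane) : Plane →L[ℝ] Plane :=
  (EuclideanSpace.proj 0 : Plane →L[ℝ] ℝ).smulRight u +
    (EuclideanSpace.proj 1 : Plane →L[ℝ] ℝ).smulRight v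

lemma columnMap_apply (u v x : Plane) : columnMap u v x = x 0 • u + x 1 • v := by
  simp [columnMap]

lemma det_columnMap (u v : Plane) : (columnMap u v).det = u 0 * v 1 - u 1 * v 0 := by
  have h : (columnMap u v).det = LinearMap.det (columnMap u v : Plane →ₗ[ℝ] Plane) := rfl
  rw [h, ← LinearMap.det_toMatrix (EuclideanSpace.basisFun (Fin 2) ℝ).toBasis,
    Matrix.det_fin_two]
  simp [LinearMap.toMatrix_apply, columnMap_apply]
  ring

lemma setIntegral_triangle (a b c : Plane) (hD : orient a b c ≠ 0) (g : Plane → ℝ) :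
    ∫ x in convexHull ℝ ({a, b, c} : Set Plane), g x =
      |orient a b c| * ∫ z in stdTriangle, g (a + z.1 • (b - a) + z.2 • (c - a)) := by
  let E : ℝ × ℝ ≃ᵐ Plane := MeasurableEquiv.finTwoArrow.symm.trans (MeasurableEquiv.toLp 2 _)
  have hE : MeasurePreserving E volume volume :=
    (volume_preserving_finTwoArrow ℝ).symm.trans (PiLp.volume_preserving_toLp (Fin 2))
  have hE0 : ∀ z, E z 0 = z.1 := fun z => rfl
  have hE1 : ∀ z, E z 1 = z.2 := fun z => rfl
  let A : Plane → Plane := fun x => a + columnMap (b - a) (c - a) x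
  have hA : ∀ x, HasFDerivAt A (columnMap (b - a) (c - a)) x := fun x =>
    (columnMap (b - a) (c - a)).hasFDerivAt.const_add a
  have hAE : ∀ z, A (E z) = a + z.1 • (b - a) + z.2 • (c - a) := by
    intro z
    simp only [A, columnMap_apply, hE0, hE1, add_assoc]
  have hinj : Function.Injective A := by
    intro x y hxy
    have h1 := congrArg (fun z => orient a z c) hxy
    have h2 := congrArg (fun z => orient a b z) hxy
    simp only [A, columnMap_apply, ← add_assoc, orient_affine_left, orient_affine_right,
      mul_eq_mul_right_iff, hD, or_false] at h1 h2
    ext i; fin_cases i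
    · exact h1
    · exact h2
  have himage : convexHull ℝ ({a, b, c} : Set Plane) = A '' (E '' stdTriangle) := by
    ext x
    rw [mem_convexHull_triple_iff]
    simp only [mem_image, exists_exists_and_eq_and]
    constructor
    · rintro ⟨s, t, hs, ht, hst, rfl⟩
      exact ⟨(s, t), ⟨hs, ht, hst⟩, hAE _⟩
    · rintro ⟨z, ⟨h1, h2, h3⟩, rfl⟩
      exact ⟨z.1, z.2, h1, h2, h3, hAE _⟩
  have hms : MeasurableSet (E '' stdTriangle) :=
    E.measurableEmbedding.measurableSet_image.2 isClosed_stdTriangle.measurableSet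
  rw [himage, integral_image_eq_integral_abs_det_fderiv_smul volume hms
    (fun x _ => (hA x).hasFDerivWithinAt) hinj.injOn,
    hE.setIntegral_image_emb E.measurableEmbedding, det_columnMap, ← integral_const_mul]
  simp only [hAE, smul_eq_mul]
  rfl

lemma hasDerivAt_comp_line {f : Plane → ℝ} (hf : ContDiff ℝ 1 f) {γ : ℝ → Plane} {v : Plane}
    {s : ℝ} (hγ : HasDerivAt γ v s) :
    HasDerivAt (fun s => f (γ s)) (v 0 * pd 0 f (γ s) + v 1 * pd 1 f (γ s)) s := by
  rw [← fderiv_apply_eq_pd]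
  exact ((hf.differentiable (by simp) (γ s)).hasFDerivAt).comp_hasDerivAt s hγ

lemma continuous_pd {f : Plane → ℝ} (hf : ContDiff ℝ 1 f) (j : Fin 2) : Continuous (pd j f) :=
  (hf.continuous_fderiv (by simp)).clm_apply continuous_const

/-- Green's formula on a triangle. -/
theorem integral_divergence_triangle {a b c : Plane} (hD : orient a b c ≠ 0)
    {F : Fin 2 → Plane → ℝ} (hF : ∀ i, ContDiff ℝ 1 (F i)) :
    ∫ x in convexHull ℝ ({a, b, c} : Set Plane), (pd 0 (F 0) x + pd 1 (F 1) x) =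
      Real.sign (orient a b c) * (edgeFlux a b F + edgeFlux b c F + edgeFlux c a F) := by
  rw [setIntegral_triangle a b c hD]
  set α : Plane := b - a with hα
  set β : Plane := c - a with hβ
  set D := orient a b c with hDdef
  have hDe : D = α 0 * β 1 - α 1 * β 0 := rfl
  let Φ : ℝ × ℝ → Plane := fun z => a + z.1 • α + z.2 • β
  have hΦ : Continuous Φ := by fun_prop
  have hFc : ∀ i, Continuous (F i) := fun i => (hF i).continuous
  have hpc : ∀ i j, Continuous (pd j (F i)) := fun i j => continuous_pd (hF i) j
  have hΦ1 : ∀ s t, HasDerivAt (fun s => Φ (s, t)) α s := by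
    intro s t
    have := (((hasDerivAt_id s).smul_const α).const_add a).add_const (t • β)
    simpa [Φ] using this
  have hΦ2 : ∀ s t, HasDerivAt (fun t => Φ (s, t)) β t := by
    intro s t
    have := ((hasDerivAt_id t).smul_const β).const_add (a + s • α)
    simpa [Φ] using this
  let G₁ : ℝ × ℝ → ℝ := fun z => F 0 (Φ z) * β 1 - F 1 (Φ z) * β 0
  let G₂ : ℝ × ℝ → ℝ := fun z => F 1 (Φ z) * α 0 - F 0 (Φ z) * α 1
  let g₁ : ℝ × ℝ → ℝ := fun z => (α 0 * pd 0 (F 0) (Φ z) + α 1 * pd 1 (F 0) (Φ z)) * β 1 -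
    (α 0 * pd 0 (F 1) (Φ z) + α 1 * pd 1 (F 1) (Φ z)) * β 0
  let g₂ : ℝ × ℝ → ℝ := fun z => (β 0 * pd 0 (F 1) (Φ z) + β 1 * pd 1 (F 1) (Φ z)) * α 0 -
    (β 0 * pd 0 (F 0) (Φ z) + β 1 * pd 1 (F 0) (Φ z)) * α 1
  have key := integral_divergence_stdTriangle (G₁ := G₁) (G₂ := G₂) (g₁ := g₁) (g₂ := g₂)
    (by fun_prop) (by fun_prop) (by fun_prop) (by fun_prop)
    (fun s t => ((hasDerivAt_comp_line (hF 0) (hΦ1 s t)).mul_const _).sub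
      ((hasDerivAt_comp_line (hF 1) (hΦ1 s t)).mul_const _))
    (fun s t => ((hasDerivAt_comp_line (hF 1) (hΦ2 s t)).mul_const _).sub
      ((hasDerivAt_comp_line (hF 0) (hΦ2 s t)).mul_const _))
  have hdiv : ∀ z, g₁ z + g₂ z = D * (pd 0 (F 0) (Φ z) + pd 1 (F 1) (Φ z)) := by
    intro z; simp only [g₁, g₂, hDe]; ring
  simp only [hdiv, integral_const_mul] at key
  have hsign : |D| = Real.sign D * D := by
    rcases hD.lt_or_gt with h | h
    · rw [abs_of_neg h, Real.sign_of_neg h]; ring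
    · rw [abs_of_pos h, Real.sign_of_pos h]; ring
  rw [hsign, mul_assoc]
  congr 1
  rw [key]
  -- the edge from `c` to `a` is traversed backwards in the parametrization of the triangle
  have hab : edgeFlux a b F = ∫ s in (0 : ℝ)..1, -G₂ (s, 0) := by
    refine intervalIntegral.integral_congr fun s _ => ?_
    have : (AffineMap.lineMap a b s : Plane) = Φ (s, 0) := by
      ext i; rw [lineMap_coord]; simp [Φ, hα]
    simp only [this, G₂, hα, PiLp.sub_apply]; ring
  have hca : edgeFlux c a F = ∫ s in (0 : ℝ)..1, -G₁ (0, s) := by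
    have h1 : edgeFlux c a F = ∫ s in (0 : ℝ)..1, (fun s => -G₁ (0, s)) (1 - s) := by
      refine intervalIntegral.integral_congr fun s _ => ?_
      have : (AffineMap.lineMap c a s : Plane) = Φ (0, 1 - s) := by
        ext i; rw [lineMap_coord]; simp [Φ, hβ]; ring
      simp only [this, G₁, hβ, PiLp.sub_apply]; ring
    rw [h1, intervalIntegral.integral_comp_sub_left (fun s => -G₁ (0, s)) 1]; simp
  have hbc : edgeFlux b c F = ∫ s in (0 : ℝ)..1, (G₁ (1 - s, s) + G₂ (1 - s, s)) := by
    refine intervalIntegral.integral_congr fun s _ => ?_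
    have : (AffineMap.lineMap b c s : Plane) = Φ (1 - s, s) := by
      ext i; rw [lineMap_coord]; simp [Φ, hα, hβ]; ring
    simp only [this, G₁, G₂, hα, hβ, PiLp.sub_apply]; ring
  have hG₁ : Continuous G₁ := by fun_prop
  have hG₂ : Continuous G₂ := by fun_prop
  have hflip : ∫ s in (0 : ℝ)..1, G₂ (1 - s, s) = ∫ s in (0 : ℝ)..1, G₂ (s, 1 - s) := by
    have := intervalIntegral.integral_comp_sub_left (a := (0 : ℝ)) (b := 1)
      (fun s => G₂ (1 - s, s)) 1
    simp only [sub_self, sub_zero, sub_sub_cancel] at this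
    exact this.symm
  rw [hab, hca, hbc, intervalIntegral.integral_add, hflip, ← intervalIntegral.integral_add,
    ← intervalIntegral.integral_add, ← intervalIntegral.integral_add]
  · refine intervalIntegral.integral_congr fun s _ => ?_
    ring
  all_goals exact Continuous.intervalIntegrable (by fun_prop) _ _

/-! ### Lipschitz domains -/

/-- A boundary chart: near a boundary point of a Lipschitz domain there are coordinates in which
the domain lies above the graph of a Lipschitz function through the given point. -/
lemma HasLipschitzBoundary.exists_chart {Ω : Set Plane} (hL : HasLipschitzBoundary Ω)
    (hO : IsOpen Ω) {x : Plane} (hx : x ∈ frontier Ω) :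
    ∃ (h : Plane ≃ₜ ℝ × ℝ) (φ : ℝ → ℝ) (K : NNReal) (V : Set Plane),
      LipschitzWith K φ ∧ IsOpen V ∧ x ∈ V ∧ (∀ y ∈ V, (y ∈ Ω ↔ φ (h y).1 < (h y).2)) ∧
        φ (h x).1 = (h x).2 := by
  obtain ⟨e, φ, K, V, hφ, hV, hxV, hy⟩ := hL x hx
  let h : Plane ≃ₜ ℝ × ℝ := e.toHomeomorph.trans
    ((PiLp.homeomorph 2 (fun _ : Fin 2 => ℝ)).trans Homeomorph.finTwoArrow)
  have hh : ∀ y, h y = (e y 0, e y 1) := fun y => rfl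
  refine ⟨h, φ, K, V, hφ, hV, hxV, fun y hyV => by rw [hh]; exact hy y hyV, ?_⟩
  have hφc := hφ.continuous
  have hhc := h.continuous
  rw [hO.frontier_eq] at hx
  refine le_antisymm ?_ ?_
  · by_contra! hlt
    have hopen : IsOpen (V ∩ {y | (h y).2 < φ (h y).1}) :=
      hV.inter (isOpen_lt (by fun_prop) (by fun_prop))
    obtain ⟨y, ⟨hyV, hy1⟩, hyΩ⟩ := mem_closure_iff.1 hx.1 _ hopen ⟨hxV, hlt⟩
    exact absurd ((hy y hyV).1 hyΩ) (not_lt.2 (le_of_lt hy1))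
  · by_contra! hlt
    exact hx.2 ((hy x hxV).2 hlt)

lemma HasLipschitzBoundary.interior_closure {Ω : Set Plane} (hL : HasLipschitzBoundary Ω)
    (hO : IsOpen Ω) : interior (closure Ω) = Ω := by
  refine Subset.antisymm (fun x hx => ?_) hO.subset_interior_closure
  by_contra hxΩ
  have hxf : x ∈ frontier Ω := by rw [hO.frontier_eq]; exact ⟨interior_subset hx, hxΩ⟩
  obtain ⟨h, φ, K, V, hφ, hV, hxV, hy, hgr⟩ := hL.exists_chart hO hxf
  have hφc := hφ.continuous
  have hhc := h.continuous
  have hhs := h.symm.continuous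
  have ht : Tendsto (fun ε : ℝ => h.symm ((h x).1, (h x).2 - ε)) (𝓝[>] 0) (𝓝 x) := by
    have : Continuous (fun ε : ℝ => h.symm ((h x).1, (h x).2 - ε)) := by fun_prop
    have h0 := this.tendsto 0
    simp only [sub_zero, Prod.mk.eta, h.symm_apply_apply] at h0
    exact h0.mono_left nhdsWithin_le_nhds
  have hev := (ht.eventually (isOpen_interior.mem_nhds hx)).and
    ((ht.eventually (hV.mem_nhds hxV)).and self_mem_nhdsWithin)
  obtain ⟨ε, h1, h2, h3⟩ := hev.exists
  have hopen : IsOpen (V ∩ {y | (h y).2 < φ (h y).1}) :=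
    hV.inter (isOpen_lt (by fun_prop) (by fun_prop))
  obtain ⟨y, ⟨hyV, hy1⟩, hyΩ⟩ := mem_closure_iff.1 (interior_subset h1) _ hopen
    ⟨h2, by simp only [mem_ofPred_eq, h.apply_symm_apply, hgr]; simpa using h3⟩
  exact absurd ((hy y hyV).1 hyΩ) (not_lt.2 (le_of_lt hy1))

/-- A Lipschitz domain is locally connected at its boundary points. -/
lemma HasLipschitzBoundary.exists_preconnected {Ω : Set Plane} (hL : HasLipschitzBoundary Ω)
    (hO : IsOpen Ω) {x : Plane} (hx : x ∈ frontier Ω) {U : Set Plane} (hU : U ∈ 𝓝 x) :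
    ∃ W ∈ 𝓝 x, W ⊆ U ∧ IsPreconnected (W ∩ Ω) := by
  obtain ⟨h, φ, K, V, hφ, hV, hxV, hy, hgr⟩ := hL.exists_chart hO hx
  have hhs := h.symm.continuous
  set s₀ := (h x).1
  set t₀ := (h x).2
  have hpre : h.symm ⁻¹' (V ∩ U) ∈ 𝓝 (s₀, t₀) := by
    refine hhs.continuousAt.preimage_mem_nhds ?_
    simp only [s₀, t₀, Prod.mk.eta, h.symm_apply_apply]
    exact inter_mem (hV.mem_nhds hxV) hU
  obtain ⟨η, hη, hball⟩ := Metric.mem_nhds_iff.1 hpre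
  obtain ⟨δ, hδ, hδη, hKδ⟩ : ∃ δ > 0, δ ≤ η ∧ K * δ < η := by
    have hK : (0 : ℝ) ≤ K := K.2
    refine ⟨η / (K + 1), by positivity, ?_, ?_⟩
    · exact div_le_self hη.le (by linarith)
    · rw [mul_div_assoc', div_lt_iff₀ (by positivity)]; nlinarith
  let t₁ : ℝ := t₀ + (K * δ + η) / 2
  have hφb : ∀ s, |s - s₀| < δ → φ s < t₁ ∧ φ s < t₀ + η := by
    intro s hs
    have h1 := hφ.dist_le_mul s s₀
    rw [Real.dist_eq, Real.dist_eq] at h1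
    have h2 := (abs_le.1 h1).2
    have h3 : (K : ℝ) * |s - s₀| ≤ K * δ := mul_le_mul_of_nonneg_left hs.le K.2
    have h4 : φ s₀ = t₀ := hgr
    simp only [t₁]
    constructor <;> linarith
  let B : Set (ℝ × ℝ) := {z | |z.1 - s₀| < δ ∧ |z.2 - t₀| < η}
  have hBo : IsOpen B := by
    have h1 : IsOpen {z : ℝ × ℝ | |z.1 - s₀| < δ} := isOpen_lt (by fun_prop) continuous_const
    have h2 : IsOpen {z : ℝ × ℝ | |z.2 - t₀| < η} := isOpen_lt (by fun_prop) continuous_const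
    exact h1.inter h2
  have hBball : ∀ z ∈ B, h.symm z ∈ V ∩ U := by
    rintro z ⟨h1, h2⟩
    refine hball ?_
    rw [Metric.mem_ball, Prod.dist_eq, max_lt_iff, Real.dist_eq, Real.dist_eq]
    exact ⟨h1.trans_le hδη, h2⟩
  let Q : Set (ℝ × ℝ) := {z | z ∈ B ∧ φ z.1 < z.2}
  have ht₁ : |t₁ - t₀| < η := by
    have hK : (0 : ℝ) ≤ K * δ := mul_nonneg K.2 hδ.le
    simp only [t₁, add_sub_cancel_left]
    rw [abs_of_nonneg (by linarith)]; linarith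
  have hQ : IsPreconnected Q := by
    refine isPreconnected_of_forall (s₀, t₁) ?_
    rintro ⟨s, t⟩ ⟨⟨hs, ht⟩, hst⟩
    simp only at hs ht hst
    have hK : (0 : ℝ) ≤ K * δ := mul_nonneg K.2 hδ.le
    let L₁ : Set (ℝ × ℝ) := (uIcc s₀ s) ×ˢ {t₁}
    let L₂ : Set (ℝ × ℝ) := {s} ×ˢ (uIcc t t₁)
    have hbd : ∀ {a b c z r : ℝ}, z ∈ uIcc a b → |a - c| < r → |b - c| < r → |z - c| < r := by
      intro a b c z r hz ha hb
      rw [abs_lt] at *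
      rcases mem_uIcc.1 hz with h | h <;> constructor <;> linarith
    refine ⟨L₁ ∪ L₂, ?_, Or.inl ⟨left_mem_uIcc, rfl⟩, Or.inr ⟨rfl, left_mem_uIcc⟩, ?_⟩
    · rintro ⟨u, v⟩ (⟨hu, hv⟩ | ⟨hu, hv⟩)
      · simp only [mem_singleton_iff] at hu hv
        subst hv
        have hus := hbd hu (by simpa using hδ) hs
        exact ⟨⟨hus, ht₁⟩, (hφb u hus).1⟩
      · simp only [mem_singleton_iff] at hu hv
        subst hu
        refine ⟨⟨hs, hbd hv ht ht₁⟩, ?_⟩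
        have := (hφb u hs).1
        simp only
        rcases mem_uIcc.1 hv with h | h <;> linarith
    · refine IsPreconnected.union (s, t₁) ⟨right_mem_uIcc, rfl⟩ ⟨rfl, right_mem_uIcc⟩ ?_ ?_
      · exact isPreconnected_uIcc.prod isPreconnected_singleton
      · exact isPreconnected_singleton.prod isPreconnected_uIcc
  refine ⟨h ⁻¹' B, ?_, fun y hyB => ?_, ?_⟩
  · refine (hBo.preimage h.continuous).mem_nhds ?_
    exact ⟨by simpa [s₀] using hδ, by simpa [t₀] using hη⟩
  · simpa using (hBball _ hyB).2
  · have : h ⁻¹' B ∩ Ω = h.symm '' Q := by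
      ext y
      simp only [mem_image]
      constructor
      · rintro ⟨hyB, hyΩ⟩
        have hyV : y ∈ V := by simpa using (hBball _ hyB).1
        exact ⟨h y, ⟨hyB, (hy y hyV).1 hyΩ⟩, by simp⟩
      · rintro ⟨z, ⟨hzB, hz⟩, rfl⟩
        refine ⟨by simpa using hzB, (hy _ (hBball _ hzB).1).2 (by simpa using hz)⟩
    rw [this]
    exact hQ.image _ hhs.continuousOn

/-- The boundary of a Lipschitz domain has no isolated points. -/
lemma HasLipschitzBoundary.frontier_accumulates {Ω : Set Plane} (hL : HasLipschitzBoundary Ω)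
    (hO : IsOpen Ω) {x : Plane} (hx : x ∈ frontier Ω) {U : Set Plane} (hU : U ∈ 𝓝 x) :
    ∃ y ∈ U ∩ frontier Ω, y ≠ x := by
  obtain ⟨h, φ, K, V, hφ, hV, hxV, hy, hgr⟩ := hL.exists_chart hO hx
  have hφc := hφ.continuous
  have hhs := h.symm.continuous
  have ht : Tendsto (fun s : ℝ => h.symm (s, φ s)) (𝓝[≠] (h x).1) (𝓝 x) := by
    have : Continuous (fun s : ℝ => h.symm (s, φ s)) := by fun_prop
    have h0 := this.tendsto (h x).1
    simp only [hgr, Prod.mk.eta, h.symm_apply_apply] at h0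
    exact h0.mono_left nhdsWithin_le_nhds
  obtain ⟨s, h1, h2, h3⟩ := ((ht.eventually hU).and
    ((ht.eventually (hV.mem_nhds hxV)).and self_mem_nhdsWithin)).exists
  refine ⟨_, ⟨h1, ?_⟩, ?_⟩
  · rw [hO.frontier_eq]
    refine ⟨?_, fun hΩ => ?_⟩
    · have ht2 : Tendsto (fun ε : ℝ => h.symm (s, φ s + ε)) (𝓝[>] 0) (𝓝 (h.symm (s, φ s))) := by
        have : Continuous (fun ε : ℝ => h.symm (s, φ s + ε)) := by fun_prop
        have h0 := this.tendsto 0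
        simp only [add_zero] at h0
        exact h0.mono_left nhdsWithin_le_nhds
      refine mem_closure_of_tendsto ht2 ?_
      filter_upwards [ht2.eventually (hV.mem_nhds h2), self_mem_nhdsWithin] with ε h4 h5
      refine (hy _ h4).2 ?_
      simpa using h5
    · have := (hy _ h2).1 hΩ
      simp at this
  · intro heq
    apply h3
    have := congrArg (fun y => (h y).1) heq
    simpa using this

/-! ### Geometry of a triangulation -/

lemma interior_orient_eq_zero {p q : Plane} (hpq : p ≠ q) :
    interior {x | orient p q x = 0} = ∅ := by
  rw [eq_empty_iff_forall_notMem]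
  intro x hx
  let n : Plane := !₂[-(q 1 - p 1), q 0 - p 0]
  have ht : Tendsto (fun ε : ℝ => x + ε • n) (𝓝[>] 0) (𝓝 x) := by
    have : Continuous (fun ε : ℝ => x + ε • n) := by fun_prop
    have h0 := this.tendsto 0
    simp only [zero_smul, add_zero] at h0
    exact h0.mono_left nhdsWithin_le_nhds
  obtain ⟨ε, h1, h2⟩ := ((ht.eventually (isOpen_interior.mem_nhds hx)).and
    self_mem_nhdsWithin).exists
  have h3 : x ∈ {x | orient p q x = 0} := interior_subset hx
  have h4 : x + ε • n ∈ {x | orient p q x = 0} := interior_subset h1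
  have h5 : orient p q (x + ε • n) = orient p q x +
      ε * ((q 0 - p 0) ^ 2 + (q 1 - p 1) ^ 2) := by
    simp [orient, n]; ring
  simp only [mem_ofPred_eq] at h3 h4
  rw [h5, h3, zero_add] at h4
  have h6 := (mul_eq_zero.1 h4).resolve_left (ne_of_gt h2)
  apply hpq
  ext i
  fin_cases i <;> simp <;> nlinarith [sq_nonneg (q 0 - p 0), sq_nonneg (q 1 - p 1)]

lemma orient_eq_zero_of_mem_segment {p q x : Plane} (hx : x ∈ segment ℝ p q) :
    orient p q x = 0 := by
  rw [segment_eq_image_lineMap] at hx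
  obtain ⟨s, -, rfl⟩ := hx
  simp [orient_lineMap]

lemma mem_openSegment_of_mem_segment {p q x : Plane} (hx : x ∈ segment ℝ p q) (hp : x ≠ p)
    (hq : x ≠ q) : x ∈ openSegment ℝ p q := by
  rw [← insert_endpoints_openSegment] at hx
  simpa [hp, hq] using hx

/-- A triangle is a neighbourhood of the interior points of its edges, on its side of the edge. -/
lemma eventually_mem_triangle {p q c m : Plane} (hD : orient p q c ≠ 0)
    (hm : m ∈ openSegment ℝ p q) :
    ∀ᶠ y in 𝓝 m, 0 ≤ orient p q y * orient p q c →
      y ∈ convexHull ℝ ({p, q, c} : Set Plane) := by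
  rw [openSegment_eq_image_lineMap] at hm
  obtain ⟨s, ⟨hs0, hs1⟩, rfl⟩ := hm
  set m : Plane := AffineMap.lineMap p q s with hm
  have e1 : orient p m c / orient p q c = s := by
    have : m = p + s • (q - p) + (0 : ℝ) • (c - p) := by
      rw [hm, AffineMap.lineMap_apply]; simp [add_comm]
    rw [this, orient_affine_left, mul_div_cancel_right₀ _ hD]
  have e2 : orient p q m / orient p q c = 0 := by simp [hm, orient_lineMap]
  have c1 : Continuous (fun y => orient p y c / orient p q c) := by unfold orient; fun_prop
  have c2 : Continuous (fun y => orient p q y / orient p q c) := by unfold orient; fun_prop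
  have v1 : ∀ᶠ y in 𝓝 m, 0 < orient p y c / orient p q c :=
    (c1.tendsto m).eventually (lt_mem_nhds (by rw [e1]; exact hs0))
  have v2 : ∀ᶠ y in 𝓝 m, orient p y c / orient p q c + orient p q y / orient p q c < 1 :=
    ((c1.add c2).tendsto m).eventually (gt_mem_nhds (by simpa [e1, e2] using hs1))
  filter_upwards [v1, v2] with y h1 h2 h3
  rw [mem_convexHull_triple_iff_orient hD]
  refine ⟨h1.le, ?_, h2.le⟩
  have h4 : orient p q y / orient p q c = orient p q y * orient p q c / (orient p q c) ^ 2 := by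
    field_simp
  rw [h4]; positivity

/-- A point of a nondegenerate triangle is interior or lies on an edge. -/
lemma mem_interior_or_mem_edge {a b c x : Plane} (hD : orient a b c ≠ 0)
    (hx : x ∈ convexHull ℝ ({a, b, c} : Set Plane)) :
    x ∈ interior (convexHull ℝ ({a, b, c} : Set Plane)) ∨ x ∈ segment ℝ a b ∨
      x ∈ segment ℝ b c ∨ x ∈ segment ℝ a c := by
  obtain ⟨h1, h2, h3⟩ := (mem_convexHull_triple_iff_orient hD x).1 hx
  have hxe := eq_barycentric hD x
  have hcont1 : Continuous (fun y => orient a y c / orient a b c) := by unfold orient; fun_prop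
  have hcont2 : Continuous (fun y => orient a b y / orient a b c) := by unfold orient; fun_prop
  rcases h1.eq_or_lt with h1' | h1'
  · right; right; right
    rw [← h1'] at hxe h3
    rw [segment_eq_image_lineMap]
    exact ⟨_, ⟨h2, by linarith⟩, by rw [AffineMap.lineMap_apply]; conv_rhs => rw [hxe]
                                    simp [add_comm]⟩
  rcases h2.eq_or_lt with h2' | h2'
  · right; left
    rw [← h2'] at hxe h3
    rw [segment_eq_image_lineMap]
    exact ⟨_, ⟨h1, by linarith⟩, by rw [AffineMap.lineMap_apply]; conv_rhs => rw [hxe]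
                                    simp [add_comm]⟩
  rcases h3.eq_or_lt with h3' | h3'
  · right; right; left
    rw [segment_eq_image_lineMap]
    refine ⟨_, ⟨h2, by linarith⟩, ?_⟩
    conv_rhs => rw [hxe]
    rw [show orient a x c / orient a b c = 1 - orient a b x / orient a b c by linarith,
      AffineMap.lineMap_apply]
    simp only [vsub_eq_sub, vadd_eq_add]
    module
  · left
    rw [mem_interior_iff_mem_nhds]
    filter_upwards [(hcont1.tendsto x).eventually (lt_mem_nhds h1'),
      (hcont2.tendsto x).eventually (lt_mem_nhds h2'),
      ((hcont1.add hcont2).tendsto x).eventually (gt_mem_nhds h3')] with y g1 g2 g3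
    exact (mem_convexHull_triple_iff_orient hD y).2 ⟨g1.le, g2.le, g3.le⟩

section Triangulation

variable {Ω : PolygonalDomain} {Γ : BoundaryParts Ω} (𝒯 : Triangulation Ω Γ)

/-- The triangles of a triangulation, given by their vertices. -/
noncomputable def Triangulation.tri : Finset (Finset Plane) :=
  (𝒯.finite.subset (sep_subset 𝒯.complex.faces fun t => t.card = 3)).toFinset

/-- The vertices of the triangles of a triangulation. -/
noncomputable def Triangulation.verts : Finset Plane := 𝒯.tri.biUnion id

variable {𝒯}

lemma Triangulation.mem_tri {t : Finset Plane} :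
    t ∈ 𝒯.tri ↔ t ∈ 𝒯.complex.faces ∧ t.card = 3 := by
  simp [Triangulation.tri]

lemma Triangulation.mem_verts {p : Plane} : p ∈ 𝒯.verts ↔ ∃ t ∈ 𝒯.tri, p ∈ t := by
  simp [Triangulation.verts]

lemma Triangulation.mem_triangles_of_tri {t : Finset Plane} (ht : t ∈ 𝒯.tri) :
    convexHull ℝ (t : Set Plane) ∈ 𝒯.triangles :=
  ⟨t, (mem_tri.1 ht).1, (mem_tri.1 ht).2, rfl⟩

lemma Triangulation.exists_tri {x : Plane} (hx : x ∈ closure Ω.carrier) :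
    ∃ t ∈ 𝒯.tri, x ∈ convexHull ℝ (t : Set Plane) := by
  obtain ⟨T, ⟨t, ht, hc, rfl⟩, hxT⟩ := 𝒯.exists_triangle hx
  exact ⟨t, mem_tri.2 ⟨ht, hc⟩, hxT⟩

lemma Triangulation.tri_subset {t : Finset Plane} (ht : t ∈ 𝒯.tri) :
    convexHull ℝ (t : Set Plane) ⊆ closure Ω.carrier :=
  𝒯.triangle_subset (mem_triangles_of_tri ht)

lemma Triangulation.interior_tri_subset {t : Finset Plane} (ht : t ∈ 𝒯.tri) :
    interior (convexHull ℝ (t : Set Plane)) ⊆ Ω.carrier := by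
  rw [← Ω.lipschitz.interior_closure Ω.isOpen]
  exact interior_mono (tri_subset ht)

lemma Triangulation.interior_tri_nonempty {t : Finset Plane} (ht : t ∈ 𝒯.tri) :
    (interior (convexHull ℝ (t : Set Plane))).Nonempty :=
  𝒯.triangle_interior (mem_triangles_of_tri ht)

lemma Triangulation.isClosed_tri (t : Finset Plane) :
    IsClosed (convexHull ℝ (t : Set Plane)) :=
  (t.finite_toSet.isCompact_convexHull ℝ).isClosed

lemma Triangulation.closure_interior_tri {t : Finset Plane} (ht : t ∈ 𝒯.tri) :
    closure (interior (convexHull ℝ (t : Set Plane))) = convexHull ℝ (t : Set Plane) := by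
  rw [(convex_convexHull ℝ (t : Set Plane)).closure_interior_eq_closure_of_nonempty_interior
    (interior_tri_nonempty ht), (isClosed_tri t).closure_eq]

lemma orient_ne_zero_of_interior {a b c : Plane} (hab : a ≠ b)
    (h : (interior (convexHull ℝ ({a, b, c} : Set Plane))).Nonempty) : orient a b c ≠ 0 := by
  intro h0
  have hsub : convexHull ℝ ({a, b, c} : Set Plane) ⊆ {x | orient a b x = 0} := by
    intro x hx
    obtain ⟨s, t, -, -, -, rfl⟩ := (mem_convexHull_triple_iff a b c x).1 hx
    simp [orient_affine_right, h0]
  have := interior_mono hsub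
  rw [interior_orient_eq_zero hab] at this
  exact (h.mono this).ne_empty rfl

lemma Triangulation.exists_apex {t : Finset Plane} (ht : t ∈ 𝒯.tri) {p q : Plane} (hp : p ∈ t)
    (hq : q ∈ t) (hpq : p ≠ q) :
    ∃ c, c ≠ p ∧ c ≠ q ∧ t = {p, q, c} ∧ orient p q c ≠ 0 := by
  have hsub : ({p, q} : Finset Plane) ⊆ t := by
    intro x hx
    simp only [Finset.mem_insert, Finset.mem_singleton] at hx
    rcases hx with rfl | rfl <;> assumption
  have hcard : (t \ {p, q}).card = 1 := by
    rw [Finset.card_sdiff_of_subset hsub, (mem_tri.1 ht).2, Finset.card_pair hpq]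
  obtain ⟨c, hc⟩ := Finset.card_eq_one.1 hcard
  have hct : c ∈ t \ {p, q} := by rw [hc]; simp
  simp only [Finset.mem_sdiff, Finset.mem_insert, Finset.mem_singleton, not_or] at hct
  have hte : t = {p, q, c} := by
    rw [← Finset.sdiff_union_of_subset hsub, hc]
    ext x; simp only [Finset.mem_union, Finset.mem_insert, Finset.mem_singleton]; tauto
  refine ⟨c, hct.2.1, hct.2.2, hte, ?_⟩
  have := interior_tri_nonempty ht
  rw [hte] at this
  refine orient_ne_zero_of_interior hpq ?_
  simpa using this

lemma Triangulation.exists_vertices {t : Finset Plane} (ht : t ∈ 𝒯.tri) :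
    ∃ a b c, a ≠ b ∧ a ≠ c ∧ b ≠ c ∧ t = {a, b, c} ∧ orient a b c ≠ 0 := by
  obtain ⟨a, b, c, hab, hac, hbc, rfl⟩ := Finset.card_eq_three.1 (mem_tri.1 ht).2
  refine ⟨a, b, c, hab, hac, hbc, rfl, orient_ne_zero_of_interior hab ?_⟩
  simpa using interior_tri_nonempty ht

lemma Triangulation.segment_subset_tri {t : Finset Plane} {p q : Plane} (hp : p ∈ t)
    (hq : q ∈ t) : segment ℝ p q ⊆ convexHull ℝ (t : Set Plane) :=
  (convex_convexHull ℝ _).segment_subset (subset_convexHull ℝ _ hp) (subset_convexHull ℝ _ hq)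

/-- Near `x`, only the faces that contain `x` are met. -/
lemma Triangulation.eventually_star (𝒯 : Triangulation Ω Γ) (x : Plane) :
    ∀ᶠ y in 𝓝 x, ∀ s ∈ 𝒯.complex.faces, y ∈ convexHull ℝ (s : Set Plane) →
      x ∈ convexHull ℝ (s : Set Plane) := by
  have := (Filter.eventually_all_finset (l := 𝓝 x) 𝒯.finite.toFinset
    (p := fun s y => y ∈ convexHull ℝ (s : Set Plane) → x ∈ convexHull ℝ (s : Set Plane))).2 ?_
  · simpa using this
  · intro s _
    by_cases hx : x ∈ convexHull ℝ (s : Set Plane)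
    · exact Eventually.of_forall fun y _ => hx
    · filter_upwards [(isClosed_tri s).isOpen_compl.mem_nhds hx] with y hy h
      exact absurd h hy

lemma Triangulation.eventually_star_tri (𝒯 : Triangulation Ω Γ) (x : Plane) :
    ∀ᶠ y in 𝓝 x, ∀ t ∈ 𝒯.tri, y ∈ convexHull ℝ (t : Set Plane) →
      x ∈ convexHull ℝ (t : Set Plane) := by
  filter_upwards [𝒯.eventually_star x] with y hy t ht
  exact hy t (mem_tri.1 ht).1

/-- Two different triangles that meet outside of the vertices meet in a common edge. -/
lemma Triangulation.exists_common_edge {t t' : Finset Plane} (ht : t ∈ 𝒯.tri) (ht' : t' ∈ 𝒯.tri)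
    (hne : t ≠ t') {x : Plane} (hx : x ∈ convexHull ℝ (t : Set Plane))
    (hx' : x ∈ convexHull ℝ (t' : Set Plane)) (hv : x ∉ 𝒯.verts) :
    ∃ p q, p ≠ q ∧ p ∈ t ∧ q ∈ t ∧ p ∈ t' ∧ q ∈ t' ∧ t ∩ t' = {p, q} ∧
      x ∈ openSegment ℝ p q := by
  have h1 : x ∈ convexHull ℝ ((t ∩ t' : Finset Plane) : Set Plane) := by
    rw [Finset.coe_inter]
    exact 𝒯.complex.inter_subset_convexHull (mem_tri.1 ht).1 (mem_tri.1 ht').1 ⟨hx, hx'⟩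
  have hc : (t ∩ t').card < 3 := by
    by_contra! h
    have e1 : t ∩ t' = t := Finset.eq_of_subset_of_card_le Finset.inter_subset_left
      (by rw [(mem_tri.1 ht).2]; exact h)
    have e2 : t ∩ t' = t' := Finset.eq_of_subset_of_card_le Finset.inter_subset_right
      (by rw [(mem_tri.1 ht').2]; exact h)
    exact hne (e1.symm.trans e2)
  have hvx : ∀ v ∈ t ∩ t', x ≠ v := by
    rintro v hvt rfl
    exact hv (mem_verts.2 ⟨t, ht, (Finset.mem_inter.1 hvt).1⟩)
  have h2 : (t ∩ t').card = 2 := by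
    have h0 : (t ∩ t').card ≠ 0 := by
      intro h0
      rw [Finset.card_eq_zero] at h0
      simp [h0] at h1
    have h0' : (t ∩ t').card ≠ 1 := by
      intro h0
      obtain ⟨v, hv'⟩ := Finset.card_eq_one.1 h0
      rw [hv'] at h1
      simp only [Finset.coe_singleton, convexHull_singleton, mem_singleton_iff] at h1
      exact hvx v (by rw [hv']; simp) h1
    omega
  obtain ⟨p, q, hpq, he⟩ := Finset.card_eq_two.1 h2
  have hp : p ∈ t ∩ t' := by rw [he]; simp
  have hq : q ∈ t ∩ t' := by rw [he]; simp
  refine ⟨p, q, hpq, (Finset.mem_inter.1 hp).1, (Finset.mem_inter.1 hq).1,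
    (Finset.mem_inter.1 hp).2, (Finset.mem_inter.1 hq).2, he, ?_⟩
  rw [he] at h1
  simp only [Finset.coe_insert, Finset.coe_singleton, convexHull_pair] at h1
  exact mem_openSegment_of_mem_segment h1 (hvx p hp) (hvx q hq)

lemma Triangulation.inter_eq_pair {t t' : Finset Plane} (ht : t ∈ 𝒯.tri) (ht' : t' ∈ 𝒯.tri)
    (hne : t ≠ t') {p q : Plane} (hpq : p ≠ q) (hp : p ∈ t) (hq : q ∈ t) (hp' : p ∈ t')
    (hq' : q ∈ t') : t ∩ t' = {p, q} := by
  obtain ⟨c, hcp, hcq, rfl, -⟩ := exists_apex ht hp hq hpq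
  obtain ⟨c', hcp', hcq', rfl, -⟩ := exists_apex ht' hp' hq' hpq
  have : c ≠ c' := by rintro rfl; exact hne rfl
  ext x
  simp only [Finset.mem_inter, Finset.mem_insert, Finset.mem_singleton]
  constructor
  · rintro ⟨h | h | h, h' | h' | h'⟩ <;> simp_all
  · tauto

lemma Triangulation.inter_eq_segment {t t' : Finset Plane} (ht : t ∈ 𝒯.tri) (ht' : t' ∈ 𝒯.tri)
    (hne : t ≠ t') {p q : Plane} (hpq : p ≠ q) (hp : p ∈ t) (hq : q ∈ t) (hp' : p ∈ t')
    (hq' : q ∈ t') :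
    convexHull ℝ (t : Set Plane) ∩ convexHull ℝ (t' : Set Plane) = segment ℝ p q := by
  rw [𝒯.complex.convexHull_inter_convexHull (mem_tri.1 ht).1 (mem_tri.1 ht').1,
    ← Finset.coe_inter, inter_eq_pair ht ht' hne hpq hp hq hp' hq']
  simp

lemma Triangulation.disjoint_interior {t t' : Finset Plane} (ht : t ∈ 𝒯.tri) (ht' : t' ∈ 𝒯.tri)
    (hne : t ≠ t') : Disjoint (interior (convexHull ℝ (t : Set Plane)))
      (interior (convexHull ℝ (t' : Set Plane))) := by
  rw [Set.disjoint_iff_inter_eq_empty, ← interior_inter]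
  by_contra hn
  rw [← Ne, ← nonempty_iff_ne_empty] at hn
  obtain ⟨x, hx, hxv⟩ : ∃ x ∈ interior (convexHull ℝ (t : Set Plane) ∩
      convexHull ℝ (t' : Set Plane)), x ∉ (𝒯.verts : Set Plane) := by
    by_contra! hcon
    have hfin := 𝒯.verts.finite_toSet.subset hcon
    exact (infinite_of_mem_nhds _ (isOpen_interior.mem_nhds hn.some_mem)) hfin
  have hx2 := interior_subset hx
  obtain ⟨p, q, hpq, hp, hq, hp', hq', -, -⟩ :=
    exists_common_edge ht ht' hne hx2.1 hx2.2 (by simpa using hxv)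
  rw [inter_eq_segment ht ht' hne hpq hp hq hp' hq'] at hx
  have hsub : segment ℝ p q ⊆ {y | orient p q y = 0} := fun y => orient_eq_zero_of_mem_segment
  have := interior_mono hsub hx
  rwa [interior_orient_eq_zero hpq] at this

/-- Two triangles with a common edge lie on different sides of it. -/
lemma Triangulation.orient_mul_neg {t t' : Finset Plane} (ht : t ∈ 𝒯.tri) (ht' : t' ∈ 𝒯.tri)
    (hne : t ≠ t') {p q c c' : Plane} (hpq : p ≠ q) (htc : t = {p, q, c}) (htc' : t' = {p, q, c'})
    (hc : orient p q c ≠ 0) (hc' : orient p q c' ≠ 0) : orient p q c * orient p q c' < 0 := by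
  by_contra! hge
  set m : Plane := AffineMap.lineMap p q (1 / 2 : ℝ) with hm
  have hmo : m ∈ openSegment ℝ p q := by
    rw [openSegment_eq_image_lineMap]
    exact ⟨1 / 2, by norm_num, rfl⟩
  have hte : Tendsto (fun ε : ℝ => (AffineMap.lineMap m c ε : Plane)) (𝓝[>] 0) (𝓝 m) := by
    have : Continuous (fun ε : ℝ => (AffineMap.lineMap m c ε : Plane)) :=
      AffineMap.lineMap_continuous
    have h0 := this.tendsto 0
    simp only [AffineMap.lineMap_apply_zero] at h0
    exact h0.mono_left nhdsWithin_le_nhds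
  obtain ⟨ε, h1, h2, h3⟩ := ((hte.eventually (eventually_mem_triangle hc hmo)).and
    ((hte.eventually (eventually_mem_triangle hc' hmo)).and self_mem_nhdsWithin)).exists
  have h3 : 0 < ε := h3
  have hval : orient p q (AffineMap.lineMap m c ε) = ε * orient p q c := by
    rw [orient_lineMap, hm, orient_lineMap]; simp
  rw [hval, mul_assoc] at h1 h2
  have m1 := h1 (mul_nonneg h3.le (mul_self_nonneg _))
  have m2 := h2 (mul_nonneg h3.le hge)
  have hin := (inter_eq_segment ht ht' hne hpq (by simp [htc]) (by simp [htc]) (by simp [htc'])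
    (by simp [htc'])).subset ⟨by simpa [htc] using m1, by simpa [htc'] using m2⟩
  have := orient_eq_zero_of_mem_segment hin
  rw [hval] at this
  exact (mul_ne_zero h3.ne' hc) this

/-- The side of the line `p q` on which the triangle `t` with edge `p q` lies. -/
noncomputable def side (t : Finset Plane) (p q : Plane) : ℝ := ∑ c ∈ t, Real.sign (orient p q c)

lemma side_eq {p q c : Plane} (hpq : p ≠ q) (hp : c ≠ p) (hq : c ≠ q) :
    side {p, q, c} p q = Real.sign (orient p q c) := by
  rw [side, Finset.sum_insert (by simp [hpq, hp.symm]), Finset.sum_insert (by simp [hq.symm])]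
  simp

lemma Triangulation.side_ne_zero {t : Finset Plane} (ht : t ∈ 𝒯.tri) {p q : Plane} (hp : p ∈ t)
    (hq : q ∈ t) (hpq : p ≠ q) : side t p q ≠ 0 := by
  obtain ⟨c, hcp, hcq, rfl, hD⟩ := exists_apex ht hp hq hpq
  rw [side_eq hpq hcp hcq]
  simpa [Real.sign_eq_zero_iff] using hD

lemma Triangulation.side_opposite {t t' : Finset Plane} (ht : t ∈ 𝒯.tri) (ht' : t' ∈ 𝒯.tri)
    (hne : t ≠ t') {p q : Plane} (hpq : p ≠ q) (hp : p ∈ t) (hq : q ∈ t) (hp' : p ∈ t')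
    (hq' : q ∈ t') : side t' p q = -side t p q := by
  obtain ⟨c, hcp, hcq, htc, hD⟩ := exists_apex ht hp hq hpq
  obtain ⟨c', hcp', hcq', htc', hD'⟩ := exists_apex ht' hp' hq' hpq
  have h := orient_mul_neg ht ht' hne hpq htc htc' hD hD'
  rw [htc, htc', side_eq hpq hcp hcq, side_eq hpq hcp' hcq']
  rcases mul_neg_iff.1 h with ⟨h1, h2⟩ | ⟨h1, h2⟩
  · rw [Real.sign_of_pos h1, Real.sign_of_neg h2]
  · rw [Real.sign_of_pos h2, Real.sign_of_neg h1, neg_neg]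

lemma Triangulation.openSegment_subset_of_two {t t' : Finset Plane} (ht : t ∈ 𝒯.tri)
    (ht' : t' ∈ 𝒯.tri) (hne : t ≠ t') {p q : Plane} (hpq : p ≠ q) (hp : p ∈ t) (hq : q ∈ t)
    (hp' : p ∈ t') (hq' : q ∈ t') : openSegment ℝ p q ⊆ Ω.carrier := by
  obtain ⟨c, hcp, hcq, htc, hD⟩ := exists_apex ht hp hq hpq
  obtain ⟨c', hcp', hcq', htc', hD'⟩ := exists_apex ht' hp' hq' hpq
  have h := orient_mul_neg ht ht' hne hpq htc htc' hD hD'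
  intro m hm
  rw [← Ω.lipschitz.interior_closure Ω.isOpen, mem_interior_iff_mem_nhds]
  filter_upwards [eventually_mem_triangle hD hm, eventually_mem_triangle hD' hm] with y h1 h2
  by_cases hy : 0 ≤ orient p q y * orient p q c
  · exact tri_subset ht (by simpa [htc] using h1 hy)
  · push Not at hy
    have h3 : 0 ≤ orient p q y * orient p q c' := by
      by_contra! h3
      have := mul_pos_of_neg_of_neg hy h3
      nlinarith [mul_self_nonneg (orient p q y)]
    exact tri_subset ht' (by simpa [htc'] using h2 h3)

/-- An edge of one triangle only lies in the boundary. -/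
lemma Triangulation.segment_subset_frontier {t : Finset Plane} (ht : t ∈ 𝒯.tri) {p q : Plane}
    (hpq : p ≠ q) (hp : p ∈ t) (hq : q ∈ t)
    (huniq : ∀ t' ∈ 𝒯.tri, p ∈ t' → q ∈ t' → t' = t) : segment ℝ p q ⊆ frontier Ω.carrier := by
  rw [← closure_openSegment, isClosed_frontier.closure_subset_iff]
  intro m hm
  rw [Ω.isOpen.frontier_eq]
  refine ⟨tri_subset ht (segment_subset_tri hp hq (openSegment_subset_segment _ _ _ hm)),
    fun hmΩ => ?_⟩
  obtain ⟨c, hcp, hcq, htc, hD⟩ := exists_apex ht hp hq hpq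
  have hmne : m ≠ c := by
    rintro rfl
    exact hD (orient_eq_zero_of_mem_segment (openSegment_subset_segment _ _ _ hm))
  -- points on the other side of the edge lie in another triangle, which contains `m`
  have hte : Tendsto (fun ε : ℝ => (AffineMap.lineMap m c (-ε) : Plane)) (𝓝[>] 0) (𝓝 m) := by
    have : Continuous (fun ε : ℝ => (AffineMap.lineMap m c (-ε) : Plane)) :=
      AffineMap.lineMap_continuous.comp continuous_neg
    have h0 := this.tendsto 0
    simp only [neg_zero, AffineMap.lineMap_apply_zero] at h0
    exact h0.mono_left nhdsWithin_le_nhds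
  obtain ⟨ε, h1, h2, h3⟩ := ((hte.eventually (Ω.isOpen.mem_nhds hmΩ)).and
    ((hte.eventually (𝒯.eventually_star_tri m)).and self_mem_nhdsWithin)).exists
  have h3 : 0 < ε := h3
  obtain ⟨t', ht', hmem⟩ := exists_tri (𝒯 := 𝒯) (subset_closure h1)
  have hmt' := h2 t' ht' hmem
  have hne : t ≠ t' := by
    rintro rfl
    rw [htc] at hmem
    have h5 := ((mem_convexHull_triple_iff_orient hD _).1 (by simpa using hmem)).2.1
    rw [orient_lineMap, orient_eq_zero_of_mem_segment (openSegment_subset_segment _ _ _ hm)] at h5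
    rw [mul_zero, zero_add, mul_div_cancel_right₀ _ hD] at h5
    linarith
  have hmt : m ∈ convexHull ℝ (t : Set Plane) :=
    segment_subset_tri hp hq (openSegment_subset_segment _ _ _ hm)
  have hI : m ∈ convexHull ℝ ((t ∩ t' : Finset Plane) : Set Plane) := by
    rw [Finset.coe_inter]
    exact 𝒯.complex.inter_subset_convexHull (mem_tri.1 ht).1 (mem_tri.1 ht').1 ⟨hmt, hmt'⟩
  rw [openSegment_eq_image_lineMap] at hm
  obtain ⟨s, ⟨hs0, hs1⟩, hms⟩ := hm
  have hme : m = p + s • (q - p) := by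
    rw [← hms, AffineMap.lineMap_apply]; simp [add_comm]
  -- a vertex `v` of `t` with positive barycentric coordinate at `m` is a vertex of `t'`
  have hvert : ∀ v a b : Plane, t = {v, a, b} → orient a b v ≠ 0 → orient a b m ≠ 0 → v ∈ t' := by
    intro v a b hvab hv0 hm0
    by_contra hv
    have hsub : ((t ∩ t' : Finset Plane) : Set Plane) ⊆ {a, b} := by
      intro x hx
      simp only [Finset.coe_inter, mem_inter_iff, Finset.mem_coe, hvab, Finset.mem_insert,
        Finset.mem_singleton] at hx
      rcases hx with ⟨rfl | h | h, hx'⟩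
      · exact absurd hx' hv
      · exact Or.inl h
      · exact Or.inr h
    have h6 := convexHull_mono hsub hI
    rw [convexHull_pair] at h6
    exact hm0 (orient_eq_zero_of_mem_segment h6)
  have hp' : p ∈ t' := by
    refine hvert p q c htc (by rw [orient_rotate]; exact hD) ?_
    have : orient q c m = (1 - s) * orient p q c := by rw [hme]; simp [orient]; ring
    rw [this]; exact mul_ne_zero (by linarith) hD
  have hq' : q ∈ t' := by
    refine hvert q p c (by rw [htc]; exact Finset.insert_comm _ _ _)
      (by rw [orient_swap_right]; simpa using hD) ?_
    have : orient p c m = -(s * orient p q c) := by rw [hme]; simp [orient]; ring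
    rw [this]; simpa using ⟨hs0.ne', hD⟩
  exact hne (huniq t' ht' hp' hq').symm

/-- Every edge of a triangle lies in the boundary and belongs to that triangle only, or is
contained in the domain except for its end points and belongs to exactly one more triangle. -/
lemma Triangulation.edge_cases {t : Finset Plane} (ht : t ∈ 𝒯.tri) {p q : Plane}
    (hpq : p ≠ q) (hp : p ∈ t) (hq : q ∈ t) :
    (segment ℝ p q ⊆ frontier Ω.carrier ∧ 𝒯.tri.filter (fun s => p ∈ s ∧ q ∈ s) = {t}) ∨
    (openSegment ℝ p q ⊆ Ω.carrier ∧ ∃ t' ∈ 𝒯.tri, t ≠ t' ∧ p ∈ t' ∧ q ∈ t' ∧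
      side t' p q = -side t p q ∧ 𝒯.tri.filter (fun s => p ∈ s ∧ q ∈ s) = {t, t'}) := by
  by_cases huniq : ∀ t' ∈ 𝒯.tri, p ∈ t' → q ∈ t' → t' = t
  · left
    refine ⟨segment_subset_frontier ht hpq hp hq huniq, ?_⟩
    ext s
    simp only [Finset.mem_filter, Finset.mem_singleton]
    exact ⟨fun h => huniq s h.1 h.2.1 h.2.2, by rintro rfl; exact ⟨ht, hp, hq⟩⟩
  · right
    push Not at huniq
    obtain ⟨t', ht', hp', hq', hne⟩ := huniq
    have hside := side_opposite ht ht' hne.symm hpq hp hq hp' hq'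
    refine ⟨openSegment_subset_of_two ht ht' hne.symm hpq hp hq hp' hq', t', ht', hne.symm, hp',
      hq', hside, ?_⟩
    ext s
    simp only [Finset.mem_filter, Finset.mem_insert, Finset.mem_singleton]
    constructor
    · rintro ⟨hs, hps, hqs⟩
      by_contra! hcon
      have h1 := side_opposite ht hs hcon.1.symm hpq hp hq hps hqs
      have h2 := side_opposite ht' hs hcon.2.symm hpq hp' hq' hps hqs
      have h3 := side_ne_zero ht hp hq hpq
      apply h3; linarith
    · rintro (rfl | rfl)
      · exact ⟨ht, hp, hq⟩
      · exact ⟨ht', hp', hq'⟩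

lemma Triangulation.mem_faces_pair {t : Finset Plane} (ht : t ∈ 𝒯.tri) {p q : Plane}
    (hp : p ∈ t) (hq : q ∈ t) : ({p, q} : Finset Plane) ∈ 𝒯.complex.faces := by
  refine 𝒯.complex.down_closed (mem_tri.1 ht).1 ?_ (by simp)
  intro x hx
  simp only [Finset.mem_insert, Finset.mem_singleton] at hx
  rcases hx with rfl | rfl <;> assumption

lemma Triangulation.openSegment_subset_or {t : Finset Plane} (ht : t ∈ 𝒯.tri) {p q : Plane}
    (hpq : p ≠ q) (hp : p ∈ t) (hq : q ∈ t) (h : segment ℝ p q ⊆ frontier Ω.carrier) :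
    openSegment ℝ p q ⊆ Γ.ΓD ∨ openSegment ℝ p q ⊆ Γ.ΓN :=
  𝒯.aligned p q hpq (mem_faces_pair ht hp hq) h

/-- A boundary point that is not a vertex is in the relative interior of a boundary edge. -/
lemma Triangulation.exists_boundary_edge {y : Plane} (hy : y ∈ frontier Ω.carrier)
    (hv : y ∉ 𝒯.verts) :
    ∃ t ∈ 𝒯.tri, ∃ p q, p ≠ q ∧ p ∈ t ∧ q ∈ t ∧ y ∈ openSegment ℝ p q ∧
      segment ℝ p q ⊆ frontier Ω.carrier ∧ 𝒯.tri.filter (fun s => p ∈ s ∧ q ∈ s) = {t} := by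
  rw [Ω.isOpen.frontier_eq] at hy
  obtain ⟨t, ht, hyt⟩ := exists_tri (𝒯 := 𝒯) hy.1
  obtain ⟨a, b, c, hab, hac, hbc, htc, hD⟩ := exists_vertices ht
  have hedge : ∃ p q, p ≠ q ∧ p ∈ t ∧ q ∈ t ∧ y ∈ segment ℝ p q := by
    have hyt' : y ∈ convexHull ℝ ({a, b, c} : Set Plane) := by simpa [htc] using hyt
    rcases mem_interior_or_mem_edge hD hyt' with h | h | h | h
    · refine absurd (interior_tri_subset ht ?_) hy.2
      simpa [htc] using h
    · exact ⟨a, b, hab, by simp [htc], by simp [htc], h⟩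
    · exact ⟨b, c, hbc, by simp [htc], by simp [htc], h⟩
    · exact ⟨a, c, hac, by simp [htc], by simp [htc], h⟩
  obtain ⟨p, q, hpq, hp, hq, hyseg⟩ := hedge
  have hyo : y ∈ openSegment ℝ p q := by
    refine mem_openSegment_of_mem_segment hyseg ?_ ?_
    · rintro rfl; exact hv (mem_verts.2 ⟨t, ht, hp⟩)
    · rintro rfl; exact hv (mem_verts.2 ⟨t, ht, hq⟩)
  rcases edge_cases ht hpq hp hq with h | h
  · exact ⟨t, ht, p, q, hpq, hp, hq, hyo, h.1, h.2⟩
  · exact absurd (h.1 hyo) hy.2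

lemma Triangulation.eventually_notMem_verts (𝒯 : Triangulation Ω Γ) (x : Plane) :
    ∀ᶠ y in 𝓝 x, y ≠ x → y ∉ 𝒯.verts := by
  have h : ((𝒯.verts.erase x : Finset Plane) : Set Plane)ᶜ ∈ 𝓝 x :=
    ((𝒯.verts.erase x).finite_toSet.isClosed.isOpen_compl).mem_nhds (by simp)
  filter_upwards [h] with y hy hne hyv
  exact hy (by simp [hne, hyv])

/-- A nonempty Dirichlet part contains an edge. -/
lemma Triangulation.exists_dirichlet_edge (𝒯 : Triangulation Ω Γ) (hD : Γ.ΓD.Nonempty) :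
    ∃ t ∈ 𝒯.tri, ∃ p q, p ≠ q ∧ p ∈ t ∧ q ∈ t ∧ openSegment ℝ p q ⊆ Γ.ΓD ∧
      segment ℝ p q ⊆ frontier Ω.carrier ∧ 𝒯.tri.filter (fun s => p ∈ s ∧ q ∈ s) = {t} := by
  obtain ⟨x, hx⟩ := hD
  obtain ⟨O, hO, hOe⟩ := Γ.openD
  have hx' := hx
  rw [hOe] at hx'
  obtain ⟨y, ⟨⟨hy1, hy2⟩, hyf⟩, hyx⟩ := Ω.lipschitz.frontier_accumulates Ω.isOpen hx'.2
    (inter_mem (hO.mem_nhds hx'.1) (𝒯.eventually_notMem_verts x))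
  obtain ⟨t, ht, p, q, hpq, hp, hq, hyo, hseg, hfil⟩ := exists_boundary_edge hyf (hy2 hyx)
  refine ⟨t, ht, p, q, hpq, hp, hq, ?_, hseg, hfil⟩
  refine (openSegment_subset_or ht hpq hp hq hseg).resolve_right fun hN => ?_
  exact (Set.disjoint_left.1 Γ.disjoint) (by rw [hOe]; exact ⟨hy1, hyf⟩) (hN hyo)

end Triangulation

/-! ### Gluing over a triangulation -/

lemma eq_of_eventually_eq {α β : Type*} [TopologicalSpace α] {s : Set α} (hs : IsPreconnected s)
    {g : α → β} (h : ∀ x ∈ s, ∀ᶠ y in 𝓝[s] x, g y = g x) {x y : α} (hx : x ∈ s) (hy : y ∈ s) :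
    g x = g y := by
  have := isPreconnected_iff_preconnectedSpace.1 hs
  have hl : IsLocallyConstant (fun z : s => g z) := by
    rw [IsLocallyConstant.iff_eventually_eq]
    rintro ⟨z, hz⟩
    have := h z hz
    rw [nhdsWithin_eq_map_subtype_coe hz, eventually_map] at this
    exact this
  exact hl.apply_eq_of_preconnectedSpace ⟨x, hx⟩ ⟨y, hy⟩

lemma isPreconnected_punctured_ball (x : Plane) {δ : ℝ} :
    IsPreconnected (Metric.ball x δ \ {x}) := by
  have hrank : 1 < Module.rank ℝ Plane := by
    rw [← Module.finrank_eq_rank]; simp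
  have h1 : IsPreconnected (Metric.sphere (0 : Plane) 1 ×ˢ Ioo (0 : ℝ) δ) :=
    (isPreconnected_sphere hrank 0 1).prod isPreconnected_Ioo
  have h2 : Metric.ball x δ \ {x} =
      (fun z : Plane × ℝ => x + z.2 • z.1) '' (Metric.sphere (0 : Plane) 1 ×ˢ Ioo (0 : ℝ) δ) := by
    ext y
    simp only [Set.mem_sdiff, Metric.mem_ball, mem_singleton_iff, mem_image, mem_prod, Prod.exists,
      mem_sphere_zero_iff_norm, mem_Ioo]
    constructor
    · rintro ⟨hd, hne⟩
      have h0 : 0 < ‖y - x‖ := norm_pos_iff.2 (sub_ne_zero.2 hne)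
      refine ⟨‖y - x‖⁻¹ • (y - x), ‖y - x‖, ⟨?_, h0, by rwa [← dist_eq_norm]⟩, ?_⟩
      · rw [norm_smul, norm_inv, norm_norm, inv_mul_cancel₀ h0.ne']
      · rw [smul_smul, mul_inv_cancel₀ h0.ne']; simp
    · rintro ⟨v, r, ⟨hv, h0, hr⟩, rfl⟩
      refine ⟨by simpa [dist_eq_norm, norm_smul, hv, abs_of_pos h0] using hr, ?_⟩
      intro h
      have : r • v = 0 := by simpa using h
      rcases smul_eq_zero.1 this with h | h
      · exact h0.ne' h
      · simp [h] at hv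
  rw [h2]
  exact h1.image _ (by fun_prop)

section Triangulation

variable {Ω : PolygonalDomain} {Γ : BoundaryParts Ω} {𝒯 : Triangulation Ω Γ}

lemma PolygonalDomain.isPreconnected (Ω : PolygonalDomain) : IsPreconnected Ω.carrier := by
  have := Ω.simplyConnected
  exact isPreconnected_iff_preconnectedSpace.2 inferInstance

/-- A choice of a triangle for every point, and of star-shaped neighbourhoods in the combinatorial
sense: every triangle that meets the neighbourhood `S x` contains `x`. -/
lemma Triangulation.exists_tri_choice (𝒯 : Triangulation Ω Γ) :
    ∃ (tr : Plane → Finset Plane) (S : Plane → Set Plane),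
      (∀ x ∈ closure Ω.carrier, tr x ∈ 𝒯.tri ∧ x ∈ convexHull ℝ (tr x : Set Plane)) ∧
      (∀ x, IsOpen (S x) ∧ x ∈ S x) ∧
      (∀ x, ∀ y ∈ S x, ∀ t ∈ 𝒯.tri, y ∈ convexHull ℝ (t : Set Plane) →
        x ∈ convexHull ℝ (t : Set Plane)) := by
  have h1 : ∀ x : Plane, ∃ t, x ∈ closure Ω.carrier → t ∈ 𝒯.tri ∧
      x ∈ convexHull ℝ (t : Set Plane) := by
    intro x
    by_cases hx : x ∈ closure Ω.carrier
    · obtain ⟨t, ht⟩ := exists_tri (𝒯 := 𝒯) hx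
      exact ⟨t, fun _ => ht⟩
    · exact ⟨∅, fun h => absurd h hx⟩
  have h2 : ∀ x : Plane, ∃ S : Set Plane, (IsOpen S ∧ x ∈ S) ∧ ∀ y ∈ S, ∀ t ∈ 𝒯.tri,
      y ∈ convexHull ℝ (t : Set Plane) → x ∈ convexHull ℝ (t : Set Plane) := by
    intro x
    obtain ⟨S, hS, hSo, hxS⟩ := mem_nhds_iff.1 (𝒯.eventually_star_tri x)
    exact ⟨S, ⟨hSo, hxS⟩, fun y hy => hS hy⟩
  choose tr htr using h1
  choose S hS hS' using h2
  exact ⟨tr, S, htr, hS, hS'⟩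

/-- Local functions on the triangles of a triangulation of a simply connected domain that differ by
constants on the intersections of the triangles can be made to agree by adding constants. -/
theorem Triangulation.exists_constants (𝒯 : Triangulation Ω Γ) (p : Finset Plane → Plane → ℝ)
    (hp : ∀ t ∈ 𝒯.tri, ∀ t' ∈ 𝒯.tri, ∀ x ∈ convexHull ℝ (t : Set Plane),
      x ∈ convexHull ℝ (t' : Set Plane) → ∀ y ∈ convexHull ℝ (t : Set Plane),
      y ∈ convexHull ℝ (t' : Set Plane) → p t x - p t' x = p t y - p t' y) :
    ∃ c : Finset Plane → ℝ, ∀ t ∈ 𝒯.tri, ∀ t' ∈ 𝒯.tri, ∀ x ∈ convexHull ℝ (t : Set Plane),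
      x ∈ convexHull ℝ (t' : Set Plane) → p t x + c t = p t' x + c t' := by
  classical
  obtain ⟨tr, S, htr, hS, hstar⟩ := 𝒯.exists_tri_choice
  -- the primitive near `x`, normalized to vanish at `x`
  let f : Plane → Plane → ℝ := fun x y => p (tr y) y - p (tr y) x
  have key : ∀ x, ∀ y ∈ S x, y ∈ closure Ω.carrier → ∀ t ∈ 𝒯.tri,
      y ∈ convexHull ℝ (t : Set Plane) → f x y = p t y - p t x := by
    intro x y hy hyΩ t ht hyt
    have h1 := htr y hyΩ
    have h2 := hp t ht (tr y) h1.1 y hyt h1.2 x (hstar x y hy t ht hyt)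
      (hstar x y hy _ h1.1 h1.2)
    simp only [f]; linarith
  have hcl : ∀ x : Ω.carrier, (x : Plane) ∈ closure Ω.carrier := fun x => subset_closure x.2
  have := Ω.simplyConnected
  have := Ω.isOpen.locallyPathConnectedSpace
  obtain ⟨u, hu⟩ := exists_global_primitive (X := Ω.carrier) (ι := Ω.carrier)
    (fun i => Subtype.val ⁻¹' S i) (fun i => (hS i).1.preimage continuous_subtype_val) id
    (fun x => (hS x).2) (fun i y => f i y) (by
      rintro i j x ⟨hi, hj⟩
      have h1 : ∀ᶠ y : Ω.carrier in 𝓝 x, (y : Plane) ∈ S i ∩ S j ∩ S x :=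
        continuous_subtype_val.continuousAt.eventually
          ((((hS i).1.inter (hS j).1).inter (hS x).1).mem_nhds ⟨⟨hi, hj⟩, (hS x).2⟩)
      filter_upwards [h1] with y ⟨⟨hyi, hyj⟩, hyx⟩
      have h2 := htr y (hcl y)
      have hxt := hstar x y hyx _ h2.1 h2.2
      rw [key i x hi (hcl x) _ h2.1 hxt, key j x hj (hcl x) _ h2.1 hxt]
      simp only [f]; ring)
  let v : Plane → ℝ := fun y => if h : y ∈ Ω.carrier then u ⟨y, h⟩ else 0
  have hv : ∀ x ∈ Ω.carrier, ∀ᶠ y in 𝓝 x, y ∈ Ω.carrier ∧ y ∈ S x ∧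
      ∀ t ∈ 𝒯.tri, y ∈ convexHull ℝ (t : Set Plane) → v y - v x = p t y - p t x := by
    intro x hx
    have h1 := hu ⟨x, hx⟩ ⟨x, hx⟩ (hS x).2
    have h2 : ∀ᶠ y in 𝓝 x, ∀ h : y ∈ Ω.carrier, u ⟨y, h⟩ - f x y = u ⟨x, hx⟩ - f x x := by
      rw [← map_nhds_subtype_coe_eq_nhds hx (Ω.isOpen.mem_nhds hx), eventually_map]
      filter_upwards [h1] with y hy _
      exact hy
    filter_upwards [h2, Ω.isOpen.mem_nhds hx, (hS x).1.mem_nhds (hS x).2] with y hy hyΩ hyS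
    refine ⟨hyΩ, hyS, fun t ht hyt => ?_⟩
    have h3 := hy hyΩ
    rw [key x y hyS (subset_closure hyΩ) t ht hyt] at h3
    simp only [v, hyΩ, hx, dif_pos]
    simp only [f, sub_self] at h3
    linarith
  -- on each triangle, the global primitive differs from the local one by a constant
  have hc : ∀ t, ∃ c, t ∈ 𝒯.tri → ∀ x ∈ convexHull ℝ (t : Set Plane) ∩ Ω.carrier,
      v x = p t x + c := by
    intro t
    by_cases ht : t ∈ 𝒯.tri
    · have hpre : IsPreconnected (convexHull ℝ (t : Set Plane) ∩ Ω.carrier) := by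
        refine (convex_convexHull ℝ (t : Set Plane)).interior.isPreconnected.subset_closure
          (fun x hx => ⟨interior_subset hx, interior_tri_subset ht hx⟩) ?_
        rw [closure_interior_tri ht]
        exact inter_subset_left
      obtain ⟨z, hz⟩ := interior_tri_nonempty ht
      refine ⟨v z - p t z, fun _ x hx => ?_⟩
      have := eq_of_eventually_eq hpre (g := fun x => v x - p t x) (fun x hx => ?_) hx
        ⟨interior_subset hz, interior_tri_subset ht hz⟩
      · linarith
      · filter_upwards [mem_nhdsWithin_of_mem_nhds (hv x hx.2), self_mem_nhdsWithin] with y hy hyt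
        have := hy.2.2 t ht hyt.1
        linarith
    · exact ⟨0, fun h => absurd h ht⟩
  choose c hc using hc
  refine ⟨c, fun t ht t' ht' z hz hz' => ?_⟩
  by_cases hzΩ : z ∈ Ω.carrier
  · rw [← hc t ht z ⟨hz, hzΩ⟩, ← hc t' ht' z ⟨hz', hzΩ⟩]
  -- at a boundary point, the domain is locally connected, so the primitive has a limit
  have hzf : z ∈ frontier Ω.carrier := by
    rw [Ω.isOpen.frontier_eq]; exact ⟨tri_subset ht hz, hzΩ⟩
  obtain ⟨W, hW, hWS, hWc⟩ := Ω.lipschitz.exists_preconnected Ω.isOpen hzf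
    ((hS z).1.mem_nhds (hS z).2)
  have hnear : ∀ t ∈ 𝒯.tri, z ∈ convexHull ℝ (t : Set Plane) →
      ∃ y ∈ W ∩ Ω.carrier, y ∈ convexHull ℝ (t : Set Plane) := by
    intro t ht hz
    rw [← closure_interior_tri ht] at hz
    obtain ⟨y, hy1, hy2⟩ := mem_closure_iff_nhds.1 hz W hW
    exact ⟨y, ⟨hy1, interior_tri_subset ht hy2⟩, interior_subset hy2⟩
  have hconst : ∀ x ∈ W ∩ Ω.carrier, ∀ᶠ y in 𝓝[W ∩ Ω.carrier] x, v y - f z y = v x - f z x := by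
    rintro x ⟨hxW, hxΩ⟩
    filter_upwards [mem_nhdsWithin_of_mem_nhds (hv x hxΩ), self_mem_nhdsWithin] with y hy hyW
    have h1 := htr y (subset_closure hyW.2)
    have h2 := hy.2.2 _ h1.1 h1.2
    have hxt := hstar x y hy.2.1 _ h1.1 h1.2
    rw [key z x (hWS hxW) (subset_closure hxΩ) _ h1.1 hxt]
    simp only [f]; linarith
  obtain ⟨y, hyW, hyt⟩ := hnear t ht hz
  obtain ⟨y', hyW', hyt'⟩ := hnear t' ht' hz'
  have h1 := eq_of_eventually_eq hWc (g := fun x => v x - f z x) hconst hyW hyW'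
  rw [hc t ht y ⟨hyt, hyW.2⟩, hc t' ht' y' ⟨hyt', hyW'.2⟩,
    key z y (hWS hyW.1) (subset_closure hyW.2) t ht hyt,
    key z y' (hWS hyW'.1) (subset_closure hyW'.2) t' ht' hyt'] at h1
  linarith

lemma Triangulation.eq_of_mem_notMem_verts {α : Type*} {c : Finset Plane → α}
    (hc : ∀ t ∈ 𝒯.tri, ∀ t' ∈ 𝒯.tri, t ≠ t' → ∀ p q, p ≠ q → p ∈ t → q ∈ t → p ∈ t' → q ∈ t' →
      c t = c t') {t t' : Finset Plane} (ht : t ∈ 𝒯.tri) (ht' : t' ∈ 𝒯.tri) {x : Plane}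
    (hx : x ∈ convexHull ℝ (t : Set Plane)) (hx' : x ∈ convexHull ℝ (t' : Set Plane))
    (hv : x ∉ 𝒯.verts) : c t = c t' := by
  by_cases hne : t = t'
  · rw [hne]
  · obtain ⟨p, q, hpq, hp, hq, hp', hq', -, -⟩ := exists_common_edge ht ht' hne hx hx' hv
    exact hc t ht t' ht' hne p q hpq hp hq hp' hq'

/-- The triangles of a triangulation of a domain are connected through common edges. -/
theorem Triangulation.eq_of_common_edge {α : Type*} (c : Finset Plane → α)
    (hc : ∀ t ∈ 𝒯.tri, ∀ t' ∈ 𝒯.tri, t ≠ t' → ∀ p q, p ≠ q → p ∈ t → q ∈ t → p ∈ t' → q ∈ t' →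
      c t = c t') {t t' : Finset Plane} (ht : t ∈ 𝒯.tri) (ht' : t' ∈ 𝒯.tri) : c t = c t' := by
  obtain ⟨tr, S, htr, hS, hstar⟩ := 𝒯.exists_tri_choice
  have hlocal : ∀ x ∈ Ω.carrier, ∀ t ∈ 𝒯.tri, ∀ t' ∈ 𝒯.tri, x ∈ convexHull ℝ (t : Set Plane) →
      x ∈ convexHull ℝ (t' : Set Plane) → c t = c t' := by
    intro x hx t ht t' ht' hxt hxt'
    obtain ⟨δ, hδ, hball⟩ := Metric.mem_nhds_iff.1 (inter_mem (Ω.isOpen.mem_nhds hx)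
      (𝒯.eventually_notMem_verts x))
    have hP : ∀ y ∈ Metric.ball x δ \ {x}, y ∈ closure Ω.carrier ∧ y ∉ 𝒯.verts := fun y hy =>
      ⟨subset_closure (hball hy.1).1, (hball hy.1).2 hy.2⟩
    have hconst : ∀ y ∈ Metric.ball x δ \ {x}, ∀ᶠ z in 𝓝[Metric.ball x δ \ {x}] y,
        c (tr z) = c (tr y) := by
      intro y hy
      filter_upwards [mem_nhdsWithin_of_mem_nhds ((hS y).1.mem_nhds (hS y).2),
        self_mem_nhdsWithin] with z hz hzP
      have h1 := htr z (hP z hzP).1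
      have h2 := htr y (hP y hy).1
      exact eq_of_mem_notMem_verts hc h1.1 h2.1 (hstar y z hz _ h1.1 h1.2) h2.2 (hP y hy).2
    have hnear : ∀ t ∈ 𝒯.tri, x ∈ convexHull ℝ (t : Set Plane) →
        ∃ y ∈ Metric.ball x δ \ {x}, c t = c (tr y) := by
      intro t ht hxt
      rw [← closure_interior_tri ht] at hxt
      obtain ⟨y, hy1, hy2⟩ := mem_closure_iff_nhds.1 hxt _ (Metric.ball_mem_nhds x hδ)
      obtain ⟨z, hz, hzx⟩ := ((infinite_of_mem_nhds y ((Metric.isOpen_ball.inter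
        isOpen_interior).mem_nhds ⟨hy1, hy2⟩)).sdiff (finite_singleton x)).nonempty
      have hzP : z ∈ Metric.ball x δ \ {x} := ⟨hz.1, hzx⟩
      have h1 := htr z (hP z hzP).1
      exact ⟨z, hzP, eq_of_mem_notMem_verts hc ht h1.1 (interior_subset hz.2) h1.2 (hP z hzP).2⟩
    obtain ⟨y, hy, e1⟩ := hnear t ht hxt
    obtain ⟨y', hy', e2⟩ := hnear t' ht' hxt'
    rw [e1, e2]
    exact eq_of_eventually_eq (isPreconnected_punctured_ball x) (g := fun z => c (tr z)) hconst
      hy hy'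
  obtain ⟨y, hy⟩ := interior_tri_nonempty ht
  obtain ⟨y', hy'⟩ := interior_tri_nonempty ht'
  have hyΩ := interior_tri_subset ht hy
  have hyΩ' := interior_tri_subset ht' hy'
  have h1 := htr y (subset_closure hyΩ)
  have h1' := htr y' (subset_closure hyΩ')
  rw [hlocal y hyΩ t ht _ h1.1 (interior_subset hy) h1.2,
    hlocal y' hyΩ' t' ht' _ h1'.1 (interior_subset hy') h1'.2]
  refine eq_of_eventually_eq Ω.isPreconnected (g := fun z => c (tr z)) (fun x hx => ?_) hyΩ hyΩ'
  filter_upwards [mem_nhdsWithin_of_mem_nhds ((hS x).1.mem_nhds (hS x).2),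
    self_mem_nhdsWithin] with z hz hzΩ
  have h2 := htr z (subset_closure hzΩ)
  have h3 := htr x (subset_closure hx)
  exact hlocal x hx _ h2.1 _ h3.1 (hstar x z hz _ h2.1 h2.2) h3.2

end Triangulation

/-! ### Piecewise integration by parts -/

lemma side_swap (t : Finset Plane) (p q : Plane) : side t q p = -side t p q := by
  simp only [side, ← Finset.sum_neg_distrib]
  refine Finset.sum_congr rfl fun c _ => ?_
  rw [orient_swap, Real.sign_neg]

lemma edgeFlux_swap (p q : Plane) (F : Fin 2 → Plane → ℝ) : edgeFlux q p F = -edgeFlux p q F := by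
  have h1 : edgeFlux q p F = ∫ s in (0 : ℝ)..1, (fun s => -(F 0 (AffineMap.lineMap p q s) *
      (q 1 - p 1) - F 1 (AffineMap.lineMap p q s) * (q 0 - p 0))) (1 - s) := by
    refine intervalIntegral.integral_congr fun s _ => ?_
    simp only [AffineMap.lineMap_apply_one_sub]
    ring
  rw [h1, intervalIntegral.integral_comp_sub_left (fun s => -(F 0 (AffineMap.lineMap p q s) *
      (q 1 - p 1) - F 1 (AffineMap.lineMap p q s) * (q 0 - p 0)))]
  simp only [sub_self, sub_zero, intervalIntegral.integral_neg]
  rfl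

lemma orient_self (p x : Plane) : orient p p x = 0 := by unfold orient; ring

/-- Green's formula on a triangle, as a sum over ordered pairs of vertices. -/
lemma integral_divergence_triangle' {a b c : Plane} (hab : a ≠ b) (hac : a ≠ c) (hbc : b ≠ c)
    (hD : orient a b c ≠ 0) {F : Fin 2 → Plane → ℝ} (hF : ∀ i, ContDiff ℝ 1 (F i)) :
    2 * ∫ x in convexHull ℝ ((({a, b, c} : Finset Plane)) : Set Plane),
      (pd 0 (F 0) x + pd 1 (F 1) x) =
      ∑ p ∈ ({a, b, c} : Finset Plane), ∑ q ∈ ({a, b, c} : Finset Plane),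
        side {a, b, c} p q * edgeFlux p q F := by
  have hs : ∀ p q, side {a, b, c} p q =
      Real.sign (orient p q a) + (Real.sign (orient p q b) + Real.sign (orient p q c)) := by
    intro p q
    rw [side, Finset.sum_insert (by simp [hab, hac]), Finset.sum_insert (by simp [hbc]),
      Finset.sum_singleton]
  have hsum : ∀ f : Plane → ℝ, ∑ p ∈ ({a, b, c} : Finset Plane), f p = f a + (f b + f c) := by
    intro f
    rw [Finset.sum_insert (by simp [hab, hac]), Finset.sum_insert (by simp [hbc]),
      Finset.sum_singleton]
  have e1 : orient b c a = orient a b c := orient_rotate a b c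
  have e2 : orient c a b = orient a b c := by rw [orient_rotate, orient_rotate]
  have e3 : orient b a c = -orient a b c := orient_swap a b c
  have e4 : orient c b a = -orient a b c := by rw [orient_swap, e1]
  have e5 : orient a c b = -orient a b c := by rw [orient_swap, e2]
  have hself : ∀ p, side {a, b, c} p p = 0 := by
    intro p; simp [hs, orient_self]
  rw [hsum, hsum, hsum, hsum, hself, hself, hself, edgeFlux_swap a b, edgeFlux_swap b c,
    edgeFlux_swap c a]
  simp only [hs, e1, e2, e3, e4, e5, orient_self_left, orient_self_right, Real.sign_zero,
    Real.sign_neg]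
  have := integral_divergence_triangle hD hF
  simp only [Finset.coe_insert, Finset.coe_singleton]
  rw [this]
  ring

section Triangulation

variable {Ω : PolygonalDomain} {Γ : BoundaryParts Ω} (𝒯 : Triangulation Ω Γ)

/-- The jump of the normal component of a piecewise vector field across the edge `p q`, scaled by
the length of the edge; on a boundary edge, this is the normal component itself, up to sign. -/
noncomputable def Triangulation.normalJump (F : Finset Plane → Fin 2 → Plane → ℝ) (p q x : Plane) :
    ℝ :=
  ∑ t ∈ 𝒯.tri.filter (fun t => p ∈ t ∧ q ∈ t),
    side t p q * (F t 0 x * (q 1 - p 1) - F t 1 x * (q 0 - p 0))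

variable {𝒯}

lemma Triangulation.normalJump_swap (F : Finset Plane → Fin 2 → Plane → ℝ) (p q x : Plane) :
    𝒯.normalJump F q p x = 𝒯.normalJump F p q x := by
  unfold normalJump
  refine Finset.sum_congr (by ext t; simp [and_comm]) fun t _ => ?_
  rw [side_swap]; ring

lemma Triangulation.normalJump_self (F : Finset Plane → Fin 2 → Plane → ℝ) (p x : Plane) :
    𝒯.normalJump F p p x = 0 := by
  simp [normalJump]

lemma Triangulation.continuous_normalJump {F : Finset Plane → Fin 2 → Plane → ℝ}
    (hF : ∀ t i, Continuous (F t i)) (p q : Plane) : Continuous (𝒯.normalJump F p q) := by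
  unfold normalJump; fun_prop

/-- The divergence theorem for piecewise smooth vector fields. -/
theorem Triangulation.sum_integral_divergence {F : Finset Plane → Fin 2 → Plane → ℝ}
    (hF : ∀ t i, ContDiff ℝ 1 (F t i)) :
    2 * ∑ t ∈ 𝒯.tri, ∫ x in convexHull ℝ (t : Set Plane), (pd 0 (F t 0) x + pd 1 (F t 1) x) =
      ∑ p ∈ 𝒯.verts, ∑ q ∈ 𝒯.verts,
        ∫ s in (0 : ℝ)..1, 𝒯.normalJump F p q (AffineMap.lineMap p q s) := by
  classical
  have h1 : ∀ t ∈ 𝒯.tri, 2 * ∫ x in convexHull ℝ (t : Set Plane),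
      (pd 0 (F t 0) x + pd 1 (F t 1) x) = ∑ p ∈ 𝒯.verts, ∑ q ∈ 𝒯.verts,
        if p ∈ t ∧ q ∈ t then side t p q * edgeFlux p q (F t) else 0 := by
    intro t ht
    obtain ⟨a, b, c, hab, hac, hbc, htc, hD⟩ := exists_vertices ht
    have hsub : t ⊆ 𝒯.verts := fun p hp => mem_verts.2 ⟨t, ht, hp⟩
    have h2 := integral_divergence_triangle' hab hac hbc hD (hF t)
    rw [← htc] at h2
    rw [h2]
    rw [← Finset.sum_subset hsub (f := fun p => ∑ q ∈ 𝒯.verts,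
        if p ∈ t ∧ q ∈ t then side t p q * edgeFlux p q (F t) else 0)]
    · refine Finset.sum_congr rfl fun p hp => ?_
      rw [← Finset.sum_subset hsub]
      · exact Finset.sum_congr rfl fun q hq => by simp [hp, hq]
      · intro q _ hq; simp [hq]
    · intro p _ hp
      exact Finset.sum_eq_zero fun q _ => by simp [hp]
  rw [Finset.mul_sum, Finset.sum_congr rfl h1, Finset.sum_comm]
  refine Finset.sum_congr rfl fun p _ => ?_
  rw [Finset.sum_comm]
  refine Finset.sum_congr rfl fun q _ => ?_
  rw [← Finset.sum_filter]
  unfold normalJump edgeFlux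
  rw [intervalIntegral.integral_finsetSum]
  · exact Finset.sum_congr rfl fun t _ => (intervalIntegral.integral_const_mul _ _).symm
  · intro t _
    have := fun i => (hF t i).continuous
    have hl : Continuous (fun s : ℝ => (AffineMap.lineMap p q s : Plane)) :=
      AffineMap.lineMap_continuous
    exact Continuous.intervalIntegrable (by fun_prop) _ _

/-- The integral over the domain is the sum of the integrals over the triangles. -/
lemma Triangulation.integral_eq_sum {h : Plane → ℝ} {G : Finset Plane → Plane → ℝ}
    (hG : ∀ t, Continuous (G t))
    (he : ∀ t ∈ 𝒯.tri, ∀ᵐ x ∂(volume.restrict Ω.carrier), x ∈ convexHull ℝ (t : Set Plane) →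
      h x = G t x) :
    ∫ x in Ω.carrier, h x = ∑ t ∈ 𝒯.tri, ∫ x in convexHull ℝ (t : Set Plane), G t x := by
  have h1 : (Ω.carrier : Set Plane) =ᵐ[volume]
      ⋃ t ∈ 𝒯.tri, interior (convexHull ℝ (t : Set Plane)) := by
    have h2 := (ae_restrict_iff' Ω.isOpen.measurableSet).1 𝒯.ae_interior
    refine Filter.Eventually.set_eq ?_
    filter_upwards [h2] with x hx
    constructor
    · intro hxΩ
      obtain ⟨T, ⟨t, ht, hc, rfl⟩, hxt⟩ := hx hxΩ
      exact mem_iUnion₂.2 ⟨t, mem_tri.2 ⟨ht, hc⟩, hxt⟩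
    · intro hxt
      obtain ⟨t, ht, hxt⟩ := mem_iUnion₂.1 hxt
      exact interior_tri_subset ht hxt
  have hae : ∀ t ∈ 𝒯.tri, h =ᵐ[volume.restrict (interior (convexHull ℝ (t : Set Plane)))] G t := by
    intro t ht
    have h3 := ae_restrict_of_ae_restrict_of_subset (interior_tri_subset ht) (he t ht)
    filter_upwards [h3, ae_restrict_mem isOpen_interior.measurableSet] with x hx hxt
    exact hx (interior_subset hxt)
  rw [setIntegral_congr_set h1, integral_biUnion_finset]
  · refine Finset.sum_congr rfl fun t ht => ?_
    rw [integral_congr_ae (hae t ht)]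
    exact setIntegral_congr_set (interior_ae_eq_of_null_frontier
      ((convex_convexHull ℝ (t : Set Plane)).addHaar_frontier volume))
  · exact fun t _ => isOpen_interior.measurableSet
  · intro t ht t' ht' hne
    exact disjoint_interior ht ht' hne
  · intro t ht
    refine IntegrableOn.congr_fun_ae ?_ (hae t ht).symm
    refine IntegrableOn.mono_set ?_ interior_subset
    exact (hG t).continuousOn.integrableOn_compact (t.finite_toSet.isCompact_convexHull ℝ)

variable (𝒯) in
/-- The polynomials `P t` are the restrictions of `f ∈ L²(Ω)` to the triangles `t`. -/
def Triangulation.HasPieces (f : L2 Ω.carrier) (P : Finset Plane → MvPolynomial (Fin 2) ℝ) :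
    Prop :=
  ∀ t ∈ 𝒯.tri, ∀ᵐ x ∂(volume.restrict Ω.carrier), x ∈ convexHull ℝ (t : Set Plane) →
    f x = polyEval (P t) x

lemma IsPiecewisePoly.exists_pieces {k : ℕ} {f : L2 Ω.carrier} (h : IsPiecewisePoly 𝒯 k f) :
    ∃ P, 𝒯.HasPieces f P ∧ ∀ t, (P t).totalDegree ≤ k := by
  have : ∀ t : Finset Plane, ∃ p : MvPolynomial (Fin 2) ℝ, p.totalDegree ≤ k ∧ (t ∈ 𝒯.tri →
      ∀ᵐ x ∂(volume.restrict Ω.carrier), x ∈ convexHull ℝ (t : Set Plane) →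
        f x = polyEval p x) := by
    intro t
    by_cases ht : t ∈ 𝒯.tri
    · obtain ⟨p, hp, hpe⟩ := h _ (Triangulation.mem_triangles_of_tri ht)
      exact ⟨p, hp, fun _ => hpe⟩
    · exact ⟨0, by simp, fun h => absurd h ht⟩
  choose P hP hPe using this
  exact ⟨P, fun t ht => hPe t ht, hP⟩

lemma Triangulation.HasPieces.isPiecewisePoly {k : ℕ} {f : L2 Ω.carrier}
    {P : Finset Plane → MvPolynomial (Fin 2) ℝ} (h : 𝒯.HasPieces f P)
    (hP : ∀ t ∈ 𝒯.tri, (P t).totalDegree ≤ k) : IsPiecewisePoly 𝒯 k f := by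
  rintro T ⟨t, ht, hc, rfl⟩
  have ht' : t ∈ 𝒯.tri := mem_tri.2 ⟨ht, hc⟩
  exact ⟨P t, hP t ht', h t ht'⟩

lemma Triangulation.ae_mem_interior (𝒯 : Triangulation Ω Γ) :
    ∀ᵐ x ∂(volume.restrict Ω.carrier), ∃ t ∈ 𝒯.tri, x ∈ interior (convexHull ℝ (t : Set Plane)) := by
  filter_upwards [𝒯.ae_interior] with x ⟨T, ⟨t, ht, hc, hT⟩, hx⟩
  exact ⟨t, mem_tri.2 ⟨ht, hc⟩, hT ▸ hx⟩

lemma Triangulation.ext_pieces {f g : L2 Ω.carrier} {P : Finset Plane → MvPolynomial (Fin 2) ℝ}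
    (hf : 𝒯.HasPieces f P) (hg : 𝒯.HasPieces g P) : f = g := by
  have h1 := (eventually_all_finset 𝒯.tri).2 hf
  have h2 := (eventually_all_finset 𝒯.tri).2 hg
  refine Lp.ext ?_
  filter_upwards [h1, h2, 𝒯.ae_mem_interior] with x h1 h2 ⟨t, ht, hx⟩
  rw [h1 t ht (interior_subset hx), h2 t ht (interior_subset hx)]

lemma Triangulation.HasPieces.unique {f : L2 Ω.carrier}
    {P Q : Finset Plane → MvPolynomial (Fin 2) ℝ}
    (hP : 𝒯.HasPieces f P) (hQ : 𝒯.HasPieces f Q) {t : Finset Plane} (ht : t ∈ 𝒯.tri) :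
    P t = Q t := by
  refine eq_of_polyEval_eq isOpen_interior (interior_tri_nonempty ht) ?_
  refine Measure.eqOn_open_of_ae_eq (μ := volume) ?_ isOpen_interior
    (continuous_polyEval _).continuousOn (continuous_polyEval _).continuousOn
  have h1 := ae_restrict_of_ae_restrict_of_subset (interior_tri_subset ht) (hP t ht)
  have h2 := ae_restrict_of_ae_restrict_of_subset (interior_tri_subset ht) (hQ t ht)
  filter_upwards [h1, h2, ae_restrict_mem isOpen_interior.measurableSet] with x h1 h2 hx
  rw [← h1 (interior_subset hx), ← h2 (interior_subset hx)]

lemma Triangulation.HasPieces.congr {f : L2 Ω.carrier}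
    {P Q : Finset Plane → MvPolynomial (Fin 2) ℝ} (hP : 𝒯.HasPieces f P)
    (h : ∀ t ∈ 𝒯.tri, P t = Q t) : 𝒯.HasPieces f Q := fun t ht => h t ht ▸ hP t ht

lemma Triangulation.HasPieces.add {f g : L2 Ω.carrier}
    {P Q : Finset Plane → MvPolynomial (Fin 2) ℝ} (hP : 𝒯.HasPieces f P) (hQ : 𝒯.HasPieces g Q) :
    𝒯.HasPieces (f + g) (P + Q) := by
  intro t ht
  filter_upwards [hP t ht, hQ t ht, Lp.coeFn_add f g] with x h1 h2 h3 hx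
  rw [h3, Pi.add_apply, h1 hx, h2 hx, Pi.add_apply, polyEval_add]

lemma Triangulation.HasPieces.smul {f : L2 Ω.carrier}
    {P : Finset Plane → MvPolynomial (Fin 2) ℝ} (c : ℝ) (hP : 𝒯.HasPieces f P) :
    𝒯.HasPieces (c • f) (c • P) := by
  intro t ht
  filter_upwards [hP t ht, Lp.coeFn_smul c f] with x h1 h3 hx
  simp [h3, h1 hx]

lemma Triangulation.eq_of_mem_interior {t t' : Finset Plane} (ht : t ∈ 𝒯.tri) (ht' : t' ∈ 𝒯.tri)
    {x : Plane} (hx : x ∈ convexHull ℝ (t : Set Plane))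
    (hx' : x ∈ interior (convexHull ℝ (t' : Set Plane))) : t = t' := by
  by_contra hne
  rw [← closure_interior_tri ht] at hx
  obtain ⟨y, hy1, hy2⟩ := mem_closure_iff_nhds.1 hx _ (isOpen_interior.mem_nhds hx')
  exact Set.disjoint_left.1 (disjoint_interior ht ht' hne) hy2 hy1

lemma Triangulation.exists_hasPieces (𝒯 : Triangulation Ω Γ)
    (P : Finset Plane → MvPolynomial (Fin 2) ℝ) : ∃ f : L2 Ω.carrier, 𝒯.HasPieces f P := by
  classical
  let g : Plane → ℝ := fun x =>
    if h : ∃ t ∈ 𝒯.tri, x ∈ interior (convexHull ℝ (t : Set Plane)) then polyEval (P h.choose) x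
    else 0
  have hg : ∀ t ∈ 𝒯.tri, EqOn g (polyEval (P t)) (interior (convexHull ℝ (t : Set Plane))) := by
    intro t ht x hx
    have h : ∃ t ∈ 𝒯.tri, x ∈ interior (convexHull ℝ (t : Set Plane)) := ⟨t, ht, hx⟩
    have he : h.choose = t :=
      eq_of_mem_interior h.choose_spec.1 ht (interior_subset h.choose_spec.2) hx
    simp only [g, dif_pos h, he]
  have hm : MemLp g 2 (volume.restrict Ω.carrier) := by
    refine memLp_of_triangles 𝒯 g ?_
    rintro T ⟨t, ht, hc, rfl⟩
    exact ⟨_, continuous_polyEval _, hg t (mem_tri.2 ⟨ht, hc⟩)⟩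
  refine ⟨hm.toLp, fun t ht => ?_⟩
  filter_upwards [hm.coeFn_toLp, 𝒯.ae_mem_interior] with x hx ⟨t', ht', hxt'⟩ hxt
  obtain rfl := eq_of_mem_interior ht ht' hxt hxt'
  rw [hx, hg t ht hxt']

variable (𝒯) in
/-- The normal jump of a piecewise polynomial vector field. -/
noncomputable def Triangulation.polyJump (P : Finset Plane → Fin 2 → MvPolynomial (Fin 2) ℝ)
    (p q x : Plane) : ℝ := 𝒯.normalJump (fun t j => polyEval (P t j)) p q x

lemma Triangulation.continuous_polyJump (P : Finset Plane → Fin 2 → MvPolynomial (Fin 2) ℝ)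
    (p q : Plane) : Continuous (𝒯.polyJump P p q) :=
  continuous_normalJump (fun _ _ => continuous_polyEval _) p q

/-- The divergence of a polynomial vector field. -/
noncomputable def divPoly (P : Fin 2 → MvPolynomial (Fin 2) ℝ) : MvPolynomial (Fin 2) ℝ :=
  MvPolynomial.pderiv 0 (P 0) + MvPolynomial.pderiv 1 (P 1)

/-- Green's formula for a row of a piecewise polynomial matrix field and its piecewise divergence:
the boundary terms are the normal jumps. -/
theorem Triangulation.two_mul_green {τ : L2Mat Ω.carrier} {g : L2Vec Ω.carrier} {i : Fin 2}
    {P : Finset Plane → Fin 2 → MvPolynomial (Fin 2) ℝ}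
    (hτ : ∀ j, 𝒯.HasPieces (τ i j) (fun t => P t j))
    (hg : 𝒯.HasPieces (g i) (fun t => divPoly (P t))) {φ : Plane → ℝ} (hφ : IsTest φ) :
    2 * green τ g i φ = ∑ p ∈ 𝒯.verts, ∑ q ∈ 𝒯.verts, ∫ s in (0 : ℝ)..1,
      φ (AffineMap.lineMap p q s) * 𝒯.polyJump P p q (AffineMap.lineMap p q s) := by
  have hφ1 : ContDiff ℝ 1 φ := hφ.1.of_le (by simp)
  have hφd : Differentiable ℝ φ := hφ1.differentiable (by simp)
  have hF : ∀ t j, ContDiff ℝ 1 (fun x => φ x * polyEval (P t j) x) := fun t j =>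
    hφ1.mul ((contDiff_polyEval _).of_le (by simp))
  have h1 := sum_integral_divergence (𝒯 := 𝒯) (F := fun t j x => φ x * polyEval (P t j) x) hF
  have h2 : green τ g i φ = ∑ t ∈ 𝒯.tri, ∫ x in convexHull ℝ (t : Set Plane),
      (pd 0 (fun x => φ x * polyEval (P t 0) x) x + pd 1 (fun x => φ x * polyEval (P t 1) x) x) := by
    have h3 : green τ g i φ = ∫ x in Ω.carrier,
        (τ i 0 x * pd 0 φ x + τ i 1 x * pd 1 φ x + g i x * φ x) := by
      have hI : Integrable (fun x => τ i 0 x * pd 0 φ x + τ i 1 x * pd 1 φ x)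
          (volume.restrict Ω.carrier) :=
        (integrable_pairing _ (hφ.pd 0).1 (hφ.pd 0).2).add
          (integrable_pairing _ (hφ.pd 1).1 (hφ.pd 1).2)
      unfold green pairing
      rw [Fin.sum_univ_two, ← integral_add (integrable_pairing _ (hφ.pd 0).1 (hφ.pd 0).2)
        (integrable_pairing _ (hφ.pd 1).1 (hφ.pd 1).2), ← integral_add hI
        (integrable_pairing _ hφ.1.continuous hφ.2)]
    rw [h3]
    refine integral_eq_sum (fun t => ?_) fun t ht => ?_
    · exact (continuous_pd (hF t 0) 0).add (continuous_pd (hF t 1) 1)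
    · filter_upwards [hτ 0 t ht, hτ 1 t ht, hg t ht] with x a0 a1 a2 hx
      rw [a0 hx, a1 hx, a2 hx, pd_mul hφd (differentiable_polyEval _),
        pd_mul hφd (differentiable_polyEval _), pd_polyEval, pd_polyEval, divPoly, polyEval_add]
      ring
  rw [h2, h1]
  refine Finset.sum_congr rfl fun p _ => Finset.sum_congr rfl fun q _ => ?_
  refine intervalIntegral.integral_congr fun s _ => ?_
  simp only [polyJump, normalJump, Finset.mul_sum]
  exact Finset.sum_congr rfl fun t _ => by ring

variable (𝒯) in
/-- The normal jumps vanish, except possibly on the Dirichlet edges. -/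
def Triangulation.JumpFree (P : Finset Plane → Fin 2 → MvPolynomial (Fin 2) ℝ) : Prop :=
  ∀ t ∈ 𝒯.tri, ∀ p ∈ t, ∀ q ∈ t, p ≠ q → ¬ openSegment ℝ p q ⊆ Γ.ΓD →
    ∀ x ∈ openSegment ℝ p q, 𝒯.polyJump P p q x = 0

lemma lineMap_mem_openSegment (p q : Plane) {s : ℝ} (h0 : 0 < s) (h1 : s < 1) :
    (AffineMap.lineMap p q s : Plane) ∈ openSegment ℝ p q := by
  rw [openSegment_eq_image_lineMap]; exact ⟨s, ⟨h0, h1⟩, rfl⟩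

/-- Piecewise polynomial fields without normal jumps have a weak divergence, given piecewise, and
vanishing normal trace on the Neumann boundary. -/
theorem Triangulation.JumpFree.green_eq_zero {τ : L2Mat Ω.carrier} {g : L2Vec Ω.carrier} {i : Fin 2}
    {P : Finset Plane → Fin 2 → MvPolynomial (Fin 2) ℝ} (hJ : 𝒯.JumpFree P)
    (hτ : ∀ j, 𝒯.HasPieces (τ i j) (fun t => P t j))
    (hg : 𝒯.HasPieces (g i) (fun t => divPoly (P t))) {φ : Plane → ℝ} (hφ : IsTest φ)
    (hφD : ∀ x ∈ Γ.ΓD, φ x = 0) : green τ g i φ = 0 := by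
  have h := two_mul_green hτ hg hφ
  have h0 : ∑ p ∈ 𝒯.verts, ∑ q ∈ 𝒯.verts, ∫ s in (0 : ℝ)..1,
      φ (AffineMap.lineMap p q s) * 𝒯.polyJump P p q (AffineMap.lineMap p q s) = 0 := by
    refine Finset.sum_eq_zero fun p _ => Finset.sum_eq_zero fun q _ => ?_
    have h1 : ∀ᵐ s : ℝ, s ≠ 1 := by
      rw [ae_iff]; simp
    refine intervalIntegral.integral_zero_ae ?_
    filter_upwards [h1] with s hs1 hs
    rw [uIoc_of_le zero_le_one] at hs
    have hx := lineMap_mem_openSegment p q hs.1 (lt_of_le_of_ne hs.2 hs1)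
    rcases eq_or_ne p q with rfl | hpq
    · rw [polyJump, normalJump_self, mul_zero]
    rcases (𝒯.tri.filter (fun t => p ∈ t ∧ q ∈ t)).eq_empty_or_nonempty with he | ⟨t, ht⟩
    · rw [polyJump, normalJump, he]; simp
    rw [Finset.mem_filter] at ht
    by_cases hD : openSegment ℝ p q ⊆ Γ.ΓD
    · rw [hφD _ (hD hx), zero_mul]
    · rw [hJ t ht.1 p ht.2.1 q ht.2.2 hpq hD _ hx, mul_zero]
  linarith

lemma BoundaryParts.ΓD_subset (Γ : BoundaryParts Ω) : Γ.ΓD ⊆ frontier Ω.carrier := by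
  obtain ⟨O, -, h⟩ := Γ.openD
  rw [h]; exact inter_subset_right

lemma BoundaryParts.ΓN_subset (Γ : BoundaryParts Ω) : Γ.ΓN ⊆ frontier Ω.carrier := by
  obtain ⟨O, -, h⟩ := Γ.openN
  rw [h]; exact inter_subset_right

lemma BoundaryParts.disjoint_closure (Γ : BoundaryParts Ω) {x : Plane} (hx : x ∈ Γ.ΓN) :
    x ∉ closure Γ.ΓD := by
  obtain ⟨O, hO, h⟩ := Γ.openN
  intro hc
  have hx' := hx
  rw [h] at hx'
  obtain ⟨y, hyO, hyD⟩ := mem_closure_iff.1 hc O hO hx'.1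
  refine Set.disjoint_left.1 Γ.disjoint hyD ?_
  rw [h]; exact ⟨hyO, Γ.ΓD_subset hyD⟩

lemma IsTest.eq_zero_of_tsupport_subset {φ : Plane → ℝ} (h : tsupport φ ⊆ Ω.carrier) :
    ∀ x ∈ Γ.ΓD, φ x = 0 := by
  intro x hx
  by_contra hne
  have h1 := h (subset_tsupport φ hne)
  have h2 := Γ.ΓD_subset hx
  rw [Ω.isOpen.frontier_eq] at h2
  exact h2.2 h1

lemma IsTest.eq_zero_of_disjoint {φ : Plane → ℝ} (h : Disjoint (tsupport φ) (closure Γ.ΓD)) :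
    ∀ x ∈ Γ.ΓD, φ x = 0 := by
  intro x hx
  by_contra hne
  exact Set.disjoint_left.1 h (subset_tsupport φ hne) (subset_closure hx)

/-- The edges of a triangulation do not cross. -/
lemma Triangulation.notMem_segment {t t' : Finset Plane} (ht : t ∈ 𝒯.tri) (ht' : t' ∈ 𝒯.tri)
    {p q p' q' x : Plane} (hp : p ∈ t) (hq : q ∈ t) (hp' : p' ∈ t') (hq' : q' ∈ t')
    (hpq : p ≠ q) (hx : x ∈ openSegment ℝ p q) (hx' : x ∈ segment ℝ p' q') :
    p ∈ ({p', q'} : Set Plane) ∧ q ∈ ({p', q'} : Set Plane) := by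
  have h1 : x ∈ convexHull ℝ (((({p, q} : Finset Plane)) : Set Plane) ∩
      ((({p', q'} : Finset Plane)) : Set Plane)) :=
    𝒯.complex.inter_subset_convexHull (mem_faces_pair ht hp hq) (mem_faces_pair ht' hp' hq')
      ⟨by simpa using openSegment_subset_segment _ _ _ hx, by simpa using hx'⟩
  have hxp : x ≠ p := by
    rintro rfl
    exact hpq (left_mem_openSegment_iff.1 hx)
  have hxq : x ≠ q := by
    rintro rfl
    exact hpq (right_mem_openSegment_iff.1 hx)
  have key : ∀ v w : Plane, x ≠ w → ({p, q} : Set Plane) ⊆ {v, w} → v ∈ ({p', q'} : Set Plane) := by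
    intro v w hw hsub
    by_contra hv
    have h2 : ((({p, q} : Finset Plane)) : Set Plane) ∩ ((({p', q'} : Finset Plane)) : Set Plane) ⊆
        {w} := by
      rintro y ⟨hy1, hy2⟩
      simp only [Finset.coe_insert, Finset.coe_singleton] at hy1 hy2
      rcases hsub hy1 with rfl | h
      · exact absurd hy2 hv
      · exact h
    have h3 := convexHull_mono h2 h1
    simp only [convexHull_singleton, mem_singleton_iff] at h3
    exact hw h3
  exact ⟨key p q hxq subset_rfl, key q p hxp (by rw [Set.pair_comm])⟩

/-- Fields with a weak divergence given piecewise and vanishing normal trace on the Neumann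
boundary have no normal jumps. -/
theorem Triangulation.jumpFree_of_green {τ : L2Mat Ω.carrier} {g : L2Vec Ω.carrier} {i : Fin 2}
    {P : Finset Plane → Fin 2 → MvPolynomial (Fin 2) ℝ}
    (hτ : ∀ j, 𝒯.HasPieces (τ i j) (fun t => P t j))
    (hg : 𝒯.HasPieces (g i) (fun t => divPoly (P t)))
    (h1 : ∀ φ, IsTest φ → tsupport φ ⊆ Ω.carrier → green τ g i φ = 0)
    (h2 : ∀ φ, IsTest φ → Disjoint (tsupport φ) (closure Γ.ΓD) → green τ g i φ = 0) :
    𝒯.JumpFree P := by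
  intro t ht p hp q hq hpq hD x hx
  by_contra hne
  set J := 𝒯.polyJump P p q with hJ
  have hJc : Continuous J := continuous_polyJump P p q
  -- an open set on which a test function sees the edge `p q` only
  have hev1 : ∀ᶠ y in 𝓝 x, 0 < J x * J y :=
    ((continuous_const.mul hJc).tendsto x).eventually
      (lt_mem_nhds (mul_self_pos.2 hne))
  have hev2 : ∀ᶠ y in 𝓝 x, ∀ s ∈ 𝒯.complex.faces, y ∈ convexHull ℝ (s : Set Plane) →
      x ∈ convexHull ℝ (s : Set Plane) := 𝒯.eventually_star x
  have hgreen : ∃ O ∈ 𝓝 x, ∀ φ, IsTest φ → tsupport φ ⊆ O → green τ g i φ = 0 := by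
    rcases edge_cases ht hpq hp hq with h | h
    · have hN := (openSegment_subset_or ht hpq hp hq h.1).resolve_left hD
      refine ⟨(closure Γ.ΓD)ᶜ, isClosed_closure.isOpen_compl.mem_nhds
        (Γ.disjoint_closure (hN hx)), fun φ hφ hs => h2 φ hφ ?_⟩
      exact Set.disjoint_left.2 fun y hy => hs hy
    · exact ⟨Ω.carrier, Ω.isOpen.mem_nhds (h.1 hx), h1⟩
  obtain ⟨O, hO, hgreen⟩ := hgreen
  obtain ⟨φ, hφs, hφc, hφd, hφr, hφx⟩ := exists_contDiff_tsupport_subset (n := ⊤)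
    (inter_mem hO (inter_mem hev1 hev2))
  have hφ : IsTest φ := ⟨hφd, hφc⟩
  have hφ0 : ∀ y, 0 ≤ φ y := fun y => (hφr (mem_range_self y)).1
  have hz := two_mul_green hτ hg hφ
  rw [hgreen φ hφ (hφs.trans inter_subset_left), mul_zero] at hz
  have hsupp : ∀ y, φ y ≠ 0 → 0 < J x * J y ∧ ∀ s ∈ 𝒯.complex.faces,
      y ∈ convexHull ℝ (s : Set Plane) → x ∈ convexHull ℝ (s : Set Plane) := fun y hy =>
    ⟨(hφs (subset_tsupport φ hy)).2.1, (hφs (subset_tsupport φ hy)).2.2⟩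
  have hnonneg : ∀ p' q' y, y ∈ segment ℝ p' q' → 0 ≤ J x * (φ y * 𝒯.polyJump P p' q' y) := by
    intro p' q' y hy
    by_cases hφy : φ y = 0
    · simp [hφy]
    obtain ⟨hpos, hstar⟩ := hsupp y hφy
    rcases (𝒯.tri.filter (fun t => p' ∈ t ∧ q' ∈ t)).eq_empty_or_nonempty with he | ⟨t', ht'⟩
    · rw [polyJump, normalJump, he]; simp
    rw [Finset.mem_filter] at ht'
    have hx' : x ∈ segment ℝ p' q' := by
      have := hstar {p', q'} (mem_faces_pair ht'.1 ht'.2.1 ht'.2.2) (by simpa using hy)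
      simpa using this
    obtain ⟨m1, m2⟩ := notMem_segment ht ht'.1 hp hq ht'.2.1 ht'.2.2 hpq hx hx'
    have hJ' : 𝒯.polyJump P p' q' y = J y := by
      simp only [mem_insert_iff, mem_singleton_iff] at m1 m2
      rcases m1 with rfl | rfl <;> rcases m2 with rfl | rfl
      · exact absurd rfl hpq
      · rfl
      · exact normalJump_swap _ _ _ _
      · exact absurd rfl hpq
    rw [hJ', mul_left_comm]
    exact mul_nonneg (hφ0 y) hpos.le
  have hmem : ∀ (p' q' : Plane) (s : ℝ), s ∈ Icc (0 : ℝ) 1 →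
      (AffineMap.lineMap p' q' s : Plane) ∈ segment ℝ p' q' := by
    intro p' q' s hs
    rw [segment_eq_image_lineMap]; exact ⟨s, hs, rfl⟩
  have hint : ∀ p' q', 0 ≤ J x * ∫ s in (0 : ℝ)..1, φ (AffineMap.lineMap p' q' s) *
      𝒯.polyJump P p' q' (AffineMap.lineMap p' q' s) := by
    intro p' q'
    rw [← intervalIntegral.integral_const_mul]
    exact intervalIntegral.integral_nonneg zero_le_one fun s hs =>
      hnonneg p' q' _ (hmem p' q' s hs)
  have hsum := congrArg (fun z => J x * z) hz.symm
  simp only [Finset.mul_sum, mul_zero] at hsum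
  have hpv : p ∈ 𝒯.verts := mem_verts.2 ⟨t, ht, hp⟩
  have hqv : q ∈ 𝒯.verts := mem_verts.2 ⟨t, ht, hq⟩
  rw [Finset.sum_eq_zero_iff_of_nonneg
    fun p' _ => Finset.sum_nonneg fun q' _ => hint p' q'] at hsum
  have hsum2 := hsum p hpv
  rw [Finset.sum_eq_zero_iff_of_nonneg fun q' _ => hint p q'] at hsum2
  have hfin := hsum2 q hqv
  have hpos : 0 < J x * ∫ s in (0 : ℝ)..1, φ (AffineMap.lineMap p q s) *
      J (AffineMap.lineMap p q s) := by
    rw [← intervalIntegral.integral_const_mul]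
    have hl : Continuous (fun s : ℝ => (AffineMap.lineMap p q s : Plane)) :=
      AffineMap.lineMap_continuous
    have hφcont := hφ.1.continuous
    refine intervalIntegral.integral_pos zero_lt_one (by fun_prop) (fun s hs =>
      hnonneg p q _ (hmem p q s ⟨hs.1.le, hs.2⟩)) ?_
    rw [openSegment_eq_image_lineMap] at hx
    obtain ⟨s, hs, hsx⟩ := hx
    refine ⟨s, ⟨hs.1.le, hs.2.le⟩, ?_⟩
    rw [hsx, hφx, one_mul]
    exact mul_self_pos.2 hne
  exact hpos.ne' hfin

lemma addHaar_segment (p q : Plane) : volume (segment ℝ p q) = 0 := by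
  by_cases hpq : p = q
  · subst hpq; simp
  have hcl : IsClosed (segment ℝ p q) := by
    rw [← convexHull_pair]; exact ((Set.toFinite _).isCompact_convexHull ℝ).isClosed
  have hsub : segment ℝ p q ⊆ {y | orient p q y = 0} := fun y => orient_eq_zero_of_mem_segment
  have hint : interior (segment ℝ p q) = ∅ := by
    rw [← subset_empty_iff, ← interior_orient_eq_zero hpq]
    exact interior_mono hsub
  have := (convex_segment p q).addHaar_frontier volume
  rwa [hcl.frontier_eq, hint, sdiff_empty] at this

/-- The weak divergence of a piecewise polynomial matrix field is the piecewise divergence. -/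
theorem Triangulation.hasPieces_weakDiv {τ : L2Mat Ω.carrier} {g : L2Vec Ω.carrier} {i : Fin 2}
    {P : Finset Plane → Fin 2 → MvPolynomial (Fin 2) ℝ}
    (hτ : ∀ j, 𝒯.HasPieces (τ i j) (fun t => P t j)) (hdiv : IsWeakDiv τ g) :
    𝒯.HasPieces (g i) (fun t => divPoly (P t)) := by
  obtain ⟨f, hf⟩ := 𝒯.exists_hasPieces (fun t => divPoly (P t))
  suffices h : g i = f by rw [h]; exact hf
  let E : Set Plane := ⋃ p ∈ 𝒯.verts, ⋃ q ∈ 𝒯.verts, segment ℝ p q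
  have hEc : IsClosed E := by
    refine 𝒯.verts.finite_toSet.isClosed_biUnion fun p _ =>
      𝒯.verts.finite_toSet.isClosed_biUnion fun q _ => ?_
    rw [← convexHull_pair]; exact ((Set.toFinite _).isCompact_convexHull ℝ).isClosed
  have hE0 : volume E = 0 := by
    refine (measure_biUnion_null_iff 𝒯.verts.countable_toSet).2 fun p _ =>
      (measure_biUnion_null_iff 𝒯.verts.countable_toSet).2 fun q _ => addHaar_segment p q
  have hO : IsOpen (Ω.carrier \ E) := Ω.isOpen.sdiff hEc
  let d : L2 Ω.carrier := g i - f
  have hd : ∀ φ, IsTest φ → tsupport φ ⊆ Ω.carrier \ E → pairing d φ = 0 := by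
    intro φ hφ hs
    have e1 := hdiv i φ hφ (hs.trans sdiff_subset)
    have e2 := two_mul_green (g := fun _ => f) hτ hf hφ
    have e3 : ∑ p ∈ 𝒯.verts, ∑ q ∈ 𝒯.verts, ∫ s in (0 : ℝ)..1,
        φ (AffineMap.lineMap p q s) * 𝒯.polyJump P p q (AffineMap.lineMap p q s) = 0 := by
      refine Finset.sum_eq_zero fun p hp => Finset.sum_eq_zero fun q hq => ?_
      rw [intervalIntegral.integral_congr (g := fun _ => 0)]
      · simp
      · intro s hs'
        rw [uIcc_of_le zero_le_one] at hs'
        have : φ (AffineMap.lineMap p q s) = 0 := by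
          by_contra hne
          refine (hs (subset_tsupport φ hne)).2 (mem_iUnion₂.2 ⟨p, hp, mem_iUnion₂.2 ⟨q, hq, ?_⟩⟩)
          rw [segment_eq_image_lineMap]; exact ⟨s, hs', rfl⟩
        simp [this]
    rw [e3] at e2
    have e4 : pairing d φ + pairing f φ = pairing (g i) φ := by
      rw [← pairing_add _ _ hφ.1.continuous hφ.2]; simp [d]
    simp only [green] at e1 e2
    linarith
  have key : ∀ᵐ x ∂(volume.restrict Ω.carrier), x ∈ Ω.carrier \ E → d x = 0 := by
    refine hO.ae_eq_zero_of_integral_contDiff_smul_eq_zero ?_ fun φ h1 h2 h3 => ?_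
    · exact ((Lp.memLp d).locallyIntegrable (by norm_num)).locallyIntegrableOn _
    · have := hd φ ⟨h1, h2⟩ h3
      unfold pairing at this
      simpa [mul_comm] using this
  have hzero : d = 0 := by
    refine Lp.ext ?_
    have h0 : ∀ᵐ x ∂(volume.restrict Ω.carrier), x ∉ E :=
      ae_restrict_of_ae (measure_eq_zero_iff_ae_notMem.1 hE0)
    filter_upwards [key, h0, ae_restrict_mem Ω.isOpen.measurableSet,
      Lp.coeFn_zero ℝ 2 (volume.restrict Ω.carrier)] with x hx hxE hxΩ h0
    rw [hx ⟨hxΩ, hxE⟩, h0]; rfl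
  exact sub_eq_zero.1 hzero

end Triangulation

/-! ### Piecewise polynomial stresses and the Airy operator -/

lemma pderiv_pderiv_comm (p : MvPolynomial (Fin 2) ℝ) :
    MvPolynomial.pderiv 0 (MvPolynomial.pderiv 1 p) =
      MvPolynomial.pderiv 1 (MvPolynomial.pderiv 0 p) := by
  ext d
  simp only [MvPolynomial.coeff_pderiv]
  rw [add_right_comm]
  simp
  ring

/-- The curl of a polynomial. -/
noncomputable def curlPoly (p : MvPolynomial (Fin 2) ℝ) : Fin 2 → MvPolynomial (Fin 2) ℝ :=
  ![-MvPolynomial.pderiv 1 p, MvPolynomial.pderiv 0 p]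

lemma curl_polyEval (p : MvPolynomial (Fin 2) ℝ) (x : Plane) (i : Fin 2) :
    curl (polyEval p) x i = polyEval (curlPoly p i) x := by
  fin_cases i <;> simp [curl, curlPoly, pd_polyEval]

lemma airyFun_polyEval (p : MvPolynomial (Fin 2) ℝ) (x : Plane) (i j : Fin 2) :
    airyFun (polyEval p) x i j = polyEval (curlPoly (curlPoly p i) j) x := by
  have h : (fun y => curl (polyEval p) y i) = polyEval (curlPoly p i) :=
    funext fun y => curl_polyEval p y i
  rw [airyFun, h, curl_polyEval]

lemma divPoly_curlPoly (p : MvPolynomial (Fin 2) ℝ) : divPoly (curlPoly p) = 0 := by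
  simp [divPoly, curlPoly, pderiv_pderiv_comm]

lemma curlPoly_curlPoly_symm (p : MvPolynomial (Fin 2) ℝ) (i j : Fin 2) :
    curlPoly (curlPoly p i) j = curlPoly (curlPoly p j) i := by
  fin_cases i <;> fin_cases j <;> simp [curlPoly, pderiv_pderiv_comm]

lemma totalDegree_curlPoly_le {p : MvPolynomial (Fin 2) ℝ} {k : ℕ} (hp : p.totalDegree ≤ k + 1)
    (i : Fin 2) : (curlPoly p i).totalDegree ≤ k := by
  fin_cases i
  · simpa [curlPoly] using totalDegree_pderiv_le hp 1
  · simpa [curlPoly] using totalDegree_pderiv_le hp 0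

/-- A divergence-free polynomial field is a curl. -/
lemma exists_curlPoly_eq {P : Fin 2 → MvPolynomial (Fin 2) ℝ} (h : divPoly P = 0) {k : ℕ}
    (hP : ∀ j, (P j).totalDegree ≤ k) :
    ∃ p : MvPolynomial (Fin 2) ℝ, p.totalDegree ≤ k + 1 ∧ curlPoly p = P := by
  obtain ⟨p, hp, h0, h1⟩ := exists_polynomial_primitive (a := P 1) (b := -P 0)
    (by rw [map_neg]; unfold divPoly at h; linear_combination h) (hP 1) (by simpa using hP 0)
  refine ⟨p, hp, ?_⟩
  ext1 j
  fin_cases j <;> simp [curlPoly, h0, h1]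

lemma hasDerivAt_polyEval_lineMap (g : MvPolynomial (Fin 2) ℝ) (p q : Plane) (s : ℝ) :
    HasDerivAt (fun s : ℝ => polyEval g (AffineMap.lineMap p q s))
      (fderiv ℝ (polyEval g) (AffineMap.lineMap p q s) (q - p)) s :=
  ((differentiable_polyEval g _).hasFDerivAt).comp_hasDerivAt s AffineMap.hasDerivAt_lineMap

lemma continuous_fderiv_polyEval (g : MvPolynomial (Fin 2) ℝ) (v : Plane) :
    Continuous fun x => fderiv ℝ (polyEval g) x v :=
  ((contDiff_polyEval g).continuous_fderiv (by simp)).clm_apply continuous_const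

lemma eqOn_segment_of_eqOn_openSegment {f g : Plane → ℝ} (hf : Continuous f) (hg : Continuous g)
    {p q : Plane} (h : ∀ x ∈ openSegment ℝ p q, f x = g x) : ∀ x ∈ segment ℝ p q, f x = g x := by
  rw [← closure_openSegment]
  exact fun x hx => closure_minimal (s := openSegment ℝ p q) h (isClosed_eq hf hg) hx

/-- A polynomial is constant on a segment if and only if its tangential derivative vanishes. -/
lemma tangential_eq_zero_iff (g : MvPolynomial (Fin 2) ℝ) (p q : Plane) :
    (∀ x ∈ openSegment ℝ p q, fderiv ℝ (polyEval g) x (q - p) = 0) ↔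
      ∀ x ∈ segment ℝ p q, polyEval g x = polyEval g p := by
  constructor
  · intro h x hx
    have h' := eqOn_segment_of_eqOn_openSegment (continuous_fderiv_polyEval g (q - p))
      continuous_const h
    rw [segment_eq_image_lineMap] at hx
    obtain ⟨s, hs, rfl⟩ := hx
    have := constant_of_has_deriv_right_zero
      (f := fun s : ℝ => polyEval g (AffineMap.lineMap p q s)) (a := 0) (b := 1)
      (fun s _ => (hasDerivAt_polyEval_lineMap g p q s).continuousAt.continuousWithinAt)
      (fun s hs => ?_) s hs
    · simpa using this
    · have h1 := hasDerivAt_polyEval_lineMap g p q s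
      rw [h' _ (by rw [segment_eq_image_lineMap]; exact ⟨s, ⟨hs.1, hs.2.le⟩, rfl⟩)] at h1
      exact h1.hasDerivWithinAt
  · intro h x hx
    rw [openSegment_eq_image_lineMap] at hx
    obtain ⟨s, hs, rfl⟩ := hx
    have h1 := hasDerivAt_polyEval_lineMap g p q s
    have h2 : (fun s : ℝ => polyEval g (AffineMap.lineMap p q s)) =ᶠ[𝓝 s]
        fun _ => polyEval g p := by
      filter_upwards [Ioo_mem_nhds hs.1 hs.2] with u hu
      exact h _ (by rw [segment_eq_image_lineMap]; exact ⟨u, ⟨hu.1.le, hu.2.le⟩, rfl⟩)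
    exact h1.unique ((hasDerivAt_const s _).congr_of_eventuallyEq h2)

section Triangulation

variable {Ω : PolygonalDomain} {Γ : BoundaryParts Ω} {𝒯 : Triangulation Ω Γ} {r : ℕ}

/-- The normal jump of a piecewise curl is a jump of tangential derivatives. -/
lemma Triangulation.polyJump_curlPoly (g : Finset Plane → MvPolynomial (Fin 2) ℝ) (p q x : Plane) :
    𝒯.polyJump (fun t => curlPoly (g t)) p q x =
      -∑ t ∈ 𝒯.tri.filter (fun t => p ∈ t ∧ q ∈ t),
        side t p q * fderiv ℝ (polyEval (g t)) x (q - p) := by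
  rw [polyJump, normalJump, ← Finset.sum_neg_distrib]
  refine Finset.sum_congr rfl fun t _ => ?_
  rw [fderiv_apply_eq_pd, pd_polyEval, pd_polyEval]
  simp [curlPoly]
  ring

/-- The curl of a piecewise polynomial has no normal jumps if and only if the jumps of the piecewise
polynomial are constant on each interior edge and it is constant on each Neumann edge. -/
theorem Triangulation.jumpFree_curlPoly_iff (g : Finset Plane → MvPolynomial (Fin 2) ℝ) :
    𝒯.JumpFree (fun t => curlPoly (g t)) ↔
      (∀ t ∈ 𝒯.tri, ∀ t' ∈ 𝒯.tri, ∀ p q, p ≠ q → p ∈ t → q ∈ t → p ∈ t' → q ∈ t' →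
        ∀ x ∈ segment ℝ p q,
          polyEval (g t) x - polyEval (g t') x = polyEval (g t) p - polyEval (g t') p) ∧
      (∀ t ∈ 𝒯.tri, ∀ p q, p ≠ q → p ∈ t → q ∈ t → openSegment ℝ p q ⊆ Γ.ΓN →
        ∀ x ∈ segment ℝ p q, polyEval (g t) x = polyEval (g t) p) := by
  have hsub : ∀ (t t' : Finset Plane) (x v : Plane), fderiv ℝ (polyEval (g t - g t')) x v =
      fderiv ℝ (polyEval (g t)) x v - fderiv ℝ (polyEval (g t')) x v := by
    intro t t' x v
    simp only [fderiv_apply_eq_pd, pd_polyEval, map_sub, polyEval_sub]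
    ring
  have hint : ∀ p q : Plane, (openSegment ℝ p q ⊆ Γ.ΓD ∨ openSegment ℝ p q ⊆ Γ.ΓN) →
      ¬ openSegment ℝ p q ⊆ Ω.carrier := by
    intro p q h hs
    have hx := lineMap_mem_openSegment p q (s := 1 / 2) (by norm_num) (by norm_num)
    have hf := h.elim (fun h => Γ.ΓD_subset (h hx)) (fun h => Γ.ΓN_subset (h hx))
    rw [Ω.isOpen.frontier_eq] at hf
    exact hf.2 (hs hx)
  constructor
  · intro hJ
    refine ⟨fun t ht t' ht' p q hpq hp hq hp' hq' => ?_, fun t ht p q hpq hp hq hN => ?_⟩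
    · rcases eq_or_ne t t' with rfl | hne
      · simp
      have hO := openSegment_subset_of_two ht ht' hne hpq hp hq hp' hq'
      have h1 : ∀ x ∈ openSegment ℝ p q, fderiv ℝ (polyEval (g t - g t')) x (q - p) = 0 := by
        intro x hx
        have h2 := hJ t ht p hp q hq hpq (fun h => hint p q (Or.inl h) hO) x hx
        rw [polyJump_curlPoly] at h2
        rcases edge_cases ht hpq hp hq with h | ⟨-, s, hs, hts, hps, hqs, hside, hfil⟩
        · have : t' ∈ ({t} : Finset (Finset Plane)) := by
            rw [← h.2]; exact Finset.mem_filter.2 ⟨ht', hp', hq'⟩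
          exact absurd (Finset.mem_singleton.1 this).symm hne
        · have : t' ∈ ({t, s} : Finset (Finset Plane)) := by
            rw [← hfil]; exact Finset.mem_filter.2 ⟨ht', hp', hq'⟩
          simp only [Finset.mem_insert, Finset.mem_singleton] at this
          obtain rfl : t' = s := this.resolve_left hne.symm
          rw [hfil, Finset.sum_pair hne, hside] at h2
          have h3 : side t p q * fderiv ℝ (polyEval (g t - g t')) x (q - p) = 0 := by
            rw [hsub]; linarith
          exact (mul_eq_zero.1 h3).resolve_left (side_ne_zero ht hp hq hpq)
      have h4 := (tangential_eq_zero_iff _ p q).1 h1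
      simpa using h4
    · refine (tangential_eq_zero_iff _ p q).1 fun x hx => ?_
      have hD : ¬ openSegment ℝ p q ⊆ Γ.ΓD := by
        intro h
        exact Set.disjoint_left.1 Γ.disjoint (h hx) (hN hx)
      have h2 := hJ t ht p hp q hq hpq hD x hx
      rw [polyJump_curlPoly] at h2
      rcases edge_cases ht hpq hp hq with h | h
      · rw [h.2, Finset.sum_singleton, neg_eq_zero] at h2
        exact (mul_eq_zero.1 h2).resolve_left (side_ne_zero ht hp hq hpq)
      · exact absurd h.1 (hint p q (Or.inr hN))
  · rintro ⟨h1, h2⟩ t ht p hp q hq hpq hD x hx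
    rw [polyJump_curlPoly, neg_eq_zero]
    rcases edge_cases ht hpq hp hq with h | ⟨-, s, hs, hts, hps, hqs, hside, hfil⟩
    · have hN := (openSegment_subset_or ht hpq hp hq h.1).resolve_left hD
      rw [h.2, Finset.sum_singleton,
        (tangential_eq_zero_iff _ p q).2 (h2 t ht p q hpq hp hq hN) x hx, mul_zero]
    · have h3 := (tangential_eq_zero_iff (g t - g s) p q).2 (by
        simpa using h1 t ht s hs p q hpq hp hq hps hqs) x hx
      rw [hsub] at h3
      rw [hfil, Finset.sum_pair hts, hside]
      linear_combination side t p q * h3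

/-- Symmetric piecewise polynomial matrix fields without normal jumps belong to `Σ_h`. -/
lemma Triangulation.mem_discreteStress_of {τ : L2Mat Ω.carrier}
    {P : Fin 2 → Finset Plane → Fin 2 → MvPolynomial (Fin 2) ℝ} (hs : τ.IsSymm)
    (hP : ∀ i j, 𝒯.HasPieces (τ i j) (fun t => P i t j))
    (hdeg : ∀ i j, ∀ t ∈ 𝒯.tri, (P i t j).totalDegree ≤ r + 3) (hJ : ∀ i, 𝒯.JumpFree (P i)) :
    τ ∈ discreteStress 𝒯 r := by
  choose g hg using fun i => 𝒯.exists_hasPieces (fun t => divPoly (P i t))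
  refine ⟨⟨hs, g, fun i φ hφ h => ?_, fun i φ hφ h => ?_⟩,
    fun i j => (hP i j).isPiecewisePoly (hdeg i j)⟩
  · exact (hJ i).green_eq_zero (hP i) (hg i) hφ (IsTest.eq_zero_of_tsupport_subset h)
  · exact (hJ i).green_eq_zero (hP i) (hg i) hφ (IsTest.eq_zero_of_disjoint h)

lemma Triangulation.jumpFree_of_mem {τ : L2Mat Ω.carrier} (hτ : τ ∈ discreteStress 𝒯 r)
    {P : Fin 2 → Finset Plane → Fin 2 → MvPolynomial (Fin 2) ℝ}
    (hP : ∀ i j, 𝒯.HasPieces (τ i j) (fun t => P i t j)) (i : Fin 2) : 𝒯.JumpFree (P i) := by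
  obtain ⟨⟨-, g, hg, hn⟩, -⟩ := hτ
  exact jumpFree_of_green (hP i) (hasPieces_weakDiv (hP i) hg) (hg i) (hn i)

/-- The divergence of a stress in `Σ_h` is its piecewise divergence. -/
lemma Triangulation.hasPieces_discreteDiv (τ : discreteStress 𝒯 r)
    {P : Fin 2 → Finset Plane → Fin 2 → MvPolynomial (Fin 2) ℝ}
    (hP : ∀ i j, 𝒯.HasPieces ((τ : L2Mat Ω.carrier) i j) (fun t => P i t j)) (i : Fin 2) :
    𝒯.HasPieces (discreteDiv 𝒯 r τ i) (fun t => divPoly (P i t)) :=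
  hasPieces_weakDiv (hP i) (weakDiv_spec Ω (Submodule.inclusion (discreteStress_le_Hdiv 𝒯 r) τ))

lemma Triangulation.exists_pieces_stress (τ : discreteStress 𝒯 r) :
    ∃ P : Fin 2 → Finset Plane → Fin 2 → MvPolynomial (Fin 2) ℝ,
      (∀ i j, 𝒯.HasPieces ((τ : L2Mat Ω.carrier) i j) (fun t => P i t j)) ∧
      ∀ i t j, (P i t j).totalDegree ≤ r + 3 := by
  choose P h1 h2 using fun i j => (τ.2.2 i j).exists_pieces
  exact ⟨fun i t j => P i j t, h1, fun i t j => h2 i j t⟩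

end Triangulation

/-! ### Exactness at the stress space -/

section Triangulation

variable {Ω : PolygonalDomain} {Γ : BoundaryParts Ω} {𝒯 : Triangulation Ω Γ} {r : ℕ}

/-- Piecewise polynomials with constant jumps across the edges can be made continuous by adding
piecewise constants. -/
lemma Triangulation.exists_constants_of_edges (𝒯 : Triangulation Ω Γ)
    (g : Finset Plane → MvPolynomial (Fin 2) ℝ)
    (h : ∀ t ∈ 𝒯.tri, ∀ t' ∈ 𝒯.tri, ∀ p q, p ≠ q → p ∈ t → q ∈ t → p ∈ t' → q ∈ t' →
        ∀ x ∈ segment ℝ p q,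
          polyEval (g t) x - polyEval (g t') x = polyEval (g t) p - polyEval (g t') p) :
    ∃ c : Finset Plane → ℝ, ∀ t ∈ 𝒯.tri, ∀ t' ∈ 𝒯.tri, ∀ x ∈ convexHull ℝ (t : Set Plane),
      x ∈ convexHull ℝ (t' : Set Plane) →
        polyEval (g t + MvPolynomial.C (c t)) x = polyEval (g t' + MvPolynomial.C (c t')) x := by
  simp only [polyEval_add, polyEval_C]
  refine 𝒯.exists_constants (fun t => polyEval (g t)) fun t ht t' ht' x hx hx' y hy hy' => ?_
  rcases eq_or_ne t t' with rfl | hne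
  · simp
  by_cases hs : ((t ∩ t' : Finset Plane) : Set Plane).Subsingleton
  · have hcap := 𝒯.complex.convexHull_inter_convexHull (mem_tri.1 ht).1 (mem_tri.1 ht').1
    rw [← Finset.coe_inter] at hcap
    have hx0 : x ∈ convexHull ℝ ((t ∩ t' : Finset Plane) : Set Plane) := hcap ▸ ⟨hx, hx'⟩
    have hy0 : y ∈ convexHull ℝ ((t ∩ t' : Finset Plane) : Set Plane) := hcap ▸ ⟨hy, hy'⟩
    rcases hs.eq_empty_or_singleton with he | ⟨a, ha⟩
    · rw [he, convexHull_empty] at hx0; exact hx0.elim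
    · rw [ha, convexHull_singleton, mem_singleton_iff] at hx0 hy0
      rw [hx0, hy0]
  · rw [Set.not_subsingleton_iff] at hs
    obtain ⟨p, hp, q, hq, hpq⟩ := hs
    rw [Finset.mem_coe, Finset.mem_inter] at hp hq
    have hcap := inter_eq_segment ht ht' hne hpq hp.1 hq.1 hp.2 hq.2
    have hx0 : x ∈ segment ℝ p q := hcap ▸ ⟨hx, hx'⟩
    have hy0 : y ∈ segment ℝ p q := hcap ▸ ⟨hy, hy'⟩
    rw [h t ht t' ht' p q hpq hp.1 hq.1 hp.2 hq.2 x hx0,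
      h t ht t' ht' p q hpq hp.1 hq.1 hp.2 hq.2 y hy0]

/-- Derivatives within the closed domain can be computed on each closed triangle. -/
lemma Triangulation.curlWithin_eq {w : Plane → ℝ} (hw : ContDiffOn ℝ 1 w (closure Ω.carrier))
    {p : MvPolynomial (Fin 2) ℝ} {t : Finset Plane} (ht : t ∈ 𝒯.tri)
    (hp : ∀ x ∈ convexHull ℝ (t : Set Plane), w x = polyEval p x) {x : Plane}
    (hx : x ∈ convexHull ℝ (t : Set Plane)) (i : Fin 2) :
    curlWithin (closure Ω.carrier) w x i = polyEval (curlPoly p i) x := by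
  have hd : fderivWithin ℝ w (closure Ω.carrier) x = fderiv ℝ (polyEval p) x := by
    have h1 := ((hw.differentiableOn (by simp) x (tri_subset ht hx)).hasFDerivWithinAt).mono
      (tri_subset ht)
    have h2 : HasFDerivWithinAt w (fderiv ℝ (polyEval p) x) (convexHull ℝ (t : Set Plane)) x :=
      (differentiable_polyEval p x).hasFDerivAt.hasFDerivWithinAt.congr hp (hp x hx)
    exact (uniqueDiffOn_convex (convex_convexHull ℝ (t : Set Plane))
      (interior_tri_nonempty ht) x hx).eq h1 h2
  rw [← curl_polyEval]
  simp only [curlWithin, hd, curl, pd]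

lemma MemW.exists_pieces {w : Plane → ℝ} (hw : MemW 𝒯 r w) :
    ∃ p : Finset Plane → MvPolynomial (Fin 2) ℝ, (∀ t ∈ 𝒯.tri, (p t).totalDegree ≤ r + 5) ∧
      ∀ t ∈ 𝒯.tri, ∀ x ∈ convexHull ℝ (t : Set Plane), w x = polyEval (p t) x := by
  have : ∀ t : Finset Plane, ∃ p : MvPolynomial (Fin 2) ℝ, t ∈ 𝒯.tri → p.totalDegree ≤ r + 5 ∧
      ∀ x ∈ convexHull ℝ (t : Set Plane), w x = polyEval p x := by
    intro t
    by_cases ht : t ∈ 𝒯.tri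
    · obtain ⟨p, hp⟩ := hw.poly _ (Triangulation.mem_triangles_of_tri ht)
      exact ⟨p, fun _ => hp⟩
    · exact ⟨0, fun h => absurd h ht⟩
  choose p hp using this
  exact ⟨p, fun t ht => (hp t ht).1, fun t ht => (hp t ht).2⟩

lemma hasPieces_airy (w : discreteAiry 𝒯 r) {p : Finset Plane → MvPolynomial (Fin 2) ℝ}
    (hp : ∀ t ∈ 𝒯.tri, ∀ x ∈ convexHull ℝ (t : Set Plane), (w : Plane → ℝ) x = polyEval (p t) x)
    (i j : Fin 2) :
    𝒯.HasPieces (airy 𝒯 r w i j) (fun t => curlPoly (curlPoly (p t) i) j) := by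
  intro t ht
  filter_upwards [(MemW.memLp w.2 i j).coeFn_toLp, 𝒯.ae_mem_interior] with x hx ⟨t', ht', hxt'⟩ hxt
  obtain rfl := Triangulation.eq_of_mem_interior ht ht' hxt hxt'
  have h1 : airy 𝒯 r w i j x = airyFun w x i j := hx
  rw [h1, ← airyFun_polyEval]
  exact airyFun_eqOn isOpen_interior (fun y hy => hp t ht y (interior_subset hy)) i j hxt'

/-- `J W_h ⊆ Σ_h`: since `w ∈ W_h` is `C¹`, the rows of `J w` are curls of continuous functions that
are constant along the Neumann edges, so they have no normal jumps. -/
theorem airy_mem_discreteStress (w : discreteAiry 𝒯 r) : airy 𝒯 r w ∈ discreteStress 𝒯 r := by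
  have hw : MemW 𝒯 r w := w.2
  obtain ⟨p, hdeg, hp⟩ := hw.exists_pieces
  have hcw := fun t ht x hx i =>
    Triangulation.curlWithin_eq (t := t) hw.contDiffOn ht (hp t ht) (x := x) hx i
  refine Triangulation.mem_discreteStress_of (P := fun i t => curlPoly (curlPoly (p t) i))
    ?_ (hasPieces_airy w hp) (fun i j t ht => totalDegree_curlPoly_le
      (totalDegree_curlPoly_le (hdeg t ht) i) j) fun i =>
      (Triangulation.jumpFree_curlPoly_iff _).2 ⟨?_, ?_⟩
  · refine Matrix.IsSymm.ext fun i j => ?_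
    refine Triangulation.ext_pieces (hasPieces_airy w hp j i) ?_
    exact (hasPieces_airy w hp i j).congr fun t _ => curlPoly_curlPoly_symm _ _ _
  · intro t ht t' ht' a b hab ha hb ha' hb' x hx
    have h := fun y (hy : y ∈ segment ℝ a b) =>
      (hcw t ht y (Triangulation.segment_subset_tri ha hb hy) i).symm.trans
        (hcw t' ht' y (Triangulation.segment_subset_tri ha' hb' hy) i)
    rw [h x hx, h a (left_mem_segment ℝ a b), sub_self, sub_self]
  · intro t ht a b hab ha hb hN
    have hm := lineMap_mem_openSegment a b (s := 1 / 2) (by norm_num) (by norm_num)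
    obtain ⟨c, hc⟩ := hw.curl_const _ (hN hm)
    have hsub := (convex_openSegment a b).isPreconnected.subset_connectedComponentIn hm hN
    have h1 : ∀ x ∈ segment ℝ a b, polyEval (curlPoly (p t) i) x = c i := by
      refine eqOn_segment_of_eqOn_openSegment (continuous_polyEval _) continuous_const fun x hx => ?_
      rw [← hcw t ht x (Triangulation.segment_subset_tri ha hb (openSegment_subset_segment _ _ _ hx))
        i, hc x (hsub hx)]
    intro x hx
    rw [h1 x hx, h1 a (left_mem_segment ℝ a b)]

lemma discreteDiv_airy (w : discreteAiry 𝒯 r) :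
    discreteDiv 𝒯 r ⟨airy 𝒯 r w, airy_mem_discreteStress w⟩ = 0 := by
  obtain ⟨p, -, hp⟩ := MemW.exists_pieces w.2
  ext1 i
  have h := Triangulation.hasPieces_discreteDiv (𝒯 := 𝒯)
    ⟨airy 𝒯 r w, airy_mem_discreteStress w⟩ (P := fun i t => curlPoly (curlPoly (p t) i))
    (hasPieces_airy w hp) i
  refine Triangulation.ext_pieces h (fun t _ => ?_)
  filter_upwards [Lp.coeFn_zero ℝ 2 (volume.restrict Ω.carrier)] with x hx _
  rw [divPoly_curlPoly, polyEval_zero]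
  exact hx

/-- Piecewise polynomials that agree on the intersections of the triangles together with their first
derivatives form a `C¹` function on the closed domain. -/
theorem Triangulation.exists_contDiffOn (𝒯 : Triangulation Ω Γ)
    {W : Finset Plane → MvPolynomial (Fin 2) ℝ}
    (h0 : ∀ t ∈ 𝒯.tri, ∀ t' ∈ 𝒯.tri, ∀ x ∈ convexHull ℝ (t : Set Plane),
      x ∈ convexHull ℝ (t' : Set Plane) → polyEval (W t) x = polyEval (W t') x)
    (h1 : ∀ j, ∀ t ∈ 𝒯.tri, ∀ t' ∈ 𝒯.tri, ∀ x ∈ convexHull ℝ (t : Set Plane),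
      x ∈ convexHull ℝ (t' : Set Plane) →
        polyEval (curlPoly (W t) j) x = polyEval (curlPoly (W t') j) x) :
    ∃ w : Plane → ℝ, (∀ x ∉ closure Ω.carrier, w x = 0) ∧
      ContDiffOn ℝ 1 w (closure Ω.carrier) ∧
      ∀ t ∈ 𝒯.tri, ∀ x ∈ convexHull ℝ (t : Set Plane), w x = polyEval (W t) x := by
  classical
  obtain ⟨tr, -, htr, -⟩ := 𝒯.exists_tri_choice
  let w : Plane → ℝ := fun x => if x ∈ closure Ω.carrier then polyEval (W (tr x)) x else 0
  let F : Plane → Plane →L[ℝ] ℝ := fun x => fderiv ℝ (polyEval (W (tr x))) x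
  have hw : ∀ t ∈ 𝒯.tri, ∀ x ∈ convexHull ℝ (t : Set Plane), w x = polyEval (W t) x := by
    intro t ht x hx
    have hxΩ := tri_subset ht hx
    simp only [w, if_pos hxΩ]
    exact h0 _ (htr x hxΩ).1 t ht x (htr x hxΩ).2 hx
  have hF : ∀ t ∈ 𝒯.tri, ∀ x ∈ convexHull ℝ (t : Set Plane),
      F x = fderiv ℝ (polyEval (W t)) x := by
    intro t ht x hx
    have hxΩ := tri_subset ht hx
    have e := fun j => h1 j _ (htr x hxΩ).1 t ht x (htr x hxΩ).2 hx
    have e0 := e 0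
    have e1 := e 1
    simp only [curlPoly, Matrix.cons_val_zero, Matrix.cons_val_one, polyEval_neg, neg_inj] at e0 e1
    ext v
    simp only [F, fderiv_apply_eq_pd, pd_polyEval, e0, e1]
  have hcover : closure Ω.carrier = ⋃ t : 𝒯.tri, convexHull ℝ ((t : Finset Plane) : Set Plane) := by
    refine subset_antisymm (fun x hx => ?_) (iUnion_subset fun t => tri_subset t.2)
    obtain ⟨t, ht, hxt⟩ := exists_tri (𝒯 := 𝒯) hx
    exact mem_iUnion.2 ⟨⟨t, ht⟩, hxt⟩
  refine ⟨w, fun x hx => if_neg hx, ?_, hw⟩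
  rw [← zero_add (1 : WithTop ℕ∞),
    contDiffOn_succ_iff_hasFDerivWithinAt_of_uniqueDiffOn 𝒯.uniqueDiffOn]
  refine ⟨by simp, F, ?_, fun x _ => ?_⟩
  · rw [contDiffOn_zero, hcover]
    refine (locallyFinite_of_finite _).continuousOn_iUnion (fun t => isClosed_tri _) fun t => ?_
    exact (((contDiff_polyEval (W t)).continuous_fderiv (by simp)).continuousOn).congr (hF t t.2)
  · have key : ∀ S ⊆ 𝒯.tri,
        HasFDerivWithinAt w (F x) (⋃ t ∈ S, convexHull ℝ (t : Set Plane)) x := by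
      intro S
      induction S using Finset.induction_on with
      | empty =>
        intro _
        exact HasFDerivWithinAt.of_notMem_closure (by simp)
      | insert t S _ ih =>
        intro hS
        rw [Finset.set_biUnion_insert]
        refine HasFDerivWithinAt.union ?_ (ih ((Finset.subset_insert _ _).trans hS))
        have ht := hS (Finset.mem_insert_self t S)
        by_cases hx : x ∈ convexHull ℝ (t : Set Plane)
        · rw [hF t ht x hx]
          exact (differentiable_polyEval _ x).hasFDerivAt.hasFDerivWithinAt.congr (hw t ht)
            (hw t ht x hx)
        · exact HasFDerivWithinAt.of_notMem_closure (by rwa [(isClosed_tri t).closure_eq])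
    rw [hcover]
    have := key 𝒯.tri subset_rfl
    rwa [← iUnion_subtype (fun t => t ∈ 𝒯.tri)
      (fun t => convexHull ℝ ((t : Finset Plane) : Set Plane))] at this

/-- Continuous piecewise polynomials that are constant along the Neumann edges are constant on the
connected components of the Neumann boundary. -/
lemma Triangulation.eq_on_connectedComponentIn {α : Type*} (𝒯 : Triangulation Ω Γ)
    (g : Plane → α)
    (hg : ∀ t ∈ 𝒯.tri, ∀ p q, p ≠ q → p ∈ t → q ∈ t → openSegment ℝ p q ⊆ Γ.ΓN →
      ∀ x ∈ segment ℝ p q, g x = g p) {x y : Plane} (hx : x ∈ Γ.ΓN)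
    (hy : y ∈ connectedComponentIn Γ.ΓN x) : g y = g x := by
  refine eq_of_eventually_eq (isPreconnected_connectedComponentIn (F := Γ.ΓN) (x := x))
    (fun y hy => ?_) hy (mem_connectedComponentIn hx)
  filter_upwards [mem_nhdsWithin_of_mem_nhds (𝒯.eventually_star y),
    mem_nhdsWithin_of_mem_nhds (𝒯.eventually_notMem_verts y), self_mem_nhdsWithin] with z h1 h2 hz
  rcases eq_or_ne z y with rfl | hne
  · rfl
  have hzN := connectedComponentIn_subset _ _ hz
  obtain ⟨t, ht, p, q, hpq, hp, hq, hzs, hf, -⟩ :=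
    exists_boundary_edge (𝒯 := 𝒯) (Γ.ΓN_subset hzN) (h2 hne)
  have hN : openSegment ℝ p q ⊆ Γ.ΓN := (openSegment_subset_or ht hpq hp hq hf).resolve_left
    fun h => Set.disjoint_left.1 Γ.disjoint (h hzs) hzN
  have hys : y ∈ segment ℝ p q := by
    have := h1 {p, q} (mem_faces_pair ht hp hq)
      (by simpa using openSegment_subset_segment _ _ _ hzs)
    simpa using this
  rw [hg t ht p q hpq hp hq hN z (openSegment_subset_segment _ _ _ hzs),
    hg t ht p q hpq hp hq hN y hys]

lemma Triangulation.JumpFree.congr {P Q : Finset Plane → Fin 2 → MvPolynomial (Fin 2) ℝ}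
    (hP : 𝒯.JumpFree P) (h : ∀ t ∈ 𝒯.tri, P t = Q t) : 𝒯.JumpFree Q := by
  intro t ht p hp q hq hpq hD x hx
  rw [← hP t ht p hp q hq hpq hD x hx]
  refine Finset.sum_congr rfl fun s hs => ?_
  simp only [h s (Finset.mem_filter.1 hs).1]

lemma curlPoly_add_C (p : MvPolynomial (Fin 2) ℝ) (c : ℝ) :
    curlPoly (p + MvPolynomial.C c) = curlPoly p := by
  simp [curlPoly]

lemma totalDegree_add_C_le {p : MvPolynomial (Fin 2) ℝ} {k : ℕ} (hp : p.totalDegree ≤ k) (c : ℝ) :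
    (p + MvPolynomial.C c).totalDegree ≤ k :=
  (MvPolynomial.totalDegree_add _ _).trans (max_le hp (by simp))

/-- A divergence-free piecewise polynomial field without normal jumps is the curl of a continuous
piecewise polynomial that is constant along the Neumann edges. -/
lemma Triangulation.JumpFree.exists_potential
    {P : Finset Plane → Fin 2 → MvPolynomial (Fin 2) ℝ} (hJ : 𝒯.JumpFree P)
    (h0 : ∀ t ∈ 𝒯.tri, divPoly (P t) = 0) {k : ℕ} (hdeg : ∀ t j, (P t j).totalDegree ≤ k) :
    ∃ g : Finset Plane → MvPolynomial (Fin 2) ℝ, (∀ t, (g t).totalDegree ≤ k + 1) ∧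
      (∀ t ∈ 𝒯.tri, curlPoly (g t) = P t) ∧
      (∀ t ∈ 𝒯.tri, ∀ t' ∈ 𝒯.tri, ∀ x ∈ convexHull ℝ (t : Set Plane),
        x ∈ convexHull ℝ (t' : Set Plane) → polyEval (g t) x = polyEval (g t') x) ∧
      ∀ t ∈ 𝒯.tri, ∀ p q, p ≠ q → p ∈ t → q ∈ t → openSegment ℝ p q ⊆ Γ.ΓN →
        ∀ x ∈ segment ℝ p q, polyEval (g t) x = polyEval (g t) p := by
  have h1 : ∀ t, ∃ g : MvPolynomial (Fin 2) ℝ, g.totalDegree ≤ k + 1 ∧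
      (t ∈ 𝒯.tri → curlPoly g = P t) := by
    intro t
    by_cases ht : t ∈ 𝒯.tri
    · obtain ⟨g, hg, he⟩ := exists_curlPoly_eq (h0 t ht) (hdeg t)
      exact ⟨g, hg, fun _ => he⟩
    · exact ⟨0, by simp, fun h => absurd h ht⟩
  choose g hg hge using h1
  obtain ⟨h2, h3⟩ := (jumpFree_curlPoly_iff g).1 (hJ.congr fun t ht => (hge t ht).symm)
  obtain ⟨c, hc⟩ := 𝒯.exists_constants_of_edges g h2
  refine ⟨fun t => g t + MvPolynomial.C (c t), fun t => totalDegree_add_C_le (hg t) _,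
    fun t ht => by rw [curlPoly_add_C, hge t ht], hc, fun t ht p q hpq hp hq hN x hx => ?_⟩
  simp only [polyEval_add, polyEval_C]
  rw [h3 t ht p q hpq hp hq hN x hx]

/-- A divergence-free stress in `Σ_h` is the Airy stress of a function in `W_h`. Both the rows of the
stress and, by symmetry of the stress, the vector field formed by their potentials are
divergence-free, so potentials can be taken twice. -/
theorem exists_airy_eq (τ : discreteStress 𝒯 r) (hτ : discreteDiv 𝒯 r τ = 0) :
    ∃ w : discreteAiry 𝒯 r, airy 𝒯 r w = τ := by
  obtain ⟨P, hP, hdeg⟩ := Triangulation.exists_pieces_stress τ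
  have hzero : 𝒯.HasPieces (0 : L2 Ω.carrier) 0 := by
    intro t _
    filter_upwards [Lp.coeFn_zero ℝ 2 (volume.restrict Ω.carrier)] with x hx _
    rw [hx]; simp
  have hdiv : ∀ i, ∀ t ∈ 𝒯.tri, divPoly (P i t) = 0 := by
    intro i t ht
    have h := Triangulation.hasPieces_discreteDiv τ hP i
    rw [hτ] at h
    exact h.unique hzero ht
  have hsymm : ∀ t ∈ 𝒯.tri, P 0 t 1 = P 1 t 0 := by
    intro t ht
    have h := hP 0 1
    rw [← τ.2.1.1.apply 0 1] at h
    exact h.unique (hP 1 0) ht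
  choose g hgdeg hgcurl hgcont hgN using fun i =>
    (Triangulation.jumpFree_of_mem τ.2 hP i).exists_potential (hdiv i) (hdeg i)
  -- the potentials of the rows form a divergence-free field
  have hgdiv : ∀ t ∈ 𝒯.tri, divPoly (fun i => g i t) = 0 := by
    intro t ht
    have e0 := congrFun (hgcurl 0 t ht) 1
    have e1 := congrFun (hgcurl 1 t ht) 0
    simp only [curlPoly, Matrix.cons_val_zero, Matrix.cons_val_one] at e0 e1
    rw [divPoly, e0, hsymm t ht, ← e1]
    ring
  have h1 : ∀ t, ∃ w : MvPolynomial (Fin 2) ℝ, w.totalDegree ≤ r + 5 ∧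
      (t ∈ 𝒯.tri → curlPoly w = fun i => g i t) := by
    intro t
    by_cases ht : t ∈ 𝒯.tri
    · obtain ⟨w, hw, he⟩ := exists_curlPoly_eq (hgdiv t ht) fun i => hgdeg i t
      exact ⟨w, hw, fun _ => he⟩
    · exact ⟨0, by simp, fun h => absurd h ht⟩
  choose w hwdeg hwcurl using h1
  obtain ⟨c, hc⟩ := 𝒯.exists_constants_of_edges w (by
    intro t ht t' ht' p q hpq hp hq hp' hq'
    have h2 := (tangential_eq_zero_iff (w t - w t') p q).1 fun x hx => by
      have hx' := openSegment_subset_segment _ _ _ hx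
      have e := fun i => hgcont i t ht t' ht' x (Triangulation.segment_subset_tri hp hq hx')
        (Triangulation.segment_subset_tri hp' hq' hx')
      have e0 := e 0
      have e1 := e 1
      rw [← congrFun (hwcurl t ht) 0, ← congrFun (hwcurl t' ht') 0] at e0
      rw [← congrFun (hwcurl t ht) 1, ← congrFun (hwcurl t' ht') 1] at e1
      simp only [curlPoly, Matrix.cons_val_zero, Matrix.cons_val_one, polyEval_neg, neg_inj]
        at e0 e1
      simp [fderiv_apply_eq_pd, pd_polyEval, e0, e1]
    simpa using h2)
  have hWcurl : ∀ t ∈ 𝒯.tri, ∀ i, curlPoly (w t + MvPolynomial.C (c t)) i = g i t := by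
    intro t ht i
    rw [curlPoly_add_C, hwcurl t ht]
  obtain ⟨u, hu0, hu1, hu⟩ := 𝒯.exists_contDiffOn hc (fun j t ht t' ht' x hx hx' => by
    rw [hWcurl t ht, hWcurl t' ht']
    exact hgcont j t ht t' ht' x hx hx')
  have hmem : MemW 𝒯 r u := by
    refine ⟨hu0, hu1, ?_, fun x hx => ⟨_, fun y hy => 𝒯.eq_on_connectedComponentIn _ ?_ hx hy⟩⟩
    · rintro T ⟨t, ht, hcard, rfl⟩
      have ht' : t ∈ 𝒯.tri := Triangulation.mem_tri.2 ⟨ht, hcard⟩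
      exact ⟨_, totalDegree_add_C_le (hwdeg t) _, hu t ht'⟩
    · intro t ht p q hpq hp hq hN x hx
      ext1 i
      have hp' := Triangulation.segment_subset_tri hp hq (left_mem_segment ℝ p q)
      have hx' := Triangulation.segment_subset_tri hp hq hx
      rw [Triangulation.curlWithin_eq hu1 ht (hu t ht) hx',
        Triangulation.curlWithin_eq hu1 ht (hu t ht) hp', hWcurl t ht,
        hgN i t ht p q hpq hp hq hN x hx]
  refine ⟨⟨u, hmem⟩, Matrix.ext fun i j => ?_⟩
  refine Triangulation.ext_pieces (hasPieces_airy ⟨u, hmem⟩ hu i j) ((hP i j).congr ?_)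
  intro t ht
  rw [hWcurl t ht, hgcurl i t ht]

end Triangulation

/-! ### The divergence maps into the displacement space -/

section Triangulation

variable {Ω : PolygonalDomain} {Γ : BoundaryParts Ω} {𝒯 : Triangulation Ω Γ} {r : ℕ}

lemma integrableOn_polyEval (p : MvPolynomial (Fin 2) ℝ) (t : Finset Plane) :
    IntegrableOn (polyEval p) (convexHull ℝ (t : Set Plane)) :=
  (continuous_polyEval p).continuousOn.integrableOn_compact (t.finite_toSet.isCompact_convexHull ℝ)

lemma integral_polyEval_add (p q : MvPolynomial (Fin 2) ℝ) (t : Finset Plane) :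
    ∫ x in convexHull ℝ (t : Set Plane), polyEval (p + q) x =
      (∫ x in convexHull ℝ (t : Set Plane), polyEval p x) +
        ∫ x in convexHull ℝ (t : Set Plane), polyEval q x := by
  rw [← integral_add (integrableOn_polyEval p t) (integrableOn_polyEval q t)]
  simp only [polyEval_add]

lemma Triangulation.HasPieces.pairing_eq {f : L2 Ω.carrier}
    {A : Finset Plane → MvPolynomial (Fin 2) ℝ} (hf : 𝒯.HasPieces f A)
    (p : MvPolynomial (Fin 2) ℝ) : pairing f (polyEval p) =
      ∑ t ∈ 𝒯.tri, ∫ x in convexHull ℝ (t : Set Plane), polyEval (p * A t) x := by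
  refine integral_eq_sum (fun t => continuous_polyEval _) fun t ht => ?_
  filter_upwards [hf t ht] with x hx hxt
  rw [hx hxt, polyEval_mul, mul_comm]

lemma Triangulation.HasPieces.inner_eq {f g : L2 Ω.carrier}
    {A B : Finset Plane → MvPolynomial (Fin 2) ℝ} (hf : 𝒯.HasPieces f A) (hg : 𝒯.HasPieces g B) :
    inner ℝ f g = ∑ t ∈ 𝒯.tri, ∫ x in convexHull ℝ (t : Set Plane), polyEval (A t * B t) x := by
  rw [L2.inner_def]
  refine integral_eq_sum (fun t => continuous_polyEval _) fun t ht => ?_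
  filter_upwards [hf t ht, hg t ht] with x hx hx' hxt
  rw [hx hxt, hx' hxt, polyEval_mul]
  simp [mul_comm]

lemma Triangulation.innerVec_eq {v w : L2Vec Ω.carrier}
    {V W : Fin 2 → Finset Plane → MvPolynomial (Fin 2) ℝ} (hv : ∀ i, 𝒯.HasPieces (v i) (V i))
    (hw : ∀ i, 𝒯.HasPieces (w i) (W i)) :
    innerVec v w = ∑ t ∈ 𝒯.tri, ∫ x in convexHull ℝ (t : Set Plane),
      polyEval (V 0 t * W 0 t + V 1 t * W 1 t) x := by
  rw [innerVec, Fin.sum_univ_two, (hv 0).inner_eq (hw 0), (hv 1).inner_eq (hw 1),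
    ← Finset.sum_add_distrib]
  simp only [integral_polyEval_add]

/-- Integration by parts for a piecewise polynomial vector field `V` and a piecewise polynomial
matrix field `P`. -/
theorem Triangulation.sum_integral_div_add_grad (𝒯 : Triangulation Ω Γ)
    (V : Fin 2 → Finset Plane → MvPolynomial (Fin 2) ℝ)
    (P : Fin 2 → Finset Plane → Fin 2 → MvPolynomial (Fin 2) ℝ) :
    2 * (∑ t ∈ 𝒯.tri, (∫ x in convexHull ℝ (t : Set Plane),
        polyEval (V 0 t * divPoly (P 0 t) + V 1 t * divPoly (P 1 t)) x) +
      ∑ t ∈ 𝒯.tri, ∫ x in convexHull ℝ (t : Set Plane),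
        polyEval (∑ i, ∑ j, MvPolynomial.pderiv j (V i t) * P i t j) x) =
      ∑ p ∈ 𝒯.verts, ∑ q ∈ 𝒯.verts, ∫ s in (0 : ℝ)..1,
        𝒯.polyJump (fun t j => ∑ i, V i t * P i t j) p q (AffineMap.lineMap p q s) := by
  have h := sum_integral_divergence (𝒯 := 𝒯)
    (F := fun t j => polyEval (∑ i, V i t * P i t j))
    (fun t j => (contDiff_polyEval _).of_le (by simp))
  refine Eq.trans ?_ h
  rw [← Finset.sum_add_distrib]
  congr 1
  refine Finset.sum_congr rfl fun t _ => ?_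
  rw [← integral_polyEval_add]
  refine integral_congr_ae (Eventually.of_forall fun x => ?_)
  simp only [pd_polyEval]
  rw [← polyEval_add]
  congr 1
  simp only [Fin.sum_univ_two, divPoly, map_add, Derivation.leibniz, smul_eq_mul]
  ring

/-- Rigid motions as polynomial vector fields. -/
noncomputable def rigidPoly (c₁ c₂ c₃ : ℝ) : Fin 2 → MvPolynomial (Fin 2) ℝ :=
  ![MvPolynomial.C c₁ - MvPolynomial.C c₃ * MvPolynomial.X 1,
    MvPolynomial.C c₂ + MvPolynomial.C c₃ * MvPolynomial.X 0]

lemma polyEval_rigidPoly (c₁ c₂ c₃ : ℝ) (i : Fin 2) :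
    polyEval (rigidPoly c₁ c₂ c₃ i) = fun x => rigidMotion c₁ c₂ c₃ x i := by
  ext x
  fin_cases i <;> simp [rigidPoly, rigidMotion]

/-- `div Σ_h ⊆ U_h`. In the pure traction case, the divergence is orthogonal to the rigid motions
because the symmetric gradient of these vanishes. -/
theorem discreteDiv_mem (τ : discreteStress 𝒯 r) :
    discreteDiv 𝒯 r τ ∈ discreteDisplacement 𝒯 r := by
  obtain ⟨P, hP, hdeg⟩ := Triangulation.exists_pieces_stress τ
  have hdiv := Triangulation.hasPieces_discreteDiv τ hP
  refine ⟨fun i => (hdiv i).isPiecewisePoly fun t _ => ?_, fun hD c₁ c₂ c₃ => ?_⟩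
  · exact (MvPolynomial.totalDegree_add _ _).trans (max_le
      (totalDegree_pderiv_le (hdeg i t 0) 0) (totalDegree_pderiv_le (hdeg i t 1) 1))
  · have h := 𝒯.sum_integral_div_add_grad (fun i _ => rigidPoly c₁ c₂ c₃ i) P
    have h1 : ∑ p ∈ 𝒯.verts, ∑ q ∈ 𝒯.verts, ∫ s in (0 : ℝ)..1,
        𝒯.polyJump (fun t j => ∑ i, rigidPoly c₁ c₂ c₃ i * P i t j) p q
          (AffineMap.lineMap p q s) = 0 := by
      refine Finset.sum_eq_zero fun p _ => Finset.sum_eq_zero fun q _ => ?_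
      have hae : ∀ᵐ s : ℝ, s ≠ 1 := by
        rw [ae_iff]; simp
      refine intervalIntegral.integral_zero_ae ?_
      filter_upwards [hae] with s hs1 hs
      rw [uIoc_of_le zero_le_one] at hs
      have hx := lineMap_mem_openSegment p q hs.1 (lt_of_le_of_ne hs.2 hs1)
      set x : Plane := AffineMap.lineMap p q s with hxdef
      have hsum : 𝒯.polyJump (fun t j => ∑ i, rigidPoly c₁ c₂ c₃ i * P i t j) p q x =
          polyEval (rigidPoly c₁ c₂ c₃ 0) x * 𝒯.polyJump (P 0) p q x +
          polyEval (rigidPoly c₁ c₂ c₃ 1) x * 𝒯.polyJump (P 1) p q x := by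
        simp only [Triangulation.polyJump, Triangulation.normalJump, Finset.mul_sum,
          ← Finset.sum_add_distrib]
        refine Finset.sum_congr rfl fun t _ => ?_
        simp only [Fin.sum_univ_two, polyEval_add, polyEval_mul]
        ring
      have hzero : ∀ i, 𝒯.polyJump (P i) p q x = 0 := by
        intro i
        rcases eq_or_ne p q with rfl | hpq
        · rw [Triangulation.polyJump, Triangulation.normalJump_self]
        rcases (𝒯.tri.filter (fun t => p ∈ t ∧ q ∈ t)).eq_empty_or_nonempty with he | ⟨t, ht⟩
        · rw [Triangulation.polyJump, Triangulation.normalJump, he]; simp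
        rw [Finset.mem_filter] at ht
        refine Triangulation.jumpFree_of_mem τ.2 hP i t ht.1 p ht.2.1 q ht.2.2 hpq ?_ x hx
        rw [hD]
        exact fun h => h hx
      rw [hsum, hzero, hzero]; simp
    rw [h1] at h
    have h2 : ∑ t ∈ 𝒯.tri, ∫ x in convexHull ℝ (t : Set Plane),
        polyEval (∑ i, ∑ j, MvPolynomial.pderiv j (rigidPoly c₁ c₂ c₃ i) * P i t j) x = 0 := by
      refine Finset.sum_eq_zero fun t ht => ?_
      have hs : P 0 t 1 = P 1 t 0 := by
        have h := hP 0 1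
        rw [← τ.2.1.1.apply 0 1] at h
        exact h.unique (hP 1 0) ht
      have : ∑ i, ∑ j, MvPolynomial.pderiv j (rigidPoly c₁ c₂ c₃ i) * P i t j = 0 := by
        simp [Fin.sum_univ_two, rigidPoly, hs, MvPolynomial.pderiv_X]
      rw [this]; simp
    rw [h2] at h
    rw [Fin.sum_univ_two, ← polyEval_rigidPoly, ← polyEval_rigidPoly, (hdiv 0).pairing_eq,
      (hdiv 1).pairing_eq, ← Finset.sum_add_distrib]
    simp only [← integral_polyEval_add]
    linarith

end Triangulation

/-! ### Edge bubbles -/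

/-- The affine function `orient p q` as a polynomial. -/
noncomputable def orientPoly (p q : Plane) : MvPolynomial (Fin 2) ℝ :=
  MvPolynomial.C (q 0 - p 0) * (MvPolynomial.X 1 - MvPolynomial.C (p 1)) -
    MvPolynomial.C (q 1 - p 1) * (MvPolynomial.X 0 - MvPolynomial.C (p 0))

lemma polyEval_orientPoly (p q x : Plane) : polyEval (orientPoly p q) x = orient p q x := by
  simp [orientPoly, orient]

lemma totalDegree_C_mul_le {p : MvPolynomial (Fin 2) ℝ} {k : ℕ} (c : ℝ) (hp : p.totalDegree ≤ k) :
    (MvPolynomial.C c * p).totalDegree ≤ k := by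
  refine (MvPolynomial.totalDegree_mul _ _).trans ?_
  simpa using hp

lemma totalDegree_sub_le {p q : MvPolynomial (Fin 2) ℝ} {k : ℕ} (hp : p.totalDegree ≤ k)
    (hq : q.totalDegree ≤ k) : (p - q).totalDegree ≤ k :=
  (MvPolynomial.totalDegree_sub _ _).trans (max_le hp hq)

lemma totalDegree_add_le {p q : MvPolynomial (Fin 2) ℝ} {k : ℕ} (hp : p.totalDegree ≤ k)
    (hq : q.totalDegree ≤ k) : (p + q).totalDegree ≤ k :=
  (MvPolynomial.totalDegree_add _ _).trans (max_le hp hq)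

lemma totalDegree_mul_le {p q : MvPolynomial (Fin 2) ℝ} {k l : ℕ} (hp : p.totalDegree ≤ k)
    (hq : q.totalDegree ≤ l) : (p * q).totalDegree ≤ k + l :=
  (MvPolynomial.totalDegree_mul _ _).trans (add_le_add hp hq)

lemma totalDegree_orientPoly_le (p q : Plane) : (orientPoly p q).totalDegree ≤ 1 :=
  totalDegree_sub_le
    (totalDegree_C_mul_le _ (totalDegree_sub_le (by simp [MvPolynomial.totalDegree_X]) (by simp)))
    (totalDegree_C_mul_le _ (totalDegree_sub_le (by simp [MvPolynomial.totalDegree_X]) (by simp)))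

section Triangulation

variable {Ω : PolygonalDomain} {Γ : BoundaryParts Ω} {𝒯 : Triangulation Ω Γ} {r : ℕ}

variable (𝒯) in
/-- The polynomials `b t` form a bubble of the edge `p q`: they vanish on the triangles that do not
contain this edge and on all other edges, are nonnegative, and are given on the edge `p q` by the
product of the barycentric coordinates. -/
structure Triangulation.IsEdgeBubble (p q : Plane) (b : Finset Plane → MvPolynomial (Fin 2) ℝ) :
    Prop where
  totalDegree_le : ∀ t, (b t).totalDegree ≤ 2
  eq_zero : ∀ t, ¬ (p ∈ t ∧ q ∈ t) → b t = 0
  apply_lineMap : ∀ t ∈ 𝒯.tri, p ∈ t → q ∈ t →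
    ∀ s, polyEval (b t) (AffineMap.lineMap p q s) = s * (1 - s)
  nonneg : ∀ t ∈ 𝒯.tri, p ∈ t → q ∈ t → ∀ x ∈ convexHull ℝ (t : Set Plane), 0 ≤ polyEval (b t) x
  vanish : ∀ t ∈ 𝒯.tri, p ∈ t → q ∈ t → ∀ p' ∈ t, ∀ q' ∈ t, p' ≠ q' →
    ({p', q'} : Set Plane) ≠ {p, q} → ∀ x ∈ segment ℝ p' q', polyEval (b t) x = 0

/-- Edge bubbles exist: take the product of the barycentric coordinates of `p` and `q`. -/
lemma Triangulation.exists_isEdgeBubble (𝒯 : Triangulation Ω Γ) {p q : Plane} (hpq : p ≠ q) :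
    ∃ b, 𝒯.IsEdgeBubble p q b := by
  classical
  have h : ∀ t : Finset Plane, ∃ b : MvPolynomial (Fin 2) ℝ, b.totalDegree ≤ 2 ∧
      (¬ (p ∈ t ∧ q ∈ t) → b = 0) ∧
      (t ∈ 𝒯.tri → p ∈ t → q ∈ t →
        (∀ s, polyEval b (AffineMap.lineMap p q s) = s * (1 - s)) ∧
        (∀ x ∈ convexHull ℝ (t : Set Plane), 0 ≤ polyEval b x) ∧
        ∀ p' ∈ t, ∀ q' ∈ t, p' ≠ q' → ({p', q'} : Set Plane) ≠ {p, q} →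
          ∀ x ∈ segment ℝ p' q', polyEval b x = 0) := by
    intro t
    by_cases ht : t ∈ 𝒯.tri ∧ p ∈ t ∧ q ∈ t
    · obtain ⟨ht, hp, hq⟩ := ht
      obtain ⟨c, hcp, hcq, htc, hD⟩ := exists_apex ht hp hq hpq
      have hev : ∀ x, polyEval (MvPolynomial.C (1 / orient p q c ^ 2) *
          (orientPoly q c * orientPoly c p)) x =
          (orient q c x / orient p q c) * (orient c p x / orient p q c) := by
        intro x
        rw [polyEval_mul, polyEval_C, polyEval_mul, polyEval_orientPoly, polyEval_orientPoly]
        field_simp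
      have e1 : orient q c p = orient p q c := orient_rotate p q c
      have e2 : orient c p q = orient p q c := by rw [orient_rotate, orient_rotate]
      refine ⟨MvPolynomial.C (1 / orient p q c ^ 2) *
        (orientPoly q c * orientPoly c p), totalDegree_C_mul_le _ (totalDegree_mul_le (totalDegree_orientPoly_le q c)
        (totalDegree_orientPoly_le c p)), fun h => absurd ⟨hp, hq⟩ h, fun _ _ _ =>
        ⟨fun s => ?_, fun x hx => ?_, fun p' hp' q' hq' hne' hne x hx => ?_⟩⟩
      · rw [hev, orient_lineMap, orient_lineMap, e1, e2]
        simp only [orient_self_left, orient_self_right]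
        field_simp
        ring
      · rw [htc] at hx
        simp only [Finset.coe_insert, Finset.coe_singleton] at hx
        have hx' : x ∈ convexHull ℝ ({c, p, q} : Set Plane) := by
          rwa [Set.insert_comm, Set.pair_comm c q]
        obtain ⟨h1, h2, -⟩ := (mem_convexHull_triple_iff_orient (by rwa [e2]) x).1 hx'
        rw [hev]
        rw [e2] at h1 h2
        have e3 : orient q c x = orient c x q := by unfold orient; ring
        rw [e3]
        exact mul_nonneg h1 h2
      · rw [hev]
        have hcase : segment ℝ p' q' = segment ℝ q c ∨ segment ℝ p' q' = segment ℝ c p := by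
          rw [htc] at hp' hq'
          simp only [Finset.mem_insert, Finset.mem_singleton] at hp' hq'
          rcases hp' with rfl | rfl | rfl <;> rcases hq' with rfl | rfl | rfl
          · exact absurd rfl hne'
          · exact absurd rfl hne
          · exact Or.inr (segment_symm ℝ _ _)
          · exact absurd (Set.pair_comm _ _) hne
          · exact absurd rfl hne'
          · exact Or.inl rfl
          · exact Or.inr rfl
          · exact Or.inl (segment_symm ℝ _ _)
          · exact absurd rfl hne'
        rcases hcase with h | h <;> rw [h] at hx
        · rw [orient_eq_zero_of_mem_segment hx]; simp
        · rw [orient_eq_zero_of_mem_segment (p := c) hx]; simp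
    · exact ⟨0, by simp, fun _ => rfl, fun h1 h2 h3 => absurd ⟨h1, h2, h3⟩ ht⟩
  choose b h1 h2 h3 using h
  exact ⟨b, h1, h2, fun t ht hp hq => (h3 t ht hp hq).1, fun t ht hp hq => (h3 t ht hp hq).2.1,
    fun t ht hp hq => (h3 t ht hp hq).2.2⟩

/-- The product of an edge bubble with a symmetric piecewise polynomial matrix field without normal
jumps across the edge belongs to `Σ_h`. -/
lemma Triangulation.exists_bubble_stress {p q : Plane} {b : Finset Plane → MvPolynomial (Fin 2) ℝ}
    (hb : 𝒯.IsEdgeBubble p q b)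
    {M : Fin 2 → Finset Plane → Fin 2 → MvPolynomial (Fin 2) ℝ}
    (hMdeg : ∀ i t j, (M i t j).totalDegree ≤ r + 1) (hMs : ∀ i t j, M i t j = M j t i)
    (hM : ¬ openSegment ℝ p q ⊆ Γ.ΓD → ∀ i, ∀ x ∈ openSegment ℝ p q, 𝒯.polyJump (M i) p q x = 0) :
    ∃ τ : discreteStress 𝒯 r,
      ∀ i j, 𝒯.HasPieces ((τ : L2Mat Ω.carrier) i j) (fun t => b t * M i t j) := by
  choose τ hτ using fun i j => 𝒯.exists_hasPieces (fun t => b t * M i t j)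
  refine ⟨⟨τ, mem_discreteStress_of (P := fun i t j => b t * M i t j) ?_ hτ (fun i j t _ => ?_)
    fun i => ?_⟩, hτ⟩
  · refine Matrix.IsSymm.ext fun i j => ext_pieces (hτ j i) ?_
    exact (hτ i j).congr fun t _ => by rw [hMs]
  · refine (totalDegree_mul_le (hb.totalDegree_le t) (hMdeg i t j)).trans (by omega)
  · intro t ht p' hp' q' hq' hne hD x hx
    have hxs := openSegment_subset_segment _ _ _ hx
    by_cases hpair : ({p', q'} : Set Plane) = {p, q}
    · have key : ∀ x ∈ openSegment ℝ p q, ¬ openSegment ℝ p q ⊆ Γ.ΓD →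
          𝒯.polyJump (fun t j => b t * M i t j) p q x = 0 := by
        intro x hx hD
        have h1 := hM hD i x hx
        rw [openSegment_eq_image_lineMap] at hx
        obtain ⟨s, -, rfl⟩ := hx
        have h2 : 𝒯.polyJump (fun t j => b t * M i t j) p q (AffineMap.lineMap p q s) =
            s * (1 - s) * 𝒯.polyJump (M i) p q (AffineMap.lineMap p q s) := by
          simp only [polyJump, normalJump, Finset.mul_sum]
          refine Finset.sum_congr rfl fun t ht => ?_
          rw [Finset.mem_filter] at ht
          simp only [polyEval_mul, hb.apply_lineMap t ht.1 ht.2.1 ht.2.2 s]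
          ring
        rw [h2, h1, mul_zero]
      rcases Set.pair_eq_pair_iff.1 hpair with ⟨rfl, rfl⟩ | ⟨rfl, rfl⟩
      · exact key x hx hD
      · rw [polyJump, normalJump_swap]
        rw [openSegment_symm] at hx hD
        exact key x hx hD
    · refine Finset.sum_eq_zero fun t ht => ?_
      rw [Finset.mem_filter] at ht
      have hz : polyEval (b t) x = 0 := by
        by_cases h : p ∈ t ∧ q ∈ t
        · exact hb.vanish t ht.1 h.1 h.2 p' ht.2.1 q' ht.2.2 hne hpair x hxs
        · simp [hb.eq_zero t h]
      simp [hz]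

/-- Testing the divergence with an edge bubble: only the strain on the triangles at the edge and the
normal jump across the edge contribute. -/
lemma Triangulation.integral_div_bubble_add {p q : Plane} (hpq : p ≠ q)
    {b : Finset Plane → MvPolynomial (Fin 2) ℝ} (hb : 𝒯.IsEdgeBubble p q b)
    (hp : p ∈ 𝒯.verts) (hq : q ∈ 𝒯.verts)
    (V : Fin 2 → Finset Plane → MvPolynomial (Fin 2) ℝ)
    (M : Fin 2 → Finset Plane → Fin 2 → MvPolynomial (Fin 2) ℝ) :
    (∑ t ∈ 𝒯.tri, ∫ x in convexHull ℝ (t : Set Plane),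
        polyEval (V 0 t * divPoly (fun j => b t * M 0 t j) +
          V 1 t * divPoly (fun j => b t * M 1 t j)) x) +
      ∑ t ∈ 𝒯.tri, ∫ x in convexHull ℝ (t : Set Plane),
        polyEval (b t * ∑ i, ∑ j, MvPolynomial.pderiv j (V i t) * M i t j) x =
      ∫ s in (0 : ℝ)..1, s * (1 - s) *
        𝒯.polyJump (fun t j => ∑ i, V i t * M i t j) p q (AffineMap.lineMap p q s) := by
  classical
  have h := 𝒯.sum_integral_div_add_grad V (fun i t j => b t * M i t j)
  set I : Plane → Plane → ℝ := fun p' q' => ∫ s in (0 : ℝ)..1,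
    𝒯.polyJump (fun t j => ∑ i, V i t * (b t * M i t j)) p' q' (AffineMap.lineMap p' q' s) with hI
  have hswap : I q p = I p q := by
    have h1 : I q p = ∫ s in (0 : ℝ)..1, (fun s => 𝒯.polyJump
        (fun t j => ∑ i, V i t * (b t * M i t j)) p q (AffineMap.lineMap p q s)) (1 - s) := by
      refine intervalIntegral.integral_congr fun s _ => ?_
      simp only [AffineMap.lineMap_apply_one_sub]
      exact normalJump_swap _ _ _ _
    rw [h1, intervalIntegral.integral_comp_sub_left (fun s => 𝒯.polyJump
        (fun t j => ∑ i, V i t * (b t * M i t j)) p q (AffineMap.lineMap p q s))]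
    simp [hI]
  have hzero : ∀ z ∈ 𝒯.verts ×ˢ 𝒯.verts, z ∉ ({(p, q), (q, p)} : Finset (Plane × Plane)) →
      I z.1 z.2 = 0 := by
    rintro ⟨p', q'⟩ - hz
    simp only [Finset.mem_insert, Finset.mem_singleton, Prod.mk.injEq, not_or] at hz
    simp only [hI]
    rw [intervalIntegral.integral_congr (g := fun _ => 0)]
    · simp
    intro s hs
    rw [uIcc_of_le zero_le_one] at hs
    rcases eq_or_ne p' q' with rfl | hne
    · exact normalJump_self _ _ _
    refine Finset.sum_eq_zero fun t ht => ?_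
    rw [Finset.mem_filter] at ht
    have hb' : polyEval (b t) (AffineMap.lineMap p' q' s) = 0 := by
      by_cases h : p ∈ t ∧ q ∈ t
      · refine hb.vanish t ht.1 h.1 h.2 p' ht.2.1 q' ht.2.2 hne ?_ _ ?_
        · rw [Ne, Set.pair_eq_pair_iff]
          tauto
        · rw [segment_eq_image_lineMap]; exact ⟨s, hs, rfl⟩
      · simp [hb.eq_zero t h]
    simp [Fin.sum_univ_two, hb']
  have hsum : ∑ p' ∈ 𝒯.verts, ∑ q' ∈ 𝒯.verts, I p' q' = 2 * I p q := by
    rw [← Finset.sum_product', ← Finset.sum_subset (s₁ := {(p, q), (q, p)}) ?_ hzero,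
      Finset.sum_pair (by simp [hpq]), hswap, two_mul]
    intro z hz
    simp only [Finset.mem_insert, Finset.mem_singleton] at hz
    rcases hz with rfl | rfl <;> simp [hp, hq]
  have hIpq : I p q = ∫ s in (0 : ℝ)..1, s * (1 - s) *
      𝒯.polyJump (fun t j => ∑ i, V i t * M i t j) p q (AffineMap.lineMap p q s) := by
    refine intervalIntegral.integral_congr fun s _ => ?_
    simp only [polyJump, normalJump, Finset.mul_sum]
    refine Finset.sum_congr rfl fun t ht => ?_
    rw [Finset.mem_filter] at ht
    simp only [polyEval_add, polyEval_mul, hb.apply_lineMap t ht.1 ht.2.1 ht.2.2 s, Fin.sum_univ_two]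
    ring
  rw [← hIpq]
  have h' := h.trans hsum
  have hstrain : ∀ t, b t * ∑ i, ∑ j, MvPolynomial.pderiv j (V i t) * M i t j =
      ∑ i, ∑ j, MvPolynomial.pderiv j (V i t) * (b t * M i t j) := by
    intro t
    simp only [Finset.mul_sum]
    exact Finset.sum_congr rfl fun i _ => Finset.sum_congr rfl fun j _ => by ring
  simp only [hstrain]
  linarith

end Triangulation

/-! ### Displacements orthogonal to all divergences -/

lemma eq_C_of_pderiv_eq_zero {p : MvPolynomial (Fin 2) ℝ}
    (h : ∀ j, MvPolynomial.pderiv j p = 0) : p = MvPolynomial.C (p.coeff 0) := by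
  classical
  ext d
  rw [MvPolynomial.coeff_C]
  split_ifs with hd
  · rw [hd]
  · obtain ⟨j, hj⟩ := DFunLike.ne_iff.1 (Ne.symm hd)
    have h1 := congrArg (MvPolynomial.coeff (d - Finsupp.single j 1)) (h j)
    have hle : Finsupp.single j 1 ≤ d := by
      rw [Finsupp.single_le_iff]
      exact Nat.one_le_iff_ne_zero.2 hj
    rw [MvPolynomial.coeff_pderiv, tsub_add_cancel_of_le hle, MvPolynomial.coeff_zero] at h1
    exact (mul_eq_zero.1 h1).resolve_right (by positivity)

/-- Polynomial fields with vanishing symmetric gradient are rigid motions. -/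
lemma exists_rigidPoly_eq {V : Fin 2 → MvPolynomial (Fin 2) ℝ}
    (h0 : MvPolynomial.pderiv 0 (V 0) = 0) (h1 : MvPolynomial.pderiv 1 (V 1) = 0)
    (h01 : MvPolynomial.pderiv 1 (V 0) + MvPolynomial.pderiv 0 (V 1) = 0) :
    ∃ c₁ c₂ c₃, V = rigidPoly c₁ c₂ c₃ := by
  have e1 : MvPolynomial.pderiv 0 (V 1) = -MvPolynomial.pderiv 1 (V 0) := by
    linear_combination h01
  have hc := eq_C_of_pderiv_eq_zero (p := MvPolynomial.pderiv 0 (V 1)) (Fin.forall_fin_two.2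
    ⟨by rw [e1, map_neg, pderiv_pderiv_comm, h0]; simp, by rw [← pderiv_pderiv_comm, h1]; simp⟩)
  set c₃ := (MvPolynomial.pderiv 0 (V 1)).coeff 0
  have hV1 := eq_C_of_pderiv_eq_zero (p := V 1 - MvPolynomial.C c₃ * MvPolynomial.X 0)
    (Fin.forall_fin_two.2 ⟨by simp [hc], by simp [h1, MvPolynomial.pderiv_X]⟩)
  have hV0 := eq_C_of_pderiv_eq_zero (p := V 0 + MvPolynomial.C c₃ * MvPolynomial.X 1)
    (Fin.forall_fin_two.2 ⟨by simp [h0, MvPolynomial.pderiv_X], by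
      rw [map_add, MvPolynomial.pderiv_C_mul, MvPolynomial.pderiv_X_self, ← hc, e1]
      simp⟩)
  refine ⟨(V 0 + MvPolynomial.C c₃ * MvPolynomial.X 1).coeff 0,
    (V 1 - MvPolynomial.C c₃ * MvPolynomial.X 0).coeff 0, c₃, ?_⟩
  ext1 i
  fin_cases i
  · exact eq_sub_of_add_eq hV0
  · exact sub_eq_iff_eq_add.1 hV1

/-- A quadratic form in the plane that vanishes on the three edge vectors of a triangle is zero. -/
lemma quadraticForm_eq_zero {R : Type*} [CommRing R] [IsDomain R] {A B E u₀ u₁ v₀ v₁ : R}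
    (hD : u₀ * v₁ - u₁ * v₀ ≠ 0) (hu : A * u₀ ^ 2 + B * (u₀ * u₁) + E * u₁ ^ 2 = 0)
    (hv : A * v₀ ^ 2 + B * (v₀ * v₁) + E * v₁ ^ 2 = 0)
    (hw : A * (v₀ - u₀) ^ 2 + B * ((v₀ - u₀) * (v₁ - u₁)) + E * (v₁ - u₁) ^ 2 = 0) :
    A = 0 ∧ B = 0 ∧ E = 0 := by
  have huv : 2 * A * (u₀ * v₀) + B * (u₀ * v₁ + u₁ * v₀) + 2 * E * (u₁ * v₁) = 0 := by
    linear_combination hu + hv - hw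
  have hne := pow_ne_zero 2 hD
  -- expand the coordinate vectors in the basis of the edge vectors
  refine ⟨(mul_eq_zero.1 ?_).resolve_left hne, (mul_eq_zero.1 ?_).resolve_left hne,
    (mul_eq_zero.1 ?_).resolve_left hne⟩
  · linear_combination v₁ ^ 2 * hu - u₁ * v₁ * huv + u₁ ^ 2 * hv
  · linear_combination -2 * v₀ * v₁ * hu + (u₀ * v₁ + u₁ * v₀) * huv - 2 * u₀ * u₁ * hv
  · linear_combination v₀ ^ 2 * hu - u₀ * v₀ * huv + u₀ ^ 2 * hv

lemma exists_rigidPoly_eq_of_tangents {V : Fin 2 → MvPolynomial (Fin 2) ℝ} {a b c : Plane}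
    (hD : orient a b c ≠ 0)
    (h : ∀ p ∈ ({a, b, c} : Finset Plane), ∀ q ∈ ({a, b, c} : Finset Plane), p ≠ q →
      ∑ i, ∑ j, MvPolynomial.pderiv j (V i) * MvPolynomial.C ((q i - p i) * (q j - p j)) = 0) :
    ∃ c₁ c₂ c₃, V = rigidPoly c₁ c₂ c₃ := by
  have hab : a ≠ b := by rintro rfl; simp [orient_self] at hD
  have hac : a ≠ c := by rintro rfl; simp at hD
  have hbc : b ≠ c := by rintro rfl; simp at hD
  have key : ∀ p q : Plane,
      ∑ i, ∑ j, MvPolynomial.pderiv j (V i) * MvPolynomial.C ((q i - p i) * (q j - p j)) =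
      MvPolynomial.pderiv 0 (V 0) * MvPolynomial.C (q 0 - p 0) ^ 2 +
        (MvPolynomial.pderiv 1 (V 0) + MvPolynomial.pderiv 0 (V 1)) *
          (MvPolynomial.C (q 0 - p 0) * MvPolynomial.C (q 1 - p 1)) +
        MvPolynomial.pderiv 1 (V 1) * MvPolynomial.C (q 1 - p 1) ^ 2 := by
    intro p q
    simp only [Fin.sum_univ_two, map_mul]
    ring
  have h1 := (key a b).symm.trans (h a (by simp) b (by simp) hab)
  have h2 := (key a c).symm.trans (h a (by simp) c (by simp) hac)
  have h3 := (key b c).symm.trans (h b (by simp) c (by simp) hbc)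
  have hw : ∀ i, (MvPolynomial.C (c i - b i) : MvPolynomial (Fin 2) ℝ) =
      MvPolynomial.C (c i - a i) - MvPolynomial.C (b i - a i) := by
    intro i
    rw [← map_sub]; congr 1; ring
  rw [hw, hw] at h3
  obtain ⟨e0, e01, e1⟩ := quadraticForm_eq_zero (by
    rw [← map_mul, ← map_mul, ← map_sub, Ne, MvPolynomial.C_eq_zero]
    exact hD) h1 h2 h3
  exact exists_rigidPoly_eq e0 e1 e01

lemma rigidPoly_eq_zero {c₁ c₂ c₃ : ℝ} {p q : Plane} (hpq : p ≠ q)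
    (hp : ∀ i, polyEval (rigidPoly c₁ c₂ c₃ i) p = 0)
    (hq : ∀ i, polyEval (rigidPoly c₁ c₂ c₃ i) q = 0) : rigidPoly c₁ c₂ c₃ = 0 := by
  have hp0 := hp 0
  have hp1 := hp 1
  have hq0 := hq 0
  have hq1 := hq 1
  simp only [polyEval_rigidPoly, rigidMotion, Matrix.cons_val_zero, Matrix.cons_val_one]
    at hp0 hp1 hq0 hq1
  have h3 : c₃ = 0 := by
    by_contra h
    refine hpq ?_
    ext i
    fin_cases i
    · exact mul_left_cancel₀ h (by simp only [Fin.zero_eta]; linarith)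
    · exact mul_left_cancel₀ h (by simp only [Fin.mk_one]; linarith)
  subst h3
  have h1 : c₁ = 0 := by linarith
  have h2 : c₂ = 0 := by linarith
  ext1 i
  fin_cases i <;> simp [rigidPoly, h1, h2]

lemma rigidPoly_sub (a₁ a₂ a₃ b₁ b₂ b₃ : ℝ) :
    rigidPoly a₁ a₂ a₃ - rigidPoly b₁ b₂ b₃ = rigidPoly (a₁ - b₁) (a₂ - b₂) (a₃ - b₃) := by
  ext1 i
  fin_cases i <;> simp [rigidPoly] <;> ring

lemma totalDegree_rigidPoly_le (c₁ c₂ c₃ : ℝ) (i : Fin 2) :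
    (rigidPoly c₁ c₂ c₃ i).totalDegree ≤ 1 := by
  fin_cases i
  · exact totalDegree_sub_le (by simp)
      (totalDegree_C_mul_le _ (by simp [MvPolynomial.totalDegree_X]))
  · exact totalDegree_add_le (by simp)
      (totalDegree_C_mul_le _ (by simp [MvPolynomial.totalDegree_X]))

section Triangulation

variable {Ω : PolygonalDomain} {Γ : BoundaryParts Ω} {𝒯 : Triangulation Ω Γ} {r : ℕ}
  {v : L2Vec Ω.carrier} {V : Fin 2 → Finset Plane → MvPolynomial (Fin 2) ℝ}

/-- If `v` is orthogonal to `div Σ_h`, testing with a bubble stress leaves only the strain of `v` at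
the edge and the jump of `v` across the edge. -/
lemma Triangulation.bubble_identity (hV : ∀ i, 𝒯.HasPieces (v i) (V i))
    (hv : ∀ τ, innerVec v (discreteDiv 𝒯 r τ) = 0) {p q : Plane} (hpq : p ≠ q)
    (hp : p ∈ 𝒯.verts) (hq : q ∈ 𝒯.verts) {b : Finset Plane → MvPolynomial (Fin 2) ℝ}
    (hb : 𝒯.IsEdgeBubble p q b)
    {M : Fin 2 → Finset Plane → Fin 2 → MvPolynomial (Fin 2) ℝ}
    (hMdeg : ∀ i t j, (M i t j).totalDegree ≤ r + 1) (hMs : ∀ i t j, M i t j = M j t i)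
    (hM : ¬ openSegment ℝ p q ⊆ Γ.ΓD → ∀ i, ∀ x ∈ openSegment ℝ p q, 𝒯.polyJump (M i) p q x = 0) :
    ∑ t ∈ 𝒯.tri, ∫ x in convexHull ℝ (t : Set Plane),
        polyEval (b t * ∑ i, ∑ j, MvPolynomial.pderiv j (V i t) * M i t j) x =
      ∫ s in (0 : ℝ)..1, s * (1 - s) *
        𝒯.polyJump (fun t j => ∑ i, V i t * M i t j) p q (AffineMap.lineMap p q s) := by
  obtain ⟨τ, hτ⟩ := exists_bubble_stress hb hMdeg hMs hM
  have h1 := hv τ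
  rw [innerVec_eq hV (hasPieces_discreteDiv τ (P := fun i t j => b t * M i t j) hτ)] at h1
  rw [← integral_div_bubble_add hpq hb hp hq V M, h1, zero_add]

lemma polyEval_eq_zero_of_integral_eq_zero {t : Finset Plane} (ht : t ∈ 𝒯.tri)
    {p : MvPolynomial (Fin 2) ℝ} (hp : ∀ x ∈ convexHull ℝ (t : Set Plane), 0 ≤ polyEval p x)
    (h : ∫ x in convexHull ℝ (t : Set Plane), polyEval p x = 0) : p = 0 := by
  refine eq_zero_of_polyEval_eq_zero isOpen_interior (Triangulation.interior_tri_nonempty ht) ?_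
  have h1 := (setIntegral_eq_zero_iff_of_nonneg_ae
    ((ae_restrict_iff' (Triangulation.isClosed_tri t).measurableSet).2 (Eventually.of_forall hp))
    (integrableOn_polyEval p t)).1 h
  exact Measure.eqOn_open_of_ae_eq (μ := volume) (ae_restrict_of_ae_restrict_of_subset
    interior_subset h1) isOpen_interior (continuous_polyEval _).continuousOn continuousOn_const

/-- If `v` is orthogonal to `div Σ_h`, its strain vanishes along the edges of each triangle: test with
the stress `b (tᵀ ε(v) t) t tᵀ`, where `t` is the edge vector and `b` the edge bubble. -/
lemma Triangulation.tangential_strain_eq_zero (hV : ∀ i, 𝒯.HasPieces (v i) (V i))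
    (hdeg : ∀ i t, (V i t).totalDegree ≤ r + 2) (hv : ∀ τ, innerVec v (discreteDiv 𝒯 r τ) = 0)
    {t : Finset Plane} (ht : t ∈ 𝒯.tri) {p q : Plane} (hp : p ∈ t) (hq : q ∈ t) (hpq : p ≠ q) :
    ∑ i, ∑ j, MvPolynomial.pderiv j (V i t) * MvPolynomial.C ((q i - p i) * (q j - p j)) = 0 := by
  classical
  obtain ⟨b, hb⟩ := 𝒯.exists_isEdgeBubble hpq
  obtain ⟨u, hu⟩ : ∃ u : Fin 2 → ℝ, ∀ i, q i - p i = u i := ⟨_, fun _ => rfl⟩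
  simp only [hu]
  obtain ⟨g, hg⟩ : ∃ g, g = ∑ i, ∑ j, MvPolynomial.pderiv j (V i t) *
    MvPolynomial.C (u i * u j) := ⟨_, rfl⟩
  rw [← hg]
  have hgdeg : g.totalDegree ≤ r + 1 := by
    rw [hg]
    exact MvPolynomial.totalDegree_finsetSum_le fun i _ => MvPolynomial.totalDegree_finsetSum_le
      fun j _ => totalDegree_mul_le (l := 0) (totalDegree_pderiv_le (hdeg i t) j)
        (MvPolynomial.totalDegree_C _).le
  obtain ⟨M, hMt, hMs⟩ : ∃ M : Fin 2 → Finset Plane → Fin 2 → MvPolynomial (Fin 2) ℝ,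
      (∀ i j, M i t j = g * MvPolynomial.C (u i * u j)) ∧ ∀ i j, ∀ s ≠ t, M i s j = 0 :=
    ⟨fun i s j => if s = t then g * MvPolynomial.C (u i * u j) else 0,
      fun i j => if_pos rfl, fun i j s hs => if_neg hs⟩
  have hnormal : ∀ i s x, polyEval (M i s 0) x * u 1 - polyEval (M i s 1) x * u 0 = 0 := by
    intro i s x
    rcases eq_or_ne s t with rfl | hs
    · simp only [hMt, polyEval_mul, polyEval_C]; ring
    · simp [hMs _ _ s hs]
  have h := bubble_identity hV hv hpq (mem_verts.2 ⟨t, ht, hp⟩) (mem_verts.2 ⟨t, ht, hq⟩) hb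
    (M := M) (fun i s j => ?_) (fun i s j => ?_) (fun _ i x _ => ?_)
  · have hjump : ∀ x, 𝒯.polyJump (fun t j => ∑ i, V i t * M i t j) p q x = 0 := by
      intro x
      refine Finset.sum_eq_zero fun s _ => ?_
      simp only [Fin.sum_univ_two, polyEval_add, polyEval_mul, hu]
      linear_combination side s p q * (polyEval (V 0 s) x * hnormal 0 s x +
        polyEval (V 1 s) x * hnormal 1 s x)
    simp only [hjump, mul_zero, intervalIntegral.integral_zero] at h
    rw [Finset.sum_eq_single t (fun s _ hs => by simp [hMs _ _ s hs]) (fun h => absurd ht h)] at h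
    have hprod : ∑ i, ∑ j, MvPolynomial.pderiv j (V i t) * M i t j = g * g := by
      conv_rhs => enter [1]; rw [hg]
      simp only [Fin.sum_univ_two, hMt]
      ring
    rw [hprod] at h
    have hz := polyEval_eq_zero_of_integral_eq_zero ht (fun x hx => by
      rw [polyEval_mul, polyEval_mul]
      exact mul_nonneg (hb.nonneg t ht hp hq x hx) (mul_self_nonneg _)) h
    have hbt : b t ≠ 0 := by
      intro h0
      have := hb.apply_lineMap t ht hp hq (1 / 2)
      rw [h0, polyEval_zero] at this
      norm_num at this
    exact mul_self_eq_zero.1 ((mul_eq_zero.1 hz).resolve_left hbt)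
  · rcases eq_or_ne s t with rfl | hs
    · rw [hMt]
      exact totalDegree_mul_le (l := 0) hgdeg (MvPolynomial.totalDegree_C _).le
    · simp [hMs _ _ s hs]
  · rcases eq_or_ne s t with rfl | hs
    · rw [hMt, hMt, mul_comm (u i)]
    · rw [hMs _ _ s hs, hMs _ _ s hs]
  · refine Finset.sum_eq_zero fun s _ => ?_
    rw [hu, hu]
    exact mul_eq_zero_of_right _ (hnormal i s x)

/-- If `v` is orthogonal to `div Σ_h`, it is a rigid motion on each triangle. -/
lemma Triangulation.exists_rigidPoly (hV : ∀ i, 𝒯.HasPieces (v i) (V i))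
    (hdeg : ∀ i t, (V i t).totalDegree ≤ r + 2) (hv : ∀ τ, innerVec v (discreteDiv 𝒯 r τ) = 0)
    {t : Finset Plane} (ht : t ∈ 𝒯.tri) :
    ∃ c₁ c₂ c₃, (fun i => V i t) = rigidPoly c₁ c₂ c₃ := by
  obtain ⟨a, b, c, -, -, -, htc, hD⟩ := exists_vertices ht
  refine exists_rigidPoly_eq_of_tangents hD fun p hp q hq hpq => ?_
  rw [← htc] at hp hq
  exact tangential_strain_eq_zero hV hdeg hv ht hp hq hpq

/-- If `v` is orthogonal to `div Σ_h`, its jump `d` across an edge vanishes: test with the stress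
`b (d νᵀ + ν dᵀ)`, where `ν` is normal to the edge and `b` is the edge bubble. -/
lemma Triangulation.jump_eq_zero (hV : ∀ i, 𝒯.HasPieces (v i) (V i))
    (hdeg : ∀ i t, (V i t).totalDegree ≤ r + 2) (hv : ∀ τ, innerVec v (discreteDiv 𝒯 r τ) = 0)
    {t : Finset Plane} (ht : t ∈ 𝒯.tri) {p q : Plane} (hp : p ∈ t) (hq : q ∈ t) (hpq : p ≠ q)
    (hside : ¬ openSegment ℝ p q ⊆ Γ.ΓD →
      ∑ s ∈ 𝒯.tri.filter (fun s => p ∈ s ∧ q ∈ s), side s p q = 0)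
    {c₁ c₂ c₃ : ℝ} (hd : ∀ (w : Fin 2 → ℝ) (x : Plane),
      ∑ s ∈ 𝒯.tri.filter (fun s => p ∈ s ∧ q ∈ s), side s p q * ∑ i, polyEval (V i s) x * w i =
        side t p q * ∑ i, polyEval (rigidPoly c₁ c₂ c₃ i) x * w i) :
    rigidPoly c₁ c₂ c₃ = 0 := by
  obtain ⟨b, hb⟩ := 𝒯.exists_isEdgeBubble hpq
  set d := rigidPoly c₁ c₂ c₃ with hdd
  let ν : Fin 2 → ℝ := ![q 1 - p 1, -(q 0 - p 0)]
  let M : Fin 2 → Finset Plane → Fin 2 → MvPolynomial (Fin 2) ℝ := fun i _ j =>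
    MvPolynomial.C (ν j) * d i + MvPolynomial.C (ν i) * d j
  have hν : 0 < ν 0 ^ 2 + ν 1 ^ 2 := by
    by_contra! h
    have h0 : ν 0 = 0 := by nlinarith [sq_nonneg (ν 0), sq_nonneg (ν 1)]
    have h1 : ν 1 = 0 := by nlinarith [sq_nonneg (ν 0), sq_nonneg (ν 1)]
    simp only [ν, Matrix.cons_val_zero, Matrix.cons_val_one, neg_eq_zero, sub_eq_zero] at h0 h1
    refine hpq ?_
    ext i
    fin_cases i
    · exact h1.symm
    · exact h0.symm
  -- the energy density of the jump
  let E : Plane → ℝ := fun x => (ν 0 ^ 2 + ν 1 ^ 2) * (polyEval (d 0) x ^ 2 + polyEval (d 1) x ^ 2) +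
    (polyEval (d 0) x * ν 0 + polyEval (d 1) x * ν 1) ^ 2
  have h := bubble_identity hV hv hpq (mem_verts.2 ⟨t, ht, hp⟩) (mem_verts.2 ⟨t, ht, hq⟩) hb
    (M := M) (fun i s j => ?_) (fun i s j => ?_) (fun hD i x _ => ?_)
  · have hleft : ∑ t ∈ 𝒯.tri, ∫ x in convexHull ℝ (t : Set Plane),
        polyEval (b t * ∑ i, ∑ j, MvPolynomial.pderiv j (V i t) * M i t j) x = 0 := by
      refine Finset.sum_eq_zero fun s hs => ?_
      obtain ⟨a₁, a₂, a₃, ha⟩ := exists_rigidPoly hV hdeg hv hs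
      have ha0 : V 0 s = rigidPoly a₁ a₂ a₃ 0 := congrFun ha 0
      have ha1 : V 1 s = rigidPoly a₁ a₂ a₃ 1 := congrFun ha 1
      have : ∑ i, ∑ j, MvPolynomial.pderiv j (V i s) * M i s j = 0 := by
        simp only [Fin.sum_univ_two, ha0, ha1, M]
        simp [rigidPoly, MvPolynomial.pderiv_X]
        ring
      rw [this]; simp
    have hjump : ∀ x, 𝒯.polyJump (fun t j => ∑ i, V i t * M i t j) p q x = side t p q * E x := by
      intro x
      have h1 := hd (fun i => polyEval (M i t 0) x * (q 1 - p 1) -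
        polyEval (M i t 1) x * (q 0 - p 0)) x
      have h2 : 𝒯.polyJump (fun t j => ∑ i, V i t * M i t j) p q x =
          ∑ s ∈ 𝒯.tri.filter (fun s => p ∈ s ∧ q ∈ s), side s p q * ∑ i, polyEval (V i s) x *
            (polyEval (M i t 0) x * (q 1 - p 1) - polyEval (M i t 1) x * (q 0 - p 0)) := by
        refine Finset.sum_congr rfl fun s _ => ?_
        simp only [Fin.sum_univ_two, polyEval_add, polyEval_mul, M]
        ring
      rw [h2, h1]
      congr 1
      simp only [Fin.sum_univ_two, polyEval_add, polyEval_mul, polyEval_C, M, E, ν,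
        Matrix.cons_val_zero, Matrix.cons_val_one]
      ring
    rw [hleft] at h
    have hE0 : ∀ x, 0 ≤ E x := fun x => by positivity
    have hEc : Continuous E := by
      have := continuous_polyEval (d 0)
      have := continuous_polyEval (d 1)
      fun_prop
    have hl : Continuous (fun s : ℝ => (AffineMap.lineMap p q s : Plane)) :=
      AffineMap.lineMap_continuous
    have hint : ∫ s in (0 : ℝ)..1, s * (1 - s) * E (AffineMap.lineMap p q s) = 0 := by
      have h3 : ∫ s in (0 : ℝ)..1, s * (1 - s) * 𝒯.polyJump (fun t j => ∑ i, V i t * M i t j) p q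
          (AffineMap.lineMap p q s) =
          side t p q * ∫ s in (0 : ℝ)..1, s * (1 - s) * E (AffineMap.lineMap p q s) := by
        rw [← intervalIntegral.integral_const_mul]
        refine intervalIntegral.integral_congr fun s _ => ?_
        simp only [hjump]
        ring
      rw [h3] at h
      exact (mul_eq_zero.1 h.symm).resolve_left (side_ne_zero ht hp hq hpq)
    have hE : ∀ x ∈ openSegment ℝ p q, E x = 0 := by
      intro x hx
      rw [openSegment_eq_image_lineMap] at hx
      obtain ⟨s, hs, rfl⟩ := hx
      by_contra hne
      refine (intervalIntegral.integral_pos zero_lt_one (by fun_prop) (fun u hu =>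
        mul_nonneg (mul_nonneg hu.1.le (by linarith [hu.2])) (hE0 _))
        ⟨s, ⟨hs.1.le, hs.2.le⟩, ?_⟩).ne' hint
      exact mul_pos (mul_pos hs.1 (by linarith [hs.2])) (lt_of_le_of_ne (hE0 _) (Ne.symm hne))
    have hzero : ∀ i, ∀ x ∈ segment ℝ p q, polyEval (d i) x = 0 := by
      intro i
      refine eqOn_segment_of_eqOn_openSegment (continuous_polyEval _) continuous_const fun x hx => ?_
      have h1 := hE x hx
      simp only [E] at h1
      have h2 : polyEval (d 0) x ^ 2 + polyEval (d 1) x ^ 2 = 0 := by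
        refine (mul_eq_zero.1 (le_antisymm ?_ ?_)).resolve_left hν.ne'
        · nlinarith [sq_nonneg (polyEval (d 0) x * ν 0 + polyEval (d 1) x * ν 1)]
        · positivity
      have h3 : ∀ i, polyEval (d i) x ^ 2 = 0 := Fin.forall_fin_two.2
        ⟨le_antisymm (by linarith [sq_nonneg (polyEval (d 1) x)]) (sq_nonneg _),
          le_antisymm (by linarith [sq_nonneg (polyEval (d 0) x)]) (sq_nonneg _)⟩
      exact (pow_eq_zero_iff two_ne_zero).1 (h3 i)
    exact rigidPoly_eq_zero hpq (fun i => hzero i p (left_mem_segment ℝ p q))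
      fun i => hzero i q (right_mem_segment ℝ p q)
  · exact (totalDegree_add_le (totalDegree_C_mul_le _ (totalDegree_rigidPoly_le _ _ _ i))
      (totalDegree_C_mul_le _ (totalDegree_rigidPoly_le _ _ _ j))).trans (by omega)
  · simp only [M]; ring
  · have h1 := hside hD
    refine (Finset.sum_mul _ (fun s => side s p q) (polyEval (M i t 0) x * (q 1 - p 1) -
      polyEval (M i t 1) x * (q 0 - p 0))).symm.trans ?_
    rw [h1, zero_mul]

/-- Only the zero displacement is orthogonal to `div Σ_h`: a displacement orthogonal to `div Σ_h` is a
rigid motion on each triangle, does not jump across interior edges, and vanishes on Dirichlet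
edges. -/
theorem eq_zero_of_orthogonal_div (hvU : v ∈ discreteDisplacement 𝒯 r)
    (hv : ∀ τ, innerVec v (discreteDiv 𝒯 r τ) = 0) : v = 0 := by
  choose V hV hdeg using fun i => (hvU.1 i).exists_pieces
  have hrigid := fun t ht => Triangulation.exists_rigidPoly (t := t) hV hdeg hv ht
  have hglobal : ∀ t ∈ 𝒯.tri, ∀ t' ∈ 𝒯.tri, (fun i => V i t) = fun i => V i t' := by
    intro t ht t' ht'
    refine 𝒯.eq_of_common_edge (fun t i => V i t) ?_ ht ht'
    intro t ht t' ht' hne p q hpq hp hq hp' hq'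
    obtain ⟨a₁, a₂, a₃, ha⟩ := hrigid t ht
    obtain ⟨b₁, b₂, b₃, hb⟩ := hrigid t' ht'
    have hfil : 𝒯.tri.filter (fun s => p ∈ s ∧ q ∈ s) = {t, t'} ∧
        side t' p q = -side t p q := by
      have hmem : t' ∈ 𝒯.tri.filter (fun s => p ∈ s ∧ q ∈ s) :=
        Finset.mem_filter.2 ⟨ht', hp', hq'⟩
      rcases Triangulation.edge_cases ht hpq hp hq with h | ⟨-, s, -, -, -, -, hside, hfil⟩
      · rw [h.2, Finset.mem_singleton] at hmem
        exact absurd hmem.symm hne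
      · rw [hfil, Finset.mem_insert, Finset.mem_singleton] at hmem
        obtain rfl := hmem.resolve_left hne.symm
        exact ⟨hfil, hside⟩
    have h := Triangulation.jump_eq_zero hV hdeg hv ht hp hq hpq
      (c₁ := a₁ - b₁) (c₂ := a₂ - b₂) (c₃ := a₃ - b₃) (fun _ => ?_) (fun w x => ?_)
    · rw [← rigidPoly_sub, sub_eq_zero] at h
      rw [ha, hb, h]
    · rw [hfil.1, Finset.sum_pair hne, hfil.2, add_neg_cancel]
    · rw [hfil.1, Finset.sum_pair hne, hfil.2, ← rigidPoly_sub, ← ha, ← hb]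
      simp only [Fin.sum_univ_two, Pi.sub_apply, polyEval_sub]
      ring
  rcases Γ.ΓD.eq_empty_or_nonempty with hD | hD
  · have h1 : ∃ c₁ c₂ c₃, ∀ t ∈ 𝒯.tri, (fun i => V i t) = rigidPoly c₁ c₂ c₃ := by
      rcases 𝒯.tri.eq_empty_or_nonempty with he | ⟨t, ht⟩
      · exact ⟨0, 0, 0, by simp [he]⟩
      · obtain ⟨c₁, c₂, c₃, hc⟩ := hrigid t ht
        exact ⟨c₁, c₂, c₃, fun t' ht' => (hglobal t' ht' t ht).trans hc⟩
    obtain ⟨c₁, c₂, c₃, hc⟩ := h1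
    have h2 := hvU.2 hD c₁ c₂ c₃
    have h3 : ∀ i, pairing (v i) (fun x => rigidMotion c₁ c₂ c₃ x i) = inner ℝ (v i) (v i) := by
      intro i
      rw [← polyEval_rigidPoly, (hV i).pairing_eq, (hV i).inner_eq (hV i)]
      refine Finset.sum_congr rfl fun t ht => ?_
      rw [← congrFun (hc t ht) i]
    simp only [h3] at h2
    rw [Finset.sum_eq_zero_iff_of_nonneg fun i _ => real_inner_self_nonneg] at h2
    ext1 i
    exact inner_self_eq_zero.1 (h2 i (Finset.mem_univ i))
  · obtain ⟨t, ht, p, q, hpq, hp, hq, hDs, -, hfil⟩ := 𝒯.exists_dirichlet_edge hD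
    obtain ⟨c₁, c₂, c₃, hc⟩ := hrigid t ht
    have h := Triangulation.jump_eq_zero hV hdeg hv ht hp hq hpq
      (c₁ := c₁) (c₂ := c₂) (c₃ := c₃) (fun h => absurd hDs h) (fun w x => by
        rw [hfil, Finset.sum_singleton, ← hc])
    ext1 i
    refine Triangulation.ext_pieces (hV i) fun t' ht' => ?_
    have hz : V i t' = 0 := by
      have := congrFun ((hglobal t' ht' t ht).trans (hc.trans h)) i
      exact this
    filter_upwards [Lp.coeFn_zero ℝ 2 (volume.restrict Ω.carrier)] with x hx _
    rw [hz, polyEval_zero]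
    exact hx

end Triangulation

/-! ### The discrete Hodge decomposition -/

/-- Adjoints and orthogonal decomposition for a linear map `D` of finite-dimensional spaces with a
trivial left kernel. -/
theorem exists_adjoint_decomposition {S U : Type*} [AddCommGroup S] [Module ℝ S]
    [FiniteDimensional ℝ S] [AddCommGroup U] [Module ℝ U] [FiniteDimensional ℝ U]
    (a : LinearMap.BilinForm ℝ S) (ha : ∀ τ, a τ τ = 0 → τ = 0) (m : LinearMap.BilinForm ℝ U)
    (hm : ∀ v, m v v = 0 → v = 0) (D : S →ₗ[ℝ] U) (hD : ∀ v, (∀ τ, m v (D τ) = 0) → v = 0) :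
    Function.Surjective D ∧ (∃! ε : U →ₗ[ℝ] S, ∀ v τ, a (ε v) τ = -m v (D τ)) ∧
      ∀ ε : U →ₗ[ℝ] S, (∀ v τ, a (ε v) τ = -m v (D τ)) →
        IsCompl (LinearMap.ker D) (LinearMap.range ε) := by
  have hai : Function.Injective a := (injective_iff_map_eq_zero _).2 fun τ h =>
    ha τ (by rw [h]; rfl)
  have hmi : Function.Injective m := (injective_iff_map_eq_zero _).2 fun v h =>
    hm v (by rw [h]; rfl)
  have hab : Function.Bijective a := ⟨hai, (LinearMap.injective_iff_surjective_of_finrank_eq_finrank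
    (Subspace.dual_finrank_eq (K := ℝ) (V := S)).symm).1 hai⟩
  have hms : Function.Surjective m := (LinearMap.injective_iff_surjective_of_finrank_eq_finrank
    (Subspace.dual_finrank_eq (K := ℝ) (V := U)).symm).1 hmi
  refine ⟨?_, ?_, fun ε hε => ?_⟩
  · rw [← LinearMap.dualMap_injective_iff, injective_iff_map_eq_zero]
    intro φ hφ
    obtain ⟨v, rfl⟩ := hms φ
    rw [hD v fun τ => LinearMap.congr_fun hφ τ, map_zero]
  · refine ⟨-((LinearEquiv.ofBijective a hab).symm.toLinearMap ∘ₗ D.dualMap ∘ₗ m),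
      fun v τ => ?_, fun ε hε => LinearMap.ext fun v => hai (LinearMap.ext fun τ => ?_)⟩
    · have h := LinearMap.congr_fun ((LinearEquiv.ofBijective a hab).apply_symm_apply
        (D.dualMap (m v))) τ
      simp only [LinearMap.neg_apply, map_neg, neg_inj]
      exact h
    · have h := LinearMap.congr_fun ((LinearEquiv.ofBijective a hab).apply_symm_apply
        (D.dualMap (m v))) τ
      rw [hε]
      simp only [LinearMap.neg_apply, map_neg, neg_inj]
      exact h.symm
  · have hinj : Function.Injective (D ∘ₗ ε) := by
      rw [injective_iff_map_eq_zero]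
      intro v hv
      have h0 : ε v = 0 := ha _ (by
        rw [hε]
        have : D (ε v) = 0 := hv
        rw [this, map_zero, neg_zero])
      refine hD v fun τ => ?_
      have h1 := hε v τ
      rw [h0, map_zero] at h1
      exact neg_eq_zero.1 h1.symm
    refine ⟨Submodule.disjoint_def.2 ?_, codisjoint_iff.2 (Submodule.eq_top_iff'.2 fun τ => ?_)⟩
    · rintro τ hτ ⟨v, rfl⟩
      rw [hinj (a₁ := v) (a₂ := 0) (by rw [map_zero]; exact hτ), map_zero]
    · obtain ⟨v, hv⟩ := LinearMap.injective_iff_surjective.1 hinj (D τ)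
      refine Submodule.mem_sup.2 ⟨τ - ε v, ?_, ε v, ⟨v, rfl⟩, sub_add_cancel _ _⟩
      rw [LinearMap.mem_ker, map_sub, ← hv]
      exact sub_self _

section Triangulation

variable {Ω : PolygonalDomain} {Γ : BoundaryParts Ω} {𝒯 : Triangulation Ω Γ} {r : ℕ}

/-- The space of piecewise polynomials of degree at most `k`. -/
def piecewisePoly (𝒯 : Triangulation Ω Γ) (k : ℕ) : Submodule ℝ (L2 Ω.carrier) where
  carrier := {f | IsPiecewisePoly 𝒯 k f}
  add_mem' h h' := h.add h'
  zero_mem' := isPiecewisePoly_zero 𝒯 k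
  smul_mem' c _ h := h.smul c

/-- The restrictions of a piecewise polynomial to the triangles. -/
noncomputable def piecesMap (𝒯 : Triangulation Ω Γ) (k : ℕ) :
    piecewisePoly 𝒯 k →ₗ[ℝ] 𝒯.tri → MvPolynomial.restrictTotalDegree (Fin 2) ℝ k where
  toFun f t := ⟨f.2.exists_pieces.choose t, (MvPolynomial.mem_restrictTotalDegree _ _ _).2
    (f.2.exists_pieces.choose_spec.2 t)⟩
  map_add' f g := by
    ext1 t
    exact Subtype.ext ((f + g).2.exists_pieces.choose_spec.1.unique
      (f.2.exists_pieces.choose_spec.1.add g.2.exists_pieces.choose_spec.1) t.2)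
  map_smul' c f := by
    ext1 t
    exact Subtype.ext ((c • f).2.exists_pieces.choose_spec.1.unique
      (f.2.exists_pieces.choose_spec.1.smul c) t.2)

instance finiteDimensional_piecewisePoly (𝒯 : Triangulation Ω Γ) (k : ℕ) :
    FiniteDimensional ℝ (piecewisePoly 𝒯 k) := by
  refine Module.Finite.of_injective (piecesMap 𝒯 k) fun f g h => Subtype.ext ?_
  refine Triangulation.ext_pieces f.2.exists_pieces.choose_spec.1
    (g.2.exists_pieces.choose_spec.1.congr fun t ht => ?_)
  exact (congrArg Subtype.val (congrFun h ⟨t, ht⟩)).symm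

instance finiteDimensional_discreteDisplacement (𝒯 : Triangulation Ω Γ) (r : ℕ) :
    FiniteDimensional ℝ (discreteDisplacement 𝒯 r) := by
  let f : discreteDisplacement 𝒯 r →ₗ[ℝ] Fin 2 → piecewisePoly 𝒯 (r + 2) :=
    { toFun := fun v i => ⟨(v : L2Vec Ω.carrier) i, v.2.1 i⟩
      map_add' := fun _ _ => rfl
      map_smul' := fun _ _ => rfl }
  refine Module.Finite.of_injective f fun v w h => Subtype.ext (funext fun i => ?_)
  exact congrArg Subtype.val (congrFun h i)

instance finiteDimensional_discreteStress (𝒯 : Triangulation Ω Γ) (r : ℕ) :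
    FiniteDimensional ℝ (discreteStress 𝒯 r) := by
  let f : discreteStress 𝒯 r →ₗ[ℝ] Fin 2 → Fin 2 → piecewisePoly 𝒯 (r + 3) :=
    { toFun := fun τ i j => ⟨(τ : L2Mat Ω.carrier) i j, τ.2.2 i j⟩
      map_add' := fun _ _ => rfl
      map_smul' := fun _ _ => rfl }
  refine Module.Finite.of_injective f fun v w h => Subtype.ext (Matrix.ext fun i j => ?_)
  exact congrArg Subtype.val (congrFun (congrFun h i) j)

lemma innerMat_compliance {Ω : Set Plane} (lam mu : ℝ) (σ τ : L2Mat Ω) :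
    innerMat (compliance lam mu σ) τ =
      1 / (2 * mu) * (innerMat σ τ - lam / (2 * mu + 2 * lam) * inner ℝ σ.trace τ.trace) := by
  simp [innerMat, compliance, Fin.sum_univ_two, Matrix.trace_fin_two, inner_sub_left,
    real_inner_smul_left, inner_add_left, inner_add_right]
  ring

lemma innerMat_compliance_comm {Ω : Set Plane} (lam mu : ℝ) (σ τ : L2Mat Ω) :
    innerMat (compliance lam mu σ) τ = innerMat (compliance lam mu τ) σ := by
  have h : innerMat σ τ = innerMat τ σ :=
    Finset.sum_congr rfl fun i _ => Finset.sum_congr rfl fun j _ => real_inner_comm _ _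
  rw [innerMat_compliance, innerMat_compliance, h, real_inner_comm]

/-- In two dimensions `(tr τ)² ≤ 2 |τ|²`, so the compliance tensor is positive definite. -/
lemma eq_zero_of_innerMat_compliance {Ω : Set Plane} {lam mu : ℝ} (hlam : 0 < lam) (hmu : 0 < mu)
    {τ : L2Mat Ω} (h : innerMat (compliance lam mu τ) τ = 0) : τ = 0 := by
  rw [innerMat_compliance] at h
  have hk : 0 < 1 - 2 * (lam / (2 * mu + 2 * lam)) := by
    have : 1 - 2 * (lam / (2 * mu + 2 * lam)) = mu / (mu + lam) := by
      field_simp; ring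
    rw [this]; positivity
  have hk0 : 0 ≤ lam / (2 * mu + 2 * lam) := by positivity
  set k := lam / (2 * mu + 2 * lam)
  have h1 := (mul_eq_zero.1 h).resolve_left (by positivity)
  have htr : inner ℝ τ.trace τ.trace ≤
      2 * (inner ℝ (τ 0 0) (τ 0 0) + inner ℝ (τ 1 1) (τ 1 1)) := by
    have h2 : 0 ≤ inner ℝ (τ 0 0 - τ 1 1) (τ 0 0 - τ 1 1) := real_inner_self_nonneg
    rw [Matrix.trace_fin_two]
    simp only [inner_add_left, inner_add_right, inner_sub_left, inner_sub_right] at h2 ⊢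
    linarith [real_inner_comm (τ 0 0) (τ 1 1)]
  have hpos : ∀ i j, 0 ≤ inner ℝ (τ i j) (τ i j) := fun _ _ => real_inner_self_nonneg
  simp only [innerMat, Fin.sum_univ_two] at h1
  have hk2 := mul_le_mul_of_nonneg_left htr hk0
  have e0 := mul_nonneg hk.le (hpos 0 0)
  have e1 := mul_nonneg hk.le (hpos 1 1)
  have f01 := hpos 0 1
  have f10 := hpos 1 0
  refine Matrix.ext fun i j => inner_self_eq_zero (𝕜 := ℝ).1 ?_
  fin_cases i <;> fin_cases j
  · exact (mul_eq_zero.1 (le_antisymm (by linarith) e0)).resolve_left hk.ne'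
  · exact le_antisymm (by simp only [Fin.zero_eta, Fin.mk_one]; linarith) f01
  · exact le_antisymm (by simp only [Fin.zero_eta, Fin.mk_one]; linarith) f10
  · exact (mul_eq_zero.1 (le_antisymm (by linarith) e1)).resolve_left hk.ne'

/-- The form `(𝔸 ·, ·)` on `Σ_h`. -/
noncomputable def complianceForm (𝒯 : Triangulation Ω Γ) (r : ℕ) (lam mu : ℝ) :
    LinearMap.BilinForm ℝ (discreteStress 𝒯 r) :=
  LinearMap.mk₂ ℝ (fun σ τ => innerMat (compliance lam mu (σ : L2Mat Ω.carrier)) τ)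
    (fun σ σ' τ => by
      rw [innerMat_compliance, innerMat_compliance, innerMat_compliance]
      simp only [innerMat, Submodule.coe_add, Matrix.add_apply,
        Matrix.trace_add, inner_add_left, Finset.sum_add_distrib]
      ring)
    (fun c σ τ => by
      rw [innerMat_compliance, innerMat_compliance]
      simp only [innerMat, Submodule.coe_smul, Matrix.smul_apply,
        Matrix.trace_smul, real_inner_smul_left, ← Finset.mul_sum, smul_eq_mul]
      ring)
    (fun σ τ τ' => by
      simp only [innerMat, Submodule.coe_add, Matrix.add_apply, inner_add_right,
        Finset.sum_add_distrib])
    (fun c σ τ => by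
      simp only [innerMat, Submodule.coe_smul, Matrix.smul_apply, real_inner_smul_right,
        ← Finset.mul_sum, smul_eq_mul])

/-- The `L²` inner product on `U_h`. -/
noncomputable def displacementForm (𝒯 : Triangulation Ω Γ) (r : ℕ) :
    LinearMap.BilinForm ℝ (discreteDisplacement 𝒯 r) :=
  LinearMap.mk₂ ℝ (fun v w => innerVec (v : L2Vec Ω.carrier) w)
    (fun v v' w => by
      simp only [innerVec, Submodule.coe_add, Pi.add_apply, inner_add_left,
        Finset.sum_add_distrib])
    (fun c v w => by
      simp only [innerVec, Submodule.coe_smul, Pi.smul_apply, real_inner_smul_left,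
        ← Finset.mul_sum, smul_eq_mul])
    (fun v w w' => by
      simp only [innerVec, Submodule.coe_add, Pi.add_apply, inner_add_right,
        Finset.sum_add_distrib])
    (fun c v w => by
      simp only [innerVec, Submodule.coe_smul, Pi.smul_apply, real_inner_smul_right,
        ← Finset.mul_sum, smul_eq_mul])

lemma eq_zero_of_innerVec {Ω : Set Plane} {v : L2Vec Ω} (h : innerVec v v = 0) : v = 0 := by
  rw [innerVec, Finset.sum_eq_zero_iff_of_nonneg fun i _ => real_inner_self_nonneg] at h
  ext1 i
  exact inner_self_eq_zero.1 (h i (Finset.mem_univ i))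

end Triangulation

end ElasticFEM


theorem theorem2p2 (Ω : ElasticFEM.PolygonalDomain) (Γ : ElasticFEM.BoundaryParts Ω)
    (𝒯 : ElasticFEM.Triangulation Ω Γ) (r : ℕ) (lam mu : ℝ) (hlam : 0 < lam) (hmu : 0 < mu) :
    ∃ (hJ : ∀ w, ElasticFEM.airy 𝒯 r w ∈ ElasticFEM.discreteStress 𝒯 r)
      (hdiv : ∀ τ, ElasticFEM.discreteDiv 𝒯 r τ ∈ ElasticFEM.discreteDisplacement 𝒯 r),
      Function.Exact ((ElasticFEM.airy 𝒯 r).codRestrict _ hJ)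
        ((ElasticFEM.discreteDiv 𝒯 r).codRestrict _ hdiv) ∧
      Function.Surjective ((ElasticFEM.discreteDiv 𝒯 r).codRestrict _ hdiv) ∧
      (∃! ε, ElasticFEM.IsDiscreteStrain 𝒯 r lam mu ε) ∧
      ∀ ε, ElasticFEM.IsDiscreteStrain 𝒯 r lam mu ε →
        IsCompl (LinearMap.range ((ElasticFEM.airy 𝒯 r).codRestrict _ hJ)) (LinearMap.range ε) ∧
        ∀ w v, ElasticFEM.innerMat
          (ElasticFEM.compliance lam mu (ElasticFEM.airy 𝒯 r w)) (ε v) = 0 := by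
  refine ⟨ElasticFEM.airy_mem_discreteStress, ElasticFEM.discreteDiv_mem, ?_⟩
  have hexact : Function.Exact
      ((ElasticFEM.airy 𝒯 r).codRestrict _ ElasticFEM.airy_mem_discreteStress)
      ((ElasticFEM.discreteDiv 𝒯 r).codRestrict _ ElasticFEM.discreteDiv_mem) := by
    intro τ
    constructor
    · intro h
      obtain ⟨w, hw⟩ := ElasticFEM.exists_airy_eq τ (congrArg Subtype.val h)
      exact ⟨w, Subtype.ext hw⟩
    · rintro ⟨w, rfl⟩
      exact Subtype.ext (ElasticFEM.discreteDiv_airy w)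
  obtain ⟨hsurj, huniq, hcompl⟩ := ElasticFEM.exists_adjoint_decomposition
    (ElasticFEM.complianceForm 𝒯 r lam mu)
    (fun τ h => Subtype.ext (ElasticFEM.eq_zero_of_innerMat_compliance hlam hmu h))
    (ElasticFEM.displacementForm 𝒯 r)
    (fun v h => Subtype.ext (ElasticFEM.eq_zero_of_innerVec h))
    ((ElasticFEM.discreteDiv 𝒯 r).codRestrict _ ElasticFEM.discreteDiv_mem)
    (fun v h => Subtype.ext (ElasticFEM.eq_zero_of_orthogonal_div v.2 h))
  refine ⟨hexact, hsurj, huniq, fun ε hε => ⟨?_, fun w v => ?_⟩⟩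
  · rw [← LinearMap.exact_iff.1 hexact]
    exact hcompl ε hε
  · rw [ElasticFEM.innerMat_compliance_comm]
    refine (hε v ⟨ElasticFEM.airy 𝒯 r w, ElasticFEM.airy_mem_discreteStress w⟩).trans ?_
    rw [ElasticFEM.discreteDiv_airy]
    simp [ElasticFEM.innerVec]
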